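/- **Setting.** Let $m\ge 1$ be an integer, $L>0$, $Q_i=[(i-1)L,iL]\times S^1$ with coordinates $(t,\theta)$, $S^1=\mathbb R/2\pi\mathbb Z$, and $Q=Q_1\cup Q_2\cup Q_3$. For $u\in C^2(Q,\mathbb R^n)$ put $$\varphi(t)=\frac1\pi\Big(\int_0^{2\pi}u\cos m\theta\,d\theta,\int_0^{2\pi}u\sin m\theta\,d\theta\Big),\qquad g^+=\varphi'+m\varphi,$$ $$\mathcal F_i(u)=\frac{1}{2m}\,e^{mt-m(2i-1)L/2}\,g^+\big(\tfrac{(2i-1)L}{2}\big)\cdot(\cos m\theta,\sin m\theta),\qquad \gamma_i=\big|g^+\big(\tfrac{(2i-1)L}{2}\big)\big|\,e^{-(2i-1)mL/2},$$ $$E_i=\int_{Q_i}|u|^2e^{-2mt}\,dt\,d\theta,\quad E_i^*=\int_{Q_i}|\mathcal F_i(u)|^2e^{-2mt}\,dt\,d\theta,\quad E_i^\dagger=\int_{Q_i}|u-\mathcal F_i(u)|^2e^{-2mt}\,dt\,d\theta,$$ $$\lambda_i=\frac{\gamma_i}{\sqrt{E_i}}\ \ (\lambda_i=0\text{ if }E_i=0),\qquad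 \nu_i=\frac{E_i^\dagger}{E_i^*}\in[0,\infty]$$ ($\nu_i=0$ if $E_i^\dagger=E_i^*=0$, and $\nu_i=+\infty$ if $E_i^*=0<E_i^\dagger$). Quantities $\Phi_1,\Phi_2,\Phi_3\ge 0$ satisfy the three-circle inequality for $(q,L)$ if $\Phi_2\le e^{-qL}(\Phi_1+\Phi_3)$. For $q\in(0,2)$ call $L_0>0$ *admissible for $(m,q)$* if for every $L>L_0$ and every real-valued harmonic function $h$ on $Q$ with an expansion $$h=a_0+b_0t+\sum_{k\ge1}\big((a_ke^{-kt}+b_ke^{kt})\cos k\theta+(a_k'e^{-kt}+b_k'e^{kt})\sin k\theta\big),\qquad b_m=b_m'=0,$$ either $\int_{Q_2}h^2e^{-2mt}=0$ or $\int_{Q_2}h^2e^{-2mt}<e^{-qL}\big(\int_{Q_1}h^2e^{-2mt}+\int_{Q_3}h^2e^{-2mt}\big)$. **Theorem 2.10.** Let $m\ge1$ and $q\in(0,2)$. There is an admissible $L_0=L_0(m,q)$. Moreover, for any admissible $L_0$, any $L>L_1:=\max\{L_0,\frac{2\log 2}{2-q}\}$, any $\epsilon_1>0$ and any $\epsilon>0$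 there is $\delta_1>0$ (depending only on $m,q,L,\epsilon_1,\epsilon$) such that the following holds for every $n$. Let $u\in C^2(Q,\mathbb R^n)$ solve $$\Delta u=\phi(x,u,\nabla u),\qquad |\phi(x,u,\nabla u)|\le\omega\,(|u|+|\nabla u|)$$ for some nonnegative function $\omega$ on $Q$, and suppose that $$\min\{\lambda_1,\lambda_2,\lambda_3\}\ge\epsilon_1,\qquad \max\{\nu_1,\nu_2,\nu_3\}>\epsilon,\qquad \|\omega\|_{L^\infty(Q)}<\delta_1 .$$ Then both $E_i^\dagger$ and $\nu_i$ satisfy the three-circle inequality: $$E_2^\dagger\le e^{-qL}(E_1^\dagger+E_3^\dagger),\qquad \nu_2\le e^{-qL}(\nu_1+\nu_3).$$ -/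

import Mathlib

open Set MeasureTheory
open scoped ENNReal

noncomputable section

namespace Cylinder

/-! Functions on the cylinder `[0, 3L] × S¹`, where `S¹ = ℝ / 2πℤ`, are written as functions
`u : ℝ → ℝ → V` of `(t, θ)` that are `2π`-periodic in `θ`. -/

variable {V : Type*} [NormedAddCommGroup V] [NormedSpace ℝ V]

/-- `u ∈ C²(Q, V)` for the closed cylinder `Q = [0, 3L] × S¹` (up to the boundary circles). -/
def IsC2 (L : ℝ) (u : ℝ → ℝ → V) : Prop :=
  ContDiffOn ℝ 2 (Function.uncurry u) (Icc 0 (3 * L) ×ˢ univ) ∧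
    ∀ t ∈ Icc 0 (3 * L), ∀ θ, u t (θ + 2 * Real.pi) = u t θ

/-- The partial derivative `∂u/∂t`. -/
def dt (u : ℝ → ℝ → V) (t θ : ℝ) : V := deriv (fun s => u s θ) t

/-- The partial derivative `∂u/∂θ`. -/
def dθ (u : ℝ → ℝ → V) (t θ : ℝ) : V := deriv (fun s => u t s) θ

/-- The Laplacian `∂²u/∂t² + ∂²u/∂θ²` of the flat cylinder. -/
def lap (u : ℝ → ℝ → V) (t θ : ℝ) : V := dt (dt u) t θ + dθ (dθ u) t θ

/-- The length `|∇u| = (|∂u/∂t|² + |∂u/∂θ|²)^(1/2)` of the gradient. -/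
def gradNorm (u : ℝ → ℝ → V) (t θ : ℝ) : ℝ := √(‖dt u t θ‖ ^ 2 + ‖dθ u t θ‖ ^ 2)

/-- The weighted integral `∫_{Q_i} |u|² e^{-2mt} dt dθ` over `Q_i = [(i-1)L, iL] × S¹`. -/
def energy (m : ℕ) (L : ℝ) (i : ℕ) (u : ℝ → ℝ → V) : ℝ :=
  ∫ t in (((i : ℝ) - 1) * L)..(i * L), ∫ θ in (0 : ℝ)..(2 * Real.pi),
    ‖u t θ‖ ^ 2 * Real.exp (-2 * m * t)

/-- The cosine Fourier coefficient `(1/π) ∫₀^{2π} u(t,θ) cos(mθ) dθ`. -/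
def cosCoeff (m : ℕ) (u : ℝ → ℝ → V) (t : ℝ) : V :=
  (1 / Real.pi) • ∫ θ in (0 : ℝ)..(2 * Real.pi), Real.cos (m * θ) • u t θ

/-- The sine Fourier coefficient `(1/π) ∫₀^{2π} u(t,θ) sin(mθ) dθ`. -/
def sinCoeff (m : ℕ) (u : ℝ → ℝ → V) (t : ℝ) : V :=
  (1 / Real.pi) • ∫ θ in (0 : ℝ)..(2 * Real.pi), Real.sin (m * θ) • u t θ

/-- First (cosine) component of `g⁺(u) = φ' + m φ`, where `φ` is the pair of Fourier coefficients. -/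
def gPlusCos (m : ℕ) (u : ℝ → ℝ → V) (t : ℝ) : V :=
  deriv (cosCoeff m u) t + (m : ℝ) • cosCoeff m u t

/-- Second (sine) component of `g⁺(u) = φ' + m φ`. -/
def gPlusSin (m : ℕ) (u : ℝ → ℝ → V) (t : ℝ) : V :=
  deriv (sinCoeff m u) t + (m : ℝ) • sinCoeff m u t

/-- The midpoint `(2i-1)L/2` of the interval `[(i-1)L, iL]`. -/
def mid (L : ℝ) (i : ℕ) : ℝ := (2 * (i : ℝ) - 1) * L / 2

/-- The projection
`ℱ_i(u) = (2m)⁻¹ e^{mt - m(2i-1)L/2} g⁺((2i-1)L/2) · (cos mθ, sin mθ)`. -/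
def proj (m : ℕ) (L : ℝ) (i : ℕ) (u : ℝ → ℝ → V) (t θ : ℝ) : V :=
  (Real.exp (m * t - m * mid L i) / (2 * m)) •
    (Real.cos (m * θ) • gPlusCos m u (mid L i) + Real.sin (m * θ) • gPlusSin m u (mid L i))

/-- `γ_i(u) = |g⁺((2i-1)L/2)| e^{-(2i-1)mL/2}`. -/
def gamma (m : ℕ) (L : ℝ) (i : ℕ) (u : ℝ → ℝ → V) : ℝ :=
  √(‖gPlusCos m u (mid L i)‖ ^ 2 + ‖gPlusSin m u (mid L i)‖ ^ 2) * Real.exp (-(m * mid L i))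

/-- `E_i^*(u) = ∫_{Q_i} |ℱ_i(u)|² e^{-2mt} dt dθ`. -/
def energyStar (m : ℕ) (L : ℝ) (i : ℕ) (u : ℝ → ℝ → V) : ℝ :=
  energy m L i (proj m L i u)

/-- `E_i^†(u) = ∫_{Q_i} |u - ℱ_i(u)|² e^{-2mt} dt dθ`. -/
def energyDagger (m : ℕ) (L : ℝ) (i : ℕ) (u : ℝ → ℝ → V) : ℝ :=
  energy m L i (fun t θ => u t θ - proj m L i u t θ)

/-- `λ_i(u) = γ_i(u) / √E_i(u)`, with value `0` when `E_i(u) = 0`. -/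
def lam (m : ℕ) (L : ℝ) (i : ℕ) (u : ℝ → ℝ → V) : ℝ :=
  gamma m L i u / √(energy m L i u)

/-- `ν_i(u) = E_i^†(u) / E_i^*(u)` with values in `[0, ∞]`; in `ℝ≥0∞` one has `0 / 0 = 0` and
`x / 0 = ∞` for `x > 0`. -/
def nu (m : ℕ) (L : ℝ) (i : ℕ) (u : ℝ → ℝ → V) : ℝ≥0∞ :=
  ENNReal.ofReal (energyDagger m L i u) / ENNReal.ofReal (energyStar m L i u)

/-- The three-circle inequality `Φ₂ ≤ e^{-qL} (Φ₁ + Φ₃)` for quantities `Φ_i ∈ [0, ∞]`. -/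
def ThreeCircle (q L : ℝ) (Φ : ℕ → ℝ≥0∞) : Prop :=
  Φ 2 ≤ ENNReal.ofReal (Real.exp (-(q * L))) * (Φ 1 + Φ 3)

/-- `h` is a (real-valued) harmonic function on `Q = [0, 3L] × S¹`. -/
def IsHarmonic (L : ℝ) (h : ℝ → ℝ → ℝ) : Prop :=
  IsC2 L h ∧ ∀ t ∈ Ioo 0 (3 * L), ∀ θ, lap h t θ = 0

/-- On `Q` the function `h` has the expansion
`a₀ + b₀ t + ∑_{k ≥ 1} ((a_k e^{-kt} + b_k e^{kt}) cos kθ + (a'_k e^{-kt} + b'_k e^{kt}) sin kθ)`. -/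
def HasExpansion (L : ℝ) (h : ℝ → ℝ → ℝ) (a₀ b₀ : ℝ) (a b a' b' : ℕ → ℝ) : Prop :=
  ∀ t ∈ Icc 0 (3 * L), ∀ θ : ℝ,
    HasSum (fun k : ℕ =>
      (a (k + 1) * Real.exp (-((k + 1 : ℕ) * t)) + b (k + 1) * Real.exp ((k + 1 : ℕ) * t))
          * Real.cos ((k + 1 : ℕ) * θ)
        + (a' (k + 1) * Real.exp (-((k + 1 : ℕ) * t)) + b' (k + 1) * Real.exp ((k + 1 : ℕ) * t))
          * Real.sin ((k + 1 : ℕ) * θ))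
      (h t θ - (a₀ + b₀ * t))

/-- `L₀ > 0` is a constant for which the three-circle lemma for harmonic functions holds with
weight `e^{-2mt}` and exponent `q`: whenever `L > L₀` and a harmonic function on `[0, 3L] × S¹` has
no `e^{mt}` terms in its expansion, its weighted energy on `Q₂` vanishes or satisfies the strict
three-circle inequality. -/
def IsHarmonicThreshold (m : ℕ) (q L₀ : ℝ) : Prop :=
  0 < L₀ ∧ ∀ L > L₀, ∀ (h : ℝ → ℝ → ℝ) (a₀ b₀ : ℝ) (a b a' b' : ℕ → ℝ),
    IsHarmonic L h → HasExpansion L h a₀ b₀ a b a' b' → b m = 0 → b' m = 0 →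
      energy m L 2 h = 0 ∨
        energy m L 2 h < Real.exp (-(q * L)) * (energy m L 1 h + energy m L 3 h)

/-- `Δu = φ(x, u, ∇u)` on the interior of `Q` with `|φ(x, u, ∇u)| ≤ ω (|u| + |∇u|)`. Here
`x = (t, θ)`, `∇u = (∂u/∂t, ∂u/∂θ)`, and each point of `S¹` is represented by its unique
`θ ∈ [0, 2π)`. -/
def SolvesWithBound (L : ℝ) (u : ℝ → ℝ → V) (φ : ℝ × ℝ → V → V × V → V) (ω : ℝ × ℝ → ℝ) : Prop :=
  ∀ t ∈ Ioo 0 (3 * L), ∀ θ ∈ Ico 0 (2 * Real.pi),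
    lap u t θ = φ (t, θ) (u t θ) (dt u t θ, dθ u t θ) ∧
    ‖φ (t, θ) (u t θ) (dt u t θ, dθ u t θ)‖ ≤ ω (t, θ) * (‖u t θ‖ + gradNorm u t θ)

/-- The norm `‖ω‖_{L^∞(Q)}` (essential supremum). -/
def supNorm (L : ℝ) (ω : ℝ × ℝ → ℝ) : ℝ≥0∞ :=
  eLpNorm ω ∞ (volume.restrict (Icc 0 (3 * L) ×ˢ Ico 0 (2 * Real.pi)))

end Cylinder

end

/-!
Write `v = u - ℱ_2(u)`. The coefficient of `e^{mt}` in the Fourier mode of degree `m` is read off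
from `c' + m c`, and `ℱ_2` is chosen so that this quantity vanishes for `v` at the midpoint of the
cylinder. Hence `v` differs from a harmonic function without `e^{mt}` terms by an error that is
controlled by the source `Δv = Δu`, and for such harmonic functions the three-circle inequality
holds with room to spare.

*Harmonic functions.* By Parseval's identity in `θ` the inequality may be checked mode by mode, on
solutions of `c'' = k² c` (`ModeBound`). For `k > m` it follows with the constant `2 e^{-2L}` from
`2 cosh(kL) c(t) = c(t - L) + c(t + L)` (`modeBound_of_gt`), and for `k = m` it is explicit
(`modeBound_self`). For the finitely many `k < m` it holds when `L` is large
(`exists_modeBound_of_lt`), which yields an admissible `L₀` (`exists_isHarmonicThreshold`). The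
coefficients of an expansion that is only assumed to converge pointwise are identified with the
Fourier coefficients through the Denjoy–Luzin theorem
(`summable_of_forall_summable_mul_sin`). Conversely, an arbitrary admissible `L₀` gives a strict
inequality for each single mode `k < m`, and compactness of the circle of solutions up to scaling
turns it into a constant below `e^{-qL}` (`IsHarmonicThreshold.exists_forall_modeBound`); the
condition `L > 2 log 2 / (2 - q)` serves the modes `k ≥ m`.

*Sources.* For `c'' = k² c + f` on `[0, 3L]` let `e` be the difference of `c` and the homogeneous
solution with the same boundary values. Testing the equation with the concave weight `t (3L - t)`
bounds `e` in `L²` by `t (3L - t) f`, uniformly in `k` (`integral_sq_le_of_boundary_zero`); for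
`k = m` the `e^{mt}` term of the homogeneous solution is controlled as well, because `c' + m c`
vanishes at the midpoint (`exists_hom_approx`). Summing over the modes gives the three-circle
inequality with an additional multiple of the `sourceEnergy` (`exists_source_bound`). The
degenerate weight is what makes the source small: no bound for `∇u` up to the boundary circles is
available, but the interior Caccioppoli inequality bounds the weighted energy of `Δu` by `‖ω‖²`
times that of `u` (`C2Data.sourceEnergy_le`).

*Conclusion.* As `λ_i ≥ ε₁`, the energy of `u` is bounded by the `γ_i²`. These and the
`ℱ_i(u)` depend on `i` only up to the source (`norm_grow_sub_sq_le`), so all `E_i^*` are nearly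
equal, and `ν_i > ε` for one `i` makes the source negligible against the `E_i^†`. The gap between
the constant for the modes and `e^{-qL}` absorbs all these errors (`three_circle_of_perturbed`).
-/

noncomputable section

namespace Cylinder

/-! ### Solutions of `c'' = k² c` and their weighted energies -/

/-- The general solution of `c'' = k² c`, written `a + b t` for `k = 0` and
`a e^{-kt} + b e^{kt}` for `k ≥ 1`. -/
def hom (k : ℕ) (a b t : ℝ) : ℝ :=
  if k = 0 then a + b * t else a * Real.exp (-(k * t)) + b * Real.exp (k * t)

/-- The derivative of `hom k a b`. -/
def homDeriv (k : ℕ) (a b t : ℝ) : ℝ :=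
  if k = 0 then b else -(k * a * Real.exp (-(k * t))) + k * b * Real.exp (k * t)

lemma hasDerivAt_hom (k : ℕ) (a b t : ℝ) : HasDerivAt (hom k a b) (homDeriv k a b t) t := by
  unfold hom homDeriv
  split_ifs
  · simpa using ((hasDerivAt_id t).const_mul b).const_add a
  · have h1 : HasDerivAt (fun t : ℝ => (k : ℝ) * t) k t := by
      simpa using (hasDerivAt_id t).const_mul (k : ℝ)
    refine ((h1.neg.exp.const_mul a).add (h1.exp.const_mul b)).congr_deriv ?_
    simp only [Pi.neg_apply]
    ring

lemma hasDerivAt_homDeriv (k : ℕ) (a b t : ℝ) :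
    HasDerivAt (homDeriv k a b) ((k : ℝ) ^ 2 * hom k a b t) t := by
  unfold hom homDeriv
  split_ifs with h
  · simpa [h] using hasDerivAt_const t b
  · have h1 : HasDerivAt (fun t : ℝ => (k : ℝ) * t) k t := by
      simpa using (hasDerivAt_id t).const_mul (k : ℝ)
    refine ((h1.neg.exp.const_mul (k * a)).neg.add (h1.exp.const_mul (k * b))).congr_deriv ?_
    simp only [Pi.neg_apply]
    ring

lemma continuous_hom (k : ℕ) :
    Continuous (fun x : (ℝ × ℝ) × ℝ => hom k x.1.1 x.1.2 x.2) := by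
  unfold hom
  split_ifs <;> fun_prop

lemma continuous_hom_right (k : ℕ) (a b : ℝ) : Continuous (hom k a b) :=
  (continuous_hom k).comp (Continuous.prodMk (continuous_const (y := (a, b))) continuous_id)

lemma hom_smul (k : ℕ) (r a b t : ℝ) : hom k (r * a) (r * b) t = r * hom k a b t := by
  unfold hom
  split_ifs <;> ring

/-- A solution is uniquely determined by its values at two different points, and these values are
arbitrary. -/
lemma exists_hom_eq (k : ℕ) {x y : ℝ} (hxy : x < y) (α β : ℝ) :
    ∃ a b, hom k a b x = α ∧ hom k a b y = β := by
  have hd : 0 < y - x := sub_pos.2 hxy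
  unfold hom
  split_ifs with h
  · refine ⟨α - (β - α) / (y - x) * x, (β - α) / (y - x), by ring, ?_⟩
    field_simp
    ring
  · have hk : (0 : ℝ) < k := by positivity
    have e : ∀ t : ℝ, Real.exp (-(k * t)) = (Real.exp (k * t))⁻¹ := fun t => Real.exp_neg _
    simp only [e]
    have hX := Real.exp_pos (k * x)
    have hY := Real.exp_pos (k * y)
    have hlt : Real.exp (k * x) < Real.exp (k * y) := Real.exp_lt_exp.2 (by nlinarith)
    set X := Real.exp (k * x)
    set Y := Real.exp (k * y)
    have hD : Y ^ 2 - X ^ 2 ≠ 0 := by nlinarith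
    refine ⟨(α * Y - β * X) * X * Y / (Y ^ 2 - X ^ 2), (β * Y - α * X) / (Y ^ 2 - X ^ 2), ?_, ?_⟩
    · field_simp
      ring
    · field_simp
      ring

lemma hom_eq_zero (k : ℕ) {x y a b : ℝ} (hxy : x < y) (hx : hom k a b x = 0)
    (hy : hom k a b y = 0) : a = 0 ∧ b = 0 := by
  have hd : 0 < y - x := sub_pos.2 hxy
  unfold hom at hx hy
  split_ifs at hx hy with h
  · have : b * (y - x) = 0 := by linarith
    have hb : b = 0 := (mul_eq_zero.1 this).resolve_right hd.ne'
    subst hb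
    exact ⟨by linarith, rfl⟩
  · have hk : (0 : ℝ) < k := by positivity
    have e : ∀ t : ℝ, Real.exp (-(k * t)) = (Real.exp (k * t))⁻¹ := fun t => Real.exp_neg _
    simp only [e] at hx hy
    have hX := Real.exp_pos (k * x)
    have hY := Real.exp_pos (k * y)
    have hlt : Real.exp (k * x) < Real.exp (k * y) := Real.exp_lt_exp.2 (by nlinarith)
    set X := Real.exp (k * x)
    set Y := Real.exp (k * y)
    have hD : Y ^ 2 - X ^ 2 ≠ 0 := by nlinarith
    have hx' : a + b * X ^ 2 = 0 := by
      have : a + b * X ^ 2 = X * (a * X⁻¹ + b * X) := by field_simp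
      rw [this, hx, mul_zero]
    have hy' : a + b * Y ^ 2 = 0 := by
      have : a + b * Y ^ 2 = Y * (a * Y⁻¹ + b * Y) := by field_simp
      rw [this, hy, mul_zero]
    have : b * (Y ^ 2 - X ^ 2) = 0 := by linarith
    have hb : b = 0 := (mul_eq_zero.1 this).resolve_right hD
    subst hb
    exact ⟨by linarith, rfl⟩

lemma two_mul_cosh_mul_hom {k : ℕ} (hk : k ≠ 0) (a b t s : ℝ) :
    (Real.exp (k * s) + Real.exp (-(k * s))) * hom k a b t
      = hom k a b (t - s) + hom k a b (t + s) := by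
  simp only [hom, if_neg hk, mul_sub, mul_add, neg_sub, neg_add, Real.exp_add, Real.exp_sub,
    Real.exp_neg]
  field_simp
  ring

/-- The weighted energy `∫_x^y c² e^{-2mt} dt` of a function of `t` alone. -/
def segEnergy (m : ℕ) (x y : ℝ) (c : ℝ → ℝ) : ℝ := ∫ t in x..y, c t ^ 2 * Real.exp (-2 * m * t)

lemma segEnergy_nonneg (m : ℕ) {x y : ℝ} (hxy : x ≤ y) (c : ℝ → ℝ) : 0 ≤ segEnergy m x y c :=
  intervalIntegral.integral_nonneg hxy fun _ _ => by positivity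

lemma intervalIntegrable_segEnergy (m : ℕ) (x y : ℝ) {c : ℝ → ℝ} (hc : Continuous c) :
    IntervalIntegrable (fun t => c t ^ 2 * Real.exp (-2 * m * t)) volume x y :=
  Continuous.intervalIntegrable (by fun_prop) _ _

lemma segEnergy_mul (m : ℕ) (x y r : ℝ) (c : ℝ → ℝ) :
    segEnergy m x y (fun t => r * c t) = r ^ 2 * segEnergy m x y c := by
  unfold segEnergy
  rw [← intervalIntegral.integral_const_mul]
  congr 1
  ext t
  ring

lemma segEnergy_eq_zero (m : ℕ) {x y : ℝ} (hxy : x < y) {c : ℝ → ℝ} (hc : Continuous c)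
    (h : segEnergy m x y c = 0) : ∀ t ∈ Icc x y, c t = 0 := by
  by_contra! hne
  obtain ⟨t, ht, hct⟩ := hne
  have hcont : Continuous fun t => c t ^ 2 * Real.exp (-2 * m * t) := by fun_prop
  have : 0 < segEnergy m x y c :=
    intervalIntegral.integral_pos hxy hcont.continuousOn (fun _ _ => by positivity)
      ⟨t, ht, by positivity⟩
  exact this.ne' h

lemma continuous_segEnergy_hom (m : ℕ) (x y : ℝ) (k : ℕ) :
    Continuous fun p : ℝ × ℝ => segEnergy m x y (hom k p.1 p.2) := by
  unfold segEnergy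
  refine intervalIntegral.continuous_parametric_intervalIntegral_of_continuous' ?_ _ _
  have := continuous_hom k
  simp only [Function.uncurry_def]
  fun_prop

lemma segEnergy_hom_smul (m : ℕ) (x y : ℝ) (k : ℕ) (r a b : ℝ) :
    segEnergy m x y (hom k (r * a) (r * b)) = r ^ 2 * segEnergy m x y (hom k a b) := by
  rw [← segEnergy_mul]
  congr 1
  ext t
  exact hom_smul k r a b t

/-- A positive continuous `2`-homogeneous function on the plane dominates every other one: by
compactness it is bounded below on the unit circle. -/
lemma exists_coercive {G X : ℝ × ℝ → ℝ} (hG : Continuous G) (hX : Continuous X)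
    (hGhom : ∀ r a b, G (r * a, r * b) = r ^ 2 * G (a, b))
    (hXhom : ∀ r a b, X (r * a, r * b) = r ^ 2 * X (a, b))
    (hpos : ∀ a b, (a ≠ 0 ∨ b ≠ 0) → 0 < G (a, b)) :
    ∃ c > 0, ∀ a b, c * X (a, b) ≤ G (a, b) := by
  set S : Set (ℝ × ℝ) := {p : ℝ × ℝ | p.1 ^ 2 + p.2 ^ 2 = 1} with hS
  have hcomp : IsCompact S := by
    refine (isCompact_Icc (a := ((-1, -1) : ℝ × ℝ)) (b := (1, 1))).of_isClosed_subset
      (isClosed_eq (by fun_prop) continuous_const) ?_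
    rintro ⟨a, b⟩ h
    simp only [hS, mem_ofPred_eq] at h
    simp only [mem_Icc, Prod.mk_le_mk]
    refine ⟨⟨?_, ?_⟩, ?_, ?_⟩ <;> nlinarith [sq_nonneg a, sq_nonneg b]
  obtain ⟨p, hp, hmin⟩ := hcomp.exists_isMinOn ⟨(1, 0), by simp [hS]⟩ hG.continuousOn
  obtain ⟨C, hC⟩ := hcomp.exists_bound_of_continuousOn hX.continuousOn
  have hGp : 0 < G p := by
    refine hpos p.1 p.2 ?_
    by_contra! h
    simp [hS, h.1, h.2] at hp
  have hC' : 0 < max C 1 := lt_of_lt_of_le one_pos (le_max_right _ _)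
  refine ⟨G p / max C 1, by positivity, fun a b => ?_⟩
  by_cases hab : a ^ 2 + b ^ 2 = 0
  · have ha : a = 0 := by nlinarith [sq_nonneg a, sq_nonneg b]
    have hb : b = 0 := by nlinarith [sq_nonneg a, sq_nonneg b]
    have h1 := hGhom 0 a b
    have h2 := hXhom 0 a b
    simp only [zero_mul, ne_eq, OfNat.ofNat_ne_zero, not_false_eq_true, zero_pow] at h1 h2
    rw [ha, hb, h1, h2, mul_zero]
  · have hr : 0 < a ^ 2 + b ^ 2 := lt_of_le_of_ne (by positivity) (Ne.symm hab)
    set r := √(a ^ 2 + b ^ 2) with hrdef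
    have hr0 : 0 < r := Real.sqrt_pos.2 hr
    have hr2 : r ^ 2 = a ^ 2 + b ^ 2 := Real.sq_sqrt hr.le
    have hmem : ((a / r, b / r) : ℝ × ℝ) ∈ S := by
      simp only [hS, mem_ofPred_eq, div_pow, ← add_div, hr2]
      exact div_self hab
    have h1 : G p ≤ G (a / r, b / r) := hmin hmem
    have h3 : X (a / r, b / r) ≤ max C 1 :=
      ((le_abs_self _).trans (hC _ hmem)).trans (le_max_left _ _)
    have h2 := hGhom r (a / r) (b / r)
    have h4 := hXhom r (a / r) (b / r)
    rw [mul_div_cancel₀ _ hr0.ne', mul_div_cancel₀ _ hr0.ne'] at h2 h4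
    rw [h2, h4]
    have h5 : G p / max C 1 * X (a / r, b / r) ≤ G p := by
      calc G p / max C 1 * X (a / r, b / r) ≤ G p / max C 1 * max C 1 := by gcongr
        _ = G p := by field_simp
    nlinarith [sq_nonneg r]

lemma segEnergy_hom_pos (m : ℕ) {x y : ℝ} (hxy : x < y) (k : ℕ) {a b : ℝ} (hab : a ≠ 0 ∨ b ≠ 0) :
    0 < segEnergy m x y (hom k a b) := by
  refine lt_of_le_of_ne (segEnergy_nonneg m hxy.le _) fun h => ?_
  have h0 := segEnergy_eq_zero m hxy (continuous_hom_right k a b) h.symm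
  obtain ⟨ha, hb⟩ := hom_eq_zero k hxy (h0 x (left_mem_Icc.2 hxy.le))
    (h0 y (right_mem_Icc.2 hxy.le))
  tauto

/-! ### The three-circle inequality for a single Fourier mode -/

/-- The three-circle inequality with constant `κ` for all solutions of `c'' = k² c`; for `k = m`
only for the solutions without an `e^{mt}` term. -/
def ModeBound (m : ℕ) (L κ : ℝ) (k : ℕ) : Prop :=
  ∀ a b : ℝ, (k = m → b = 0) → segEnergy m L (2 * L) (hom k a b) ≤
    κ * (segEnergy m 0 L (hom k a b) + segEnergy m (2 * L) (3 * L) (hom k a b))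

lemma ModeBound.mono {m : ℕ} {L κ κ' : ℝ} {k : ℕ} (hL : 0 < L) (h : ModeBound m L κ k)
    (hκ : κ ≤ κ') : ModeBound m L κ' k := fun a b hb =>
  (h a b hb).trans (mul_le_mul_of_nonneg_right hκ
    (add_nonneg (segEnergy_nonneg m hL.le _) (segEnergy_nonneg m (by linarith) _)))

/-- For `k > m` the identity `2 cosh(kL) c(t) = c(t - L) + c(t + L)` gives the three-circle
inequality with a constant that does not depend on `k`. -/
lemma modeBound_of_gt {m k : ℕ} (hk : m < k) {L : ℝ} (hL : 0 < L) :
    ModeBound m L (2 * Real.exp (-(2 * L))) k := by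
  intro a b _
  set c := hom k a b with hcdef
  have hc : Continuous c := continuous_hom_right k a b
  have e1 : segEnergy m 0 L c
      = ∫ t in L..(2 * L), c (t - L) ^ 2 * Real.exp (-2 * m * (t - L)) := by
    rw [intervalIntegral.integral_comp_sub_right
      (fun t => c t ^ 2 * Real.exp (-2 * m * t)) L]
    unfold segEnergy
    congr 1 <;> ring
  have e2 : segEnergy m (2 * L) (3 * L) c
      = ∫ t in L..(2 * L), c (t + L) ^ 2 * Real.exp (-2 * m * (t + L)) := by
    rw [intervalIntegral.integral_comp_add_right
      (fun t => c t ^ 2 * Real.exp (-2 * m * t)) L]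
    unfold segEnergy
    congr 1 <;> ring
  rw [e1, e2, ← intervalIntegral.integral_add (Continuous.intervalIntegrable (by fun_prop) _ _)
    (Continuous.intervalIntegrable (by fun_prop) _ _), ← intervalIntegral.integral_const_mul]
  refine intervalIntegral.integral_mono_on (by linarith)
    (intervalIntegrable_segEnergy m _ _ hc)
    (Continuous.intervalIntegrable (by fun_prop) _ _) fun t _ => ?_
  have hid := two_mul_cosh_mul_hom (by omega : k ≠ 0) a b t L
  rw [← hcdef] at hid
  have hkm : (m : ℝ) + 1 ≤ k := by exact_mod_cast hk
  have hm0 : (0 : ℝ) ≤ m := by positivity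
  have hP : Real.exp (k * L) * |c t| ≤ |c (t - L)| + |c (t + L)| := by
    have h1 : Real.exp (k * L) * |c t| ≤ (Real.exp (k * L) + Real.exp (-(k * L))) * |c t| := by
      gcongr
      linarith [Real.exp_pos (-(k * L))]
    refine h1.trans ?_
    have h2 : (Real.exp (k * L) + Real.exp (-(k * L))) * |c t| = |c (t - L) + c (t + L)| := by
      rw [← hid, abs_mul, abs_of_pos (add_pos (Real.exp_pos _) (Real.exp_pos _))]
    rw [h2]
    exact abs_add_le _ _
  have hsq : Real.exp (k * L) ^ 2 * c t ^ 2 ≤ 2 * (c (t - L) ^ 2 + c (t + L) ^ 2) := by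
    have h1 : (Real.exp (k * L) * |c t|) ^ 2 ≤ (|c (t - L)| + |c (t + L)|) ^ 2 :=
      pow_le_pow_left₀ (by positivity) hP 2
    rw [mul_pow, sq_abs] at h1
    nlinarith [sq_abs (c (t - L)), sq_abs (c (t + L)), sq_nonneg (|c (t - L)| - |c (t + L)|)]
  have hct : c t ^ 2 ≤ 2 * Real.exp (-(2 * (k * L))) * (c (t - L) ^ 2 + c (t + L) ^ 2) := by
    have h3 : Real.exp (-(2 * (k * L))) * Real.exp (k * L) ^ 2 = 1 := by
      rw [← Real.exp_nat_mul, ← Real.exp_add]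
      simp
    calc c t ^ 2 = Real.exp (-(2 * (k * L))) * (Real.exp (k * L) ^ 2 * c t ^ 2) := by
          rw [← mul_assoc, h3, one_mul]
      _ ≤ Real.exp (-(2 * (k * L))) * (2 * (c (t - L) ^ 2 + c (t + L) ^ 2)) := by gcongr
      _ = _ := by ring
  have b1 : Real.exp (-(2 * (k * L))) * Real.exp (-2 * m * t)
      ≤ Real.exp (-(2 * L)) * Real.exp (-2 * m * (t - L)) := by
    rw [← Real.exp_add, ← Real.exp_add]
    apply Real.exp_le_exp.2
    nlinarith
  have b2 : Real.exp (-(2 * (k * L))) * Real.exp (-2 * m * t)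
      ≤ Real.exp (-(2 * L)) * Real.exp (-2 * m * (t + L)) := by
    rw [← Real.exp_add, ← Real.exp_add]
    apply Real.exp_le_exp.2
    nlinarith
  calc c t ^ 2 * Real.exp (-2 * m * t)
      ≤ 2 * Real.exp (-(2 * (k * L))) * (c (t - L) ^ 2 + c (t + L) ^ 2)
          * Real.exp (-2 * m * t) := by
        gcongr
    _ = 2 * c (t - L) ^ 2 * (Real.exp (-(2 * (k * L))) * Real.exp (-2 * m * t))
        + 2 * c (t + L) ^ 2 * (Real.exp (-(2 * (k * L))) * Real.exp (-2 * m * t)) := by ring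
    _ ≤ 2 * c (t - L) ^ 2 * (Real.exp (-(2 * L)) * Real.exp (-2 * m * (t - L)))
        + 2 * c (t + L) ^ 2 * (Real.exp (-(2 * L)) * Real.exp (-2 * m * (t + L))) := by gcongr
    _ = _ := by ring

/-- For `k = m` the remaining solution is a multiple of `e^{-mt}`. -/
lemma modeBound_self {m : ℕ} (hm : 1 ≤ m) {L : ℝ} (hL : 0 < L) :
    ModeBound m L (2 * Real.exp (-(2 * L))) m := by
  intro a b hb
  rw [hb rfl]
  have hc : Continuous (hom m a 0) := continuous_hom_right m a 0
  have e1 : segEnergy m 0 L (hom m a 0)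
      = ∫ t in L..(2 * L), hom m a 0 (t - L) ^ 2 * Real.exp (-2 * m * (t - L)) := by
    rw [intervalIntegral.integral_comp_sub_right
      (fun t => hom m a 0 t ^ 2 * Real.exp (-2 * m * t)) L]
    unfold segEnergy
    congr 1 <;> ring
  have h3 := segEnergy_nonneg m (by linarith : 2 * L ≤ 3 * L) (hom m a 0)
  have hmain : segEnergy m L (2 * L) (hom m a 0)
      ≤ 2 * Real.exp (-(2 * L)) * segEnergy m 0 L (hom m a 0) := by
    rw [e1, ← intervalIntegral.integral_const_mul]
    refine intervalIntegral.integral_mono_on (by linarith)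
      (intervalIntegrable_segEnergy m _ _ hc)
      (Continuous.intervalIntegrable (by fun_prop) _ _) fun t _ => ?_
    have hm1 : (1 : ℝ) ≤ m := by exact_mod_cast hm
    have hm0 : m ≠ 0 := by omega
    simp only [hom, if_neg hm0, zero_mul, add_zero, mul_pow, ← Real.exp_nat_mul]
    have hb : Real.exp ((2 : ℕ) * -(m * t)) * Real.exp (-2 * m * t) ≤
        Real.exp (-(2 * L)) *
          (Real.exp ((2 : ℕ) * -(m * (t - L))) * Real.exp (-2 * m * (t - L))) := by
      rw [← Real.exp_add, ← Real.exp_add, ← Real.exp_add]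
      apply Real.exp_le_exp.2
      push_cast
      nlinarith
    have : 0 ≤ a ^ 2 * (Real.exp (-(2 * L)) *
      (Real.exp ((2 : ℕ) * -(m * (t - L))) * Real.exp (-2 * m * (t - L)))) := by positivity
    nlinarith [mul_le_mul_of_nonneg_left hb (sq_nonneg a)]
  refine hmain.trans ?_
  gcongr
  linarith

/-- If the three-circle inequality holds strictly for each nonzero solution of `c'' = k² c`, it
holds with a smaller constant for all of them, since these form a two-dimensional space. -/
lemma exists_modeBound_of_strict {m k : ℕ} {L μ : ℝ} (hL : 0 < L) (hμ : 0 < μ)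
    (h : ∀ a b, segEnergy m L (2 * L) (hom k a b) = 0 ∨ segEnergy m L (2 * L) (hom k a b) <
      μ * (segEnergy m 0 L (hom k a b) + segEnergy m (2 * L) (3 * L) (hom k a b))) :
    ∃ κ, 0 ≤ κ ∧ κ < μ ∧ ModeBound m L κ k := by
  let X : ℝ × ℝ → ℝ := fun p => segEnergy m 0 L (hom k p.1 p.2) +
    segEnergy m (2 * L) (3 * L) (hom k p.1 p.2)
  let Y : ℝ × ℝ → ℝ := fun p => segEnergy m L (2 * L) (hom k p.1 p.2)
  have hX : Continuous X :=
    (continuous_segEnergy_hom m _ _ k).add (continuous_segEnergy_hom m _ _ k)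
  have hY : Continuous Y := continuous_segEnergy_hom m _ _ k
  have hXhom : ∀ r a b, X (r * a, r * b) = r ^ 2 * X (a, b) := fun r a b => by
    simp only [X, segEnergy_hom_smul]
    ring
  have hYhom : ∀ r a b, Y (r * a, r * b) = r ^ 2 * Y (a, b) := fun r a b => by
    simp only [Y, segEnergy_hom_smul]
  obtain ⟨c, hc, hcX⟩ := exists_coercive (G := fun p => μ * X p - Y p) (X := X) (by fun_prop) hX
    (fun r a b => by rw [hXhom, hYhom]; ring) hXhom (fun a b hab => by
      have h1 := segEnergy_hom_pos m (by linarith : L < 2 * L) k hab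
      rcases h a b with h0 | h0
      · exact absurd h0 h1.ne'
      · exact sub_pos.2 h0)
  have hX0 : ∀ a b, 0 ≤ X (a, b) := fun a b =>
    add_nonneg (segEnergy_nonneg m hL.le _) (segEnergy_nonneg m (by linarith) _)
  refine ⟨max 0 (μ - c), le_max_left _ _, max_lt hμ (by linarith), fun a b _ => ?_⟩
  have h1 := hcX a b
  have h2 : (μ - c) * X (a, b) ≤ max 0 (μ - c) * X (a, b) :=
    mul_le_mul_of_nonneg_right (le_max_right _ _) (hX0 a b)
  change Y (a, b) ≤ max 0 (μ - c) * X (a, b)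
  linarith

/-- For `k < m` both solutions decay after multiplication with the weight `e^{-mt}`, at least like
`e^{-t}` up to a linear factor, and their coefficients are controlled by the energy on `[0, 1]`. -/
lemma exists_modeBound_of_lt {m k : ℕ} (hk : k < m) :
    ∃ K > 0, ∀ L, 1 ≤ L → ModeBound m L (K * (1 + 4 * L ^ 2) * L * Real.exp (-(2 * L))) k := by
  obtain ⟨c, hc, hcX⟩ := exists_coercive (G := fun p => segEnergy m 0 1 (hom k p.1 p.2))
    (X := fun p => p.1 ^ 2 + p.2 ^ 2) (continuous_segEnergy_hom m 0 1 k) (by fun_prop)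
    (fun r a b => segEnergy_hom_smul m 0 1 k r a b) (fun r a b => by ring)
    (fun a b hab => segEnergy_hom_pos m one_pos k hab)
  refine ⟨2 / c, by positivity, fun L hL a b _ => ?_⟩
  have hkm : (k : ℝ) + 1 ≤ m := by exact_mod_cast hk
  have hk0 : (0 : ℝ) ≤ k := by positivity
  have hpt : ∀ t ∈ Icc L (2 * L), hom k a b t ^ 2 * Real.exp (-2 * m * t) ≤
      2 * (a ^ 2 + b ^ 2) * (1 + 4 * L ^ 2) * Real.exp (-(2 * L)) := by
    intro t ht
    have ht0 : 0 ≤ t := by linarith [ht.1]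
    have hhom : hom k a b t ^ 2 ≤ 2 * (a ^ 2 + b ^ 2) * (1 + 4 * L ^ 2) * Real.exp (2 * k * t) := by
      unfold hom
      split_ifs with h
      · have h1 : (a + b * t) ^ 2 ≤ 2 * (a ^ 2 + b ^ 2 * t ^ 2) := by
          nlinarith [sq_nonneg (a - b * t)]
        have h2 : t ^ 2 ≤ 4 * L ^ 2 := by nlinarith [ht.2]
        subst h
        simp only [Nat.cast_zero, mul_zero, zero_mul, Real.exp_zero, mul_one]
        nlinarith [mul_le_mul_of_nonneg_left h2 (sq_nonneg b), sq_nonneg a, sq_nonneg b,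
          mul_nonneg (sq_nonneg a) (sq_nonneg L)]
      · have h1 : Real.exp (-(k * t)) ≤ Real.exp (k * t) := Real.exp_le_exp.2 (by nlinarith)
        have h2 : |a * Real.exp (-(k * t)) + b * Real.exp (k * t)|
            ≤ (|a| + |b|) * Real.exp (k * t) := by
          refine (abs_add_le _ _).trans ?_
          rw [abs_mul, abs_mul, Real.abs_exp, Real.abs_exp, add_mul]
          gcongr
        have h3 := pow_le_pow_left₀ (abs_nonneg _) h2 2
        rw [sq_abs, mul_pow, ← Real.exp_nat_mul] at h3
        refine h3.trans ?_
        have h4 : Real.exp ((2 : ℕ) * (k * t)) = Real.exp (2 * k * t) := by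
          congr 1
          push_cast
          ring
        rw [h4]
        gcongr
        nlinarith [sq_abs a, sq_abs b, sq_nonneg (|a| - |b|),
          mul_nonneg (add_nonneg (sq_nonneg a) (sq_nonneg b)) (sq_nonneg L)]
    calc hom k a b t ^ 2 * Real.exp (-2 * m * t)
        ≤ 2 * (a ^ 2 + b ^ 2) * (1 + 4 * L ^ 2) * Real.exp (2 * k * t) * Real.exp (-2 * m * t) := by
          gcongr
      _ = 2 * (a ^ 2 + b ^ 2) * (1 + 4 * L ^ 2)
            * (Real.exp (2 * k * t) * Real.exp (-2 * m * t)) := by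
          ring
      _ ≤ _ := by
          gcongr
          rw [← Real.exp_add]
          apply Real.exp_le_exp.2
          nlinarith [ht.1]
  have hcont := continuous_hom_right k a b
  have h1 : segEnergy m L (2 * L) (hom k a b) ≤
      2 * (a ^ 2 + b ^ 2) * (1 + 4 * L ^ 2) * Real.exp (-(2 * L)) * L := by
    have := intervalIntegral.integral_mono_on (by linarith : L ≤ 2 * L)
      (intervalIntegrable_segEnergy m L (2 * L) hcont)
      (intervalIntegrable_const
        (c := 2 * (a ^ 2 + b ^ 2) * (1 + 4 * L ^ 2) * Real.exp (-(2 * L)))) hpt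
    rw [intervalIntegral.integral_const, smul_eq_mul] at this
    refine this.trans (le_of_eq ?_)
    ring
  have h2 : segEnergy m 0 1 (hom k a b) ≤ segEnergy m 0 L (hom k a b) :=
    intervalIntegral.integral_mono_interval le_rfl zero_le_one hL
      (Filter.Eventually.of_forall fun t => by positivity)
      (intervalIntegrable_segEnergy m 0 L hcont)
  have h3 := segEnergy_nonneg m (by linarith : 2 * L ≤ 3 * L) (hom k a b)
  have h4 : a ^ 2 + b ^ 2 ≤ segEnergy m 0 L (hom k a b) / c := by
    rw [le_div_iff₀ hc, mul_comm]
    exact (hcX a b).trans h2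
  have h5 : 0 ≤ (1 + 4 * L ^ 2) * Real.exp (-(2 * L)) * L := by positivity
  calc segEnergy m L (2 * L) (hom k a b)
      ≤ 2 * (a ^ 2 + b ^ 2) * (1 + 4 * L ^ 2) * Real.exp (-(2 * L)) * L := h1
    _ = 2 * ((1 + 4 * L ^ 2) * Real.exp (-(2 * L)) * L) * (a ^ 2 + b ^ 2) := by ring
    _ ≤ 2 * ((1 + 4 * L ^ 2) * Real.exp (-(2 * L)) * L) * (segEnergy m 0 L (hom k a b) / c) := by
        gcongr
    _ = 2 / c * (1 + 4 * L ^ 2) * L * Real.exp (-(2 * L)) * segEnergy m 0 L (hom k a b) := by ring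
    _ ≤ _ := by
        gcongr
        linarith

/-- For large `L` a single constant below `e^{-qL}` works for all modes. -/
lemma exists_forall_modeBound {m : ℕ} (hm : 1 ≤ m) {q : ℝ} (hq : q < 2) :
    ∃ L₀ : ℝ, 0 < L₀ ∧ ∀ L > L₀, ∃ κ, 0 ≤ κ ∧ κ < Real.exp (-(q * L)) ∧ ∀ k, ModeBound m L κ k := by
  have hK : ∃ K > 0, ∀ k < m, ∀ L, 1 ≤ L →
      ModeBound m L (K * (1 + 4 * L ^ 2) * L * Real.exp (-(2 * L))) k := by
    choose! K hK0 hK using fun k (hk : k < m) => exists_modeBound_of_lt hk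
    refine ⟨∑ k ∈ Finset.range m, K k, Finset.sum_pos (fun k hk => hK0 k (Finset.mem_range.1 hk))
      ⟨0, Finset.mem_range.2 (by omega)⟩, fun k hk L hL => (hK k hk L hL).mono (by linarith) ?_⟩
    gcongr
    exact Finset.single_le_sum (fun i hi => (hK0 i (Finset.mem_range.1 hi)).le)
      (Finset.mem_range.2 hk)
  obtain ⟨K, hK0, hK⟩ := hK
  have hr : 0 < 2 - q := by linarith
  have hlim : Filter.Tendsto
      (fun L : ℝ => (2 + K * (1 + 4 * L ^ 2) * L) * Real.exp (-((2 - q) * L)))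
      Filter.atTop (nhds 0) := by
    have hp : ∀ n : ℕ, Filter.Tendsto (fun L : ℝ => L ^ n * Real.exp (-((2 - q) * L)))
        Filter.atTop (nhds 0) := fun n => by
      have := tendsto_rpow_mul_exp_neg_mul_atTop_nhds_zero n (2 - q) hr
      refine this.congr fun L => ?_
      rw [Real.rpow_natCast, neg_mul]
    have := (((hp 0).const_mul 2).add ((hp 1).const_mul K)).add ((hp 3).const_mul (4 * K))
    simp only [mul_zero, add_zero] at this
    refine this.congr fun L => ?_
    ring
  obtain ⟨L₁, hL₁⟩ := Filter.eventually_atTop.1 (hlim.eventually_lt_const one_pos)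
  refine ⟨max L₁ 1, lt_of_lt_of_le one_pos (le_max_right _ _), fun L hL => ?_⟩
  have hL1 : 1 ≤ L := (le_max_right _ _).trans hL.le
  have hL0 : 0 < L := by linarith
  have hlt := hL₁ L ((le_max_left _ _).trans hL.le)
  refine ⟨(2 + K * (1 + 4 * L ^ 2) * L) * Real.exp (-(2 * L)), by positivity, ?_, fun k => ?_⟩
  · have h1 : Real.exp (-(2 * L)) = Real.exp (-((2 - q) * L)) * Real.exp (-(q * L)) := by
      rw [← Real.exp_add]
      congr 1
      ring
    rw [h1, ← mul_assoc]
    exact mul_lt_of_lt_one_left (Real.exp_pos _) hlt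
  · have hle : 2 * Real.exp (-(2 * L)) ≤ (2 + K * (1 + 4 * L ^ 2) * L) * Real.exp (-(2 * L)) := by
      gcongr
      have : 0 ≤ K * (1 + 4 * L ^ 2) * L := by positivity
      linarith
    rcases lt_trichotomy k m with h | h | h
    · refine (hK k h L hL1).mono hL0 ?_
      gcongr
      linarith
    · subst h
      exact (modeBound_self hm hL0).mono hL0 hle
    · exact (modeBound_of_gt h hL0).mono hL0 hle

/-! ### A single Fourier mode with a source term -/

/-- The Cauchy–Schwarz inequality on an interval. -/
lemma sq_integral_le {x y : ℝ} (hxy : x < y) {g : ℝ → ℝ} (hg : Continuous g) :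
    (∫ t in x..y, g t) ^ 2 ≤ (y - x) * ∫ t in x..y, g t ^ 2 := by
  set I := ∫ t in x..y, g t with hI
  have h0 : 0 ≤ ∫ t in x..y, ((y - x) * g t - I) ^ 2 :=
    intervalIntegral.integral_nonneg hxy.le fun _ _ => sq_nonneg _
  have h1 : ∫ t in x..y, ((y - x) * g t - I) ^ 2
      = (y - x) * ((y - x) * (∫ t in x..y, g t ^ 2) - I ^ 2) := by
    have e : ∀ t, ((y - x) * g t - I) ^ 2
        = (y - x) ^ 2 * g t ^ 2 - (2 * (y - x) * I) * g t + I ^ 2 := fun t => by ring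
    simp only [e]
    rw [intervalIntegral.integral_add (Continuous.intervalIntegrable (by fun_prop) _ _)
      (Continuous.intervalIntegrable (by fun_prop) _ _),
      intervalIntegral.integral_sub (Continuous.intervalIntegrable (by fun_prop) _ _)
      (Continuous.intervalIntegrable (by fun_prop) _ _), intervalIntegral.integral_const_mul,
      intervalIntegral.integral_const_mul, intervalIntegral.integral_const, ← hI, smul_eq_mul]
    ring
  rw [h1] at h0
  have := nonneg_of_mul_nonneg_right h0 (sub_pos.2 hxy)
  linarith

lemma add_sq_le_weighted {τ : ℝ} (hτ : 0 < τ) (x y : ℝ) :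
    (x + y) ^ 2 ≤ (1 + τ) * x ^ 2 + (1 + 1 / τ) * y ^ 2 := by
  have h : (1 + τ) * x ^ 2 + (1 + 1 / τ) * y ^ 2 - (x + y) ^ 2 = (τ * x - y) ^ 2 / τ := by
    field_simp
    ring
  have : 0 ≤ (τ * x - y) ^ 2 / τ := by positivity
  linarith

/-- Testing `c'' = K c + f` with `t (T - t) c`: since the weight is concave, this controls the
`L²` norm of a solution that vanishes at both ends by that of `t (T - t) f`, uniformly in
`K ≥ 0`. The source may therefore be uncontrolled near the ends. -/
lemma integral_sq_le_of_boundary_zero {T K : ℝ} (hT : 0 < T) (hK : 0 ≤ K) {c c₁ f : ℝ → ℝ}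
    (hc : Continuous c) (hc₁ : Continuous c₁) (hf : Continuous f)
    (hd : ∀ t ∈ Ioo 0 T, HasDerivAt c (c₁ t) t)
    (hd₁ : ∀ t ∈ Ioo 0 T, HasDerivAt c₁ (K * c t + f t) t) (h0 : c 0 = 0) (hT0 : c T = 0) :
    (∫ t in (0 : ℝ)..T, c t ^ 2) ≤ (∫ t in (0 : ℝ)..T, (t * (T - t)) ^ 2 * f t ^ 2) ∧
    (∫ t in (0 : ℝ)..T, t * (T - t) * c₁ t ^ 2) ≤
      (∫ t in (0 : ℝ)..T, (t * (T - t)) ^ 2 * f t ^ 2) := by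
  set J := ∫ t in (0 : ℝ)..T, t * (T - t) * c₁ t ^ 2 with hJ
  set P := ∫ t in (0 : ℝ)..T, c t ^ 2 with hP
  set D := ∫ t in (0 : ℝ)..T, (t * (T - t)) ^ 2 * f t ^ 2 with hD
  have hJ0 : 0 ≤ J := intervalIntegral.integral_nonneg hT.le fun t ht =>
    mul_nonneg (mul_nonneg ht.1 (sub_nonneg.2 ht.2)) (sq_nonneg _)
  have hP0 : 0 ≤ P := intervalIntegral.integral_nonneg hT.le fun t ht => sq_nonneg _
  have hftc : ∫ t in (0 : ℝ)..T,
      (2 * (t * (T - t)) * (c₁ t ^ 2 + K * c t ^ 2 + c t * f t) + 2 * c t ^ 2) = 0 := by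
    rw [intervalIntegral.integral_eq_sub_of_hasDerivAt_of_le hT.le
      (f := fun t => 2 * (t * (T - t)) * (c t * c₁ t) - (T - 2 * t) * c t ^ 2)
      (Continuous.continuousOn (by fun_prop)) (fun t ht => ?_)
      (Continuous.intervalIntegrable (by fun_prop) _ _)]
    · simp [h0, hT0]
    · have w : HasDerivAt (fun t : ℝ => 2 * (t * (T - t))) (2 * (T - 2 * t)) t := by
        have := (((hasDerivAt_id t).mul ((hasDerivAt_id t).const_sub T))).const_mul 2
        refine this.congr_deriv ?_
        simp only [id]
        ring
      have w' : HasDerivAt (fun t : ℝ => T - 2 * t) (-2) t := by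
        simpa using ((hasDerivAt_id t).const_mul 2).const_sub T
      refine ((w.mul ((hd t ht).mul (hd₁ t ht))).sub (w'.mul ((hd t ht).pow 2))).congr_deriv ?_
      simp only [Pi.mul_apply, Pi.pow_apply]
      push_cast
      ring
  have hle : 2 * J + P - D ≤ ∫ t in (0 : ℝ)..T,
      (2 * (t * (T - t)) * (c₁ t ^ 2 + K * c t ^ 2 + c t * f t) + 2 * c t ^ 2) := by
    have e : 2 * J + P - D = ∫ t in (0 : ℝ)..T,
        (2 * (t * (T - t) * c₁ t ^ 2) + c t ^ 2 - (t * (T - t)) ^ 2 * f t ^ 2) := by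
      rw [intervalIntegral.integral_sub (Continuous.intervalIntegrable (by fun_prop) _ _)
        (Continuous.intervalIntegrable (by fun_prop) _ _),
        intervalIntegral.integral_add (Continuous.intervalIntegrable (by fun_prop) _ _)
        (Continuous.intervalIntegrable (by fun_prop) _ _), intervalIntegral.integral_const_mul]
    rw [e]
    refine intervalIntegral.integral_mono_on hT.le (Continuous.intervalIntegrable (by fun_prop) _ _)
      (Continuous.intervalIntegrable (by fun_prop) _ _) fun t ht => ?_
    have hdt : 0 ≤ t * (T - t) := mul_nonneg ht.1 (sub_nonneg.2 ht.2)
    have h1 : 0 ≤ t * (T - t) * (K * c t ^ 2) := by positivity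
    nlinarith [sq_nonneg (c t + t * (T - t) * f t)]
  rw [hftc] at hle
  constructor <;> linarith

/-- `e^{-mt} (e' + m e)` has derivative `e^{-mt} f`, so its value at the midpoint is controlled by
its value at any other point and the integral of `f`. -/
lemma sq_growing_coeff_le {m : ℕ} {L : ℝ} (hL : 0 < L) {e e₁ f : ℝ → ℝ} {b : ℝ}
    (hf : Continuous f) (hd : ∀ t ∈ Ioo 0 (3 * L), HasDerivAt e (e₁ t) t)
    (hd₁ : ∀ t ∈ Ioo 0 (3 * L), HasDerivAt e₁ ((m : ℝ) ^ 2 * e t + f t) t)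
    (hb : e₁ (3 * L / 2) + m * e (3 * L / 2) = -(2 * m * b * Real.exp (m * (3 * L / 2))))
    {t : ℝ} (ht : t ∈ Icc L (2 * L)) :
    (2 * m * b) ^ 2 ≤ 3 * (e₁ t ^ 2 + m ^ 2 * e t ^ 2 + (∫ t in L..(2 * L), |f t|) ^ 2) := by
  have hm0 : (0 : ℝ) ≤ m := by positivity
  have hL2 : L < 2 * L := by linarith
  set F := ∫ t in L..(2 * L), |f t| with hF
  have hIoo : ∀ s ∈ uIcc t (3 * L / 2), s ∈ Icc L (2 * L) := fun s hs =>
    (uIcc_subset_Icc ht ⟨by linarith, by linarith⟩) hs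
  have hG : ∫ s in t..(3 * L / 2), Real.exp (-(m * s)) * f s =
      Real.exp (-(m * (3 * L / 2))) * (e₁ (3 * L / 2) + m * e (3 * L / 2))
        - Real.exp (-(m * t)) * (e₁ t + m * e t) := by
    refine intervalIntegral.integral_eq_sub_of_hasDerivAt
      (f := fun s => Real.exp (-(m * s)) * (e₁ s + m * e s)) (fun s hs => ?_)
      (Continuous.intervalIntegrable (by fun_prop) _ _)
    have hs' : s ∈ Ioo 0 (3 * L) := ⟨by linarith [(hIoo s hs).1], by linarith [(hIoo s hs).2]⟩
    have h1 : HasDerivAt (fun s : ℝ => -((m : ℝ) * s)) (-m) s :=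
      (((hasDerivAt_id s).const_mul (m : ℝ)).neg).congr_deriv (by ring)
    refine (h1.exp.mul ((hd₁ s hs').add ((hd s hs').const_mul (m : ℝ)))).congr_deriv ?_
    simp only [Pi.add_apply]
    ring
  have hmid : Real.exp (-(m * (3 * L / 2))) * (e₁ (3 * L / 2) + m * e (3 * L / 2))
      = -(2 * m * b) := by
    rw [hb, Real.exp_neg]
    field_simp
  rw [hmid] at hG
  have hGle : |∫ s in t..(3 * L / 2), Real.exp (-(m * s)) * f s| ≤ F := by
    have h1 := intervalIntegral.norm_integral_le_integral_norm_uIoc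
      (f := fun s => Real.exp (-(m * s)) * f s) (a := t) (b := 3 * L / 2) (μ := volume)
    rw [Real.norm_eq_abs] at h1
    refine h1.trans ?_
    rw [hF, intervalIntegral.integral_of_le hL2.le]
    have hint : IntegrableOn (fun s => |f s|) (Ioc L (2 * L)) :=
      (hf.abs.integrableOn_Icc (a := L) (b := 2 * L)).mono_set Ioc_subset_Icc_self
    have hss : uIoc t (3 * L / 2) ⊆ Ioc L (2 * L) := by
      intro s hs
      rw [mem_uIoc] at hs
      rcases hs with hs | hs
      · exact ⟨by linarith [ht.1], by linarith⟩
      · exact ⟨by linarith, by linarith [ht.2]⟩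
    refine le_trans ?_ (setIntegral_mono_set hint
      (Filter.Eventually.of_forall fun s => abs_nonneg _) hss.eventuallyLE)
    refine setIntegral_mono_on ?_ (hint.mono_set hss) measurableSet_uIoc fun s hs => ?_
    · exact (Continuous.integrableOn_Icc (a := L) (b := 2 * L) (by fun_prop)).mono_set
        (hss.trans Ioc_subset_Icc_self)
    · rw [norm_mul, Real.norm_eq_abs, Real.norm_eq_abs, Real.abs_exp]
      refine mul_le_of_le_one_left (abs_nonneg _) (Real.exp_le_one_iff.2 ?_)
      have := (hss hs).1
      nlinarith
  have hexp : Real.exp (-(m * t)) ≤ 1 := Real.exp_le_one_iff.2 (by nlinarith [ht.1])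
  set I := ∫ s in t..(3 * L / 2), Real.exp (-(m * s)) * f s
  have hI2 : I ^ 2 ≤ F ^ 2 := sq_le_sq' (by linarith [neg_abs_le I]) ((le_abs_self _).trans hGle)
  have e1 : 2 * m * b = -(Real.exp (-(m * t)) * e₁ t) - Real.exp (-(m * t)) * (m * e t) - I := by
    rw [hG]
    ring
  have hexp2 : Real.exp (-(m * t)) ^ 2 ≤ 1 := pow_le_one₀ (Real.exp_pos _).le hexp
  have e2 : (2 * m * b) ^ 2 ≤
      3 * (Real.exp (-(m * t)) ^ 2 * e₁ t ^ 2 + Real.exp (-(m * t)) ^ 2 * (m * e t) ^ 2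
        + I ^ 2) := by
    rw [e1]
    nlinarith [sq_nonneg (Real.exp (-(m * t)) * e₁ t - Real.exp (-(m * t)) * (m * e t)),
      sq_nonneg (Real.exp (-(m * t)) * e₁ t - I), sq_nonneg (Real.exp (-(m * t)) * (m * e t) - I)]
  refine e2.trans ?_
  have e3 := mul_le_mul_of_nonneg_right hexp2 (sq_nonneg (e₁ t))
  have e4 := mul_le_mul_of_nonneg_right hexp2 (sq_nonneg (m * e t))
  nlinarith

/-- The coefficient of `e^{mt}` in the solution with the same boundary values is controlled by the
source if `c' + m c` vanishes at the midpoint. -/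
lemma exists_bound_growing_coeff {m : ℕ} (hm : 1 ≤ m) {L : ℝ} (hL : 0 < L) :
    ∃ C > 0, ∀ (e e₁ f : ℝ → ℝ) (b : ℝ), Continuous e → Continuous e₁ → Continuous f →
      (∀ t ∈ Ioo 0 (3 * L), HasDerivAt e (e₁ t) t) →
      (∀ t ∈ Ioo 0 (3 * L), HasDerivAt e₁ ((m : ℝ) ^ 2 * e t + f t) t) →
      e 0 = 0 → e (3 * L) = 0 →
      e₁ (3 * L / 2) + m * e (3 * L / 2) = -(2 * m * b * Real.exp (m * (3 * L / 2))) →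
      b ^ 2 ≤ C * ∫ t in (0 : ℝ)..(3 * L), (t * (3 * L - t)) ^ 2 * f t ^ 2 := by
  refine ⟨3 * (1 / (2 * L ^ 2) + m ^ 2 + 1 / (4 * L ^ 2)) / L, by positivity,
    fun e e₁ f b he he₁ hf hd hd₁ h0 h3 hb => ?_⟩
  obtain ⟨hI, hJ⟩ := integral_sq_le_of_boundary_zero (by linarith : 0 < 3 * L) (sq_nonneg (m : ℝ))
    he he₁ hf hd hd₁ h0 h3
  set D := ∫ t in (0 : ℝ)..(3 * L), (t * (3 * L - t)) ^ 2 * f t ^ 2 with hD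
  set F := ∫ t in L..(2 * L), |f t| with hF
  have hm1 : (1 : ℝ) ≤ m := by exact_mod_cast hm
  have hL2 : L < 2 * L := by linarith
  have hsub : ∀ t ∈ Icc L (2 * L), 2 * L ^ 2 ≤ t * (3 * L - t) := fun t ht => by
    nlinarith [mul_nonneg (sub_nonneg.2 ht.1) (sub_nonneg.2 ht.2)]
  have hsub2 : ∀ t ∈ Icc L (2 * L), 4 * L ^ 4 ≤ (t * (3 * L - t)) ^ 2 := fun t ht => by
    nlinarith [hsub t ht, pow_le_pow_left₀ (by positivity) (hsub t ht) 2]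
  have hf2 : (∫ t in L..(2 * L), f t ^ 2) ≤ D / (4 * L ^ 4) := by
    rw [le_div_iff₀ (by positivity), mul_comm, ← intervalIntegral.integral_const_mul]
    refine (intervalIntegral.integral_mono_on hL2.le
      (Continuous.intervalIntegrable (by fun_prop) _ _)
      (Continuous.intervalIntegrable (by fun_prop) _ _) fun t ht =>
        mul_le_mul_of_nonneg_right (hsub2 t ht) (sq_nonneg (f t))).trans ?_
    exact intervalIntegral.integral_mono_interval hL.le hL2.le (by linarith)
      (Filter.Eventually.of_forall fun t => by positivity)
      (Continuous.intervalIntegrable (by fun_prop) _ _)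
  have he2 : (∫ t in L..(2 * L), e t ^ 2) ≤ D :=
    (intervalIntegral.integral_mono_interval hL.le hL2.le (by linarith)
      (Filter.Eventually.of_forall fun t => by positivity)
      (Continuous.intervalIntegrable (by fun_prop) _ _)).trans hI
  have he12 : (∫ t in L..(2 * L), e₁ t ^ 2) ≤ D / (2 * L ^ 2) := by
    rw [le_div_iff₀ (by positivity), mul_comm, ← intervalIntegral.integral_const_mul]
    refine (intervalIntegral.integral_mono_on hL2.le
      (Continuous.intervalIntegrable (by fun_prop) _ _)
      (Continuous.intervalIntegrable (by fun_prop) _ _) fun t ht =>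
        mul_le_mul_of_nonneg_right (hsub t ht) (sq_nonneg (e₁ t))).trans ?_
    refine le_trans ?_ hJ
    refine intervalIntegral.integral_mono_interval hL.le hL2.le (by linarith) ?_
      (Continuous.intervalIntegrable (by fun_prop) _ _)
    filter_upwards [ae_restrict_mem measurableSet_Ioc] with t ht
    exact mul_nonneg (mul_nonneg ht.1.le (sub_nonneg.2 ht.2)) (sq_nonneg _)
  have hF2 : F ^ 2 ≤ D / (4 * L ^ 3) := by
    have := sq_integral_le hL2 hf.abs
    simp only [sq_abs] at this
    refine this.trans ?_
    have h1 : (2 * L - L) * (D / (4 * L ^ 4)) = D / (4 * L ^ 3) := by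
      rw [two_mul, add_sub_cancel_right]
      field_simp
    rw [← h1]
    gcongr
  have hpt : ∀ t ∈ Icc L (2 * L), (2 * m * b) ^ 2 ≤ 3 * (e₁ t ^ 2 + m ^ 2 * e t ^ 2 + F ^ 2) :=
    fun t ht => sq_growing_coeff_le hL hf hd hd₁ hb ht
  have hint := intervalIntegral.integral_mono_on hL2.le
    (intervalIntegrable_const (c := (2 * m * b) ^ 2) (a := L) (b := 2 * L) (μ := volume))
    (Continuous.intervalIntegrable (by fun_prop) _ _) hpt
  rw [intervalIntegral.integral_const, intervalIntegral.integral_const_mul,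
    intervalIntegral.integral_add (Continuous.intervalIntegrable (by fun_prop) _ _)
      (Continuous.intervalIntegrable (by fun_prop) _ _),
    intervalIntegral.integral_add (Continuous.intervalIntegrable (by fun_prop) _ _)
      (Continuous.intervalIntegrable (by fun_prop) _ _), intervalIntegral.integral_const_mul,
    intervalIntegral.integral_const, smul_eq_mul, smul_eq_mul] at hint
  have hD0 : 0 ≤ D := intervalIntegral.integral_nonneg (by linarith) fun _ _ => by positivity
  have hfin : L * b ^ 2 ≤ 3 * (1 / (2 * L ^ 2) + m ^ 2 + 1 / (4 * L ^ 2)) * D := by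
    have h1 : (m : ℝ) ^ 2 * (∫ t in L..(2 * L), e t ^ 2) ≤ m ^ 2 * D := by gcongr
    have h2 : (2 * L - L) * F ^ 2 ≤ D / (4 * L ^ 2) := by
      have h3 : (2 * L - L) * (D / (4 * L ^ 3)) = D / (4 * L ^ 2) := by
        rw [two_mul, add_sub_cancel_right]
        field_simp
      rw [← h3]
      exact mul_le_mul_of_nonneg_left hF2 (by linarith)
    have h3 : L * b ^ 2 ≤ (2 * L - L) * (2 * m * b) ^ 2 := by
      have h4 : b ^ 2 ≤ (2 * m * b) ^ 2 := by
        have h5 : (1 : ℝ) ≤ m ^ 2 := one_le_pow₀ hm1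
        have h6 : b ^ 2 ≤ m ^ 2 * b ^ 2 := le_mul_of_one_le_left (sq_nonneg b) h5
        have h7 : (2 * m * b) ^ 2 = 4 * (m ^ 2 * b ^ 2) := by ring
        rw [h7]
        linarith [sq_nonneg b]
      have h5 : (2 * L - L) * (2 * m * b) ^ 2 = L * (2 * m * b) ^ 2 := by ring
      rw [h5]
      exact mul_le_mul_of_nonneg_left h4 hL.le
    have h4 : 3 * (1 / (2 * L ^ 2) + m ^ 2 + 1 / (4 * L ^ 2)) * D
        = 3 * (D / (2 * L ^ 2) + m ^ 2 * D + D / (4 * L ^ 2)) := by ring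
    rw [h4]
    linarith
  rw [div_mul_eq_mul_div, le_div_iff₀ hL]
  linarith

/-- A solution of `c'' = k² c + f` is `L²`-close to a solution of the homogeneous equation, with no
`e^{mt}` term if `k = m` and `c' + m c` vanishes at the midpoint. -/
lemma exists_hom_approx {m : ℕ} (hm : 1 ≤ m) {L : ℝ} (hL : 0 < L) :
    ∃ C > 0, ∀ (k : ℕ) (c c₁ f : ℝ → ℝ), Continuous c → Continuous c₁ → Continuous f →
      (∀ t ∈ Ioo 0 (3 * L), HasDerivAt c (c₁ t) t) →
      (∀ t ∈ Ioo 0 (3 * L), HasDerivAt c₁ ((k : ℝ) ^ 2 * c t + f t) t) →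
      (k = m → c₁ (3 * L / 2) + m * c (3 * L / 2) = 0) →
      ∃ a b, (k = m → b = 0) ∧ (∫ t in (0 : ℝ)..(3 * L), (c t - hom k a b t) ^ 2) ≤
        C * ∫ t in (0 : ℝ)..(3 * L), (t * (3 * L - t)) ^ 2 * f t ^ 2 := by
  obtain ⟨C, hC, hCb⟩ := exists_bound_growing_coeff hm hL
  refine ⟨2 + 2 * (3 * L * Real.exp (2 * (m * (3 * L)))) * C, by positivity,
    fun k c c₁ f hc hc₁ hf hd hd₁ hmid => ?_⟩
  have h3L : 0 < 3 * L := by linarith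
  obtain ⟨a, b, ha, hb⟩ := exists_hom_eq k h3L (c 0) (c (3 * L))
  have hD0 : 0 ≤ ∫ t in (0 : ℝ)..(3 * L), (t * (3 * L - t)) ^ 2 * f t ^ 2 :=
    intervalIntegral.integral_nonneg h3L.le fun _ _ => by positivity
  have hh := continuous_hom_right k a b
  have hh1 : Continuous (homDeriv k a b) :=
    continuous_iff_continuousAt.2 fun t => (hasDerivAt_homDeriv k a b t).continuousAt
  have hde : ∀ t ∈ Ioo 0 (3 * L), HasDerivAt (fun t => c t - hom k a b t)
      (c₁ t - homDeriv k a b t) t := fun t ht => (hd t ht).sub (hasDerivAt_hom k a b t)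
  have hde₁ : ∀ t ∈ Ioo 0 (3 * L), HasDerivAt (fun t => c₁ t - homDeriv k a b t)
      ((k : ℝ) ^ 2 * (c t - hom k a b t) + f t) t := fun t ht =>
    ((hd₁ t ht).sub (hasDerivAt_homDeriv k a b t)).congr_deriv (by ring)
  have he : Continuous fun t => c t - hom k a b t := hc.sub hh
  have he₁ : Continuous fun t => c₁ t - homDeriv k a b t := hc₁.sub hh1
  have hI := (integral_sq_le_of_boundary_zero h3L (sq_nonneg (k : ℝ)) he he₁ hf
    hde hde₁ (by simp [ha]) (by simp [hb])).1
  set D := ∫ t in (0 : ℝ)..(3 * L), (t * (3 * L - t)) ^ 2 * f t ^ 2 with hD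
  by_cases hk : k = m
  · subst hk
    have hk0 : k ≠ 0 := by omega
    have hb2 := hCb _ _ f b he he₁ hf hde hde₁ (by simp [ha]) (by simp [hb]) (by
      have h1 := hmid rfl
      have h2 : homDeriv k a b (3 * L / 2) + k * hom k a b (3 * L / 2)
          = 2 * k * b * Real.exp (k * (3 * L / 2)) := by
        simp only [hom, homDeriv, if_neg hk0]
        ring
      linarith)
    refine ⟨a, 0, fun _ => rfl, ?_⟩
    have hpt : ∀ t ∈ Icc 0 (3 * L), (c t - hom k a 0 t) ^ 2 ≤
        2 * (c t - hom k a b t) ^ 2 + 2 * (b ^ 2 * Real.exp (2 * (k * (3 * L)))) := by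
      intro t ht
      have e1 : c t - hom k a 0 t = (c t - hom k a b t) + b * Real.exp (k * t) := by
        simp only [hom, if_neg hk0]
        ring
      have e2 : (b * Real.exp (k * t)) ^ 2 ≤ b ^ 2 * Real.exp (2 * (k * (3 * L))) := by
        rw [mul_pow, ← Real.exp_nat_mul]
        refine mul_le_mul_of_nonneg_left (Real.exp_le_exp.2 ?_) (sq_nonneg b)
        have := mul_le_mul_of_nonneg_left ht.2 (by positivity : (0 : ℝ) ≤ k)
        push_cast
        linarith
      rw [e1]
      nlinarith [sq_nonneg ((c t - hom k a b t) - b * Real.exp (k * t))]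
    have hha := continuous_hom_right k a 0
    have := intervalIntegral.integral_mono_on (μ := volume) h3L.le
      (Continuous.intervalIntegrable (by fun_prop) _ _)
      (Continuous.intervalIntegrable (by fun_prop) _ _) hpt
    rw [intervalIntegral.integral_add (Continuous.intervalIntegrable (by fun_prop) _ _)
      (Continuous.intervalIntegrable (by fun_prop) _ _), intervalIntegral.integral_const_mul,
      intervalIntegral.integral_const, smul_eq_mul, sub_zero] at this
    refine this.trans ?_
    have h5 := mul_le_mul_of_nonneg_left hb2
      (by positivity : 0 ≤ 2 * (3 * L * Real.exp (2 * (k * (3 * L)))))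
    linarith
  · refine ⟨a, b, fun h => absurd h hk, hI.trans ?_⟩
    have : 0 ≤ 2 * (3 * L * Real.exp (2 * (m * (3 * L)))) * C * D := by positivity
    linarith

lemma segEnergy_le_add (m : ℕ) {x y τ : ℝ} (hx : 0 ≤ x) (hxy : x ≤ y) (hτ : 0 < τ) {c d : ℝ → ℝ}
    (hc : Continuous c) (hd : Continuous d) :
    segEnergy m x y c
      ≤ (1 + τ) * segEnergy m x y d + (1 + 1 / τ) * ∫ t in x..y, (c t - d t) ^ 2 := by
  unfold segEnergy
  rw [← intervalIntegral.integral_const_mul, ← intervalIntegral.integral_const_mul,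
    ← intervalIntegral.integral_add (Continuous.intervalIntegrable (by fun_prop) _ _)
      (Continuous.intervalIntegrable (by fun_prop) _ _)]
  refine intervalIntegral.integral_mono_on hxy (Continuous.intervalIntegrable (by fun_prop) _ _)
    (Continuous.intervalIntegrable (by fun_prop) _ _) fun t ht => ?_
  have h1 := add_sq_le_weighted hτ (d t) (c t - d t)
  rw [add_sub_cancel] at h1
  have hm0 : (0 : ℝ) ≤ m := by positivity
  have h2 : Real.exp (-2 * m * t) ≤ 1 :=
    Real.exp_le_one_iff.2 (by nlinarith [mul_nonneg hm0 (hx.trans ht.1)])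
  have h3 : 0 ≤ (1 + 1 / τ) * (c t - d t) ^ 2 := by positivity
  calc c t ^ 2 * Real.exp (-2 * m * t)
      ≤ ((1 + τ) * d t ^ 2 + (1 + 1 / τ) * (c t - d t) ^ 2) * Real.exp (-2 * m * t) := by gcongr
    _ = (1 + τ) * (d t ^ 2 * Real.exp (-2 * m * t))
        + (1 + 1 / τ) * (c t - d t) ^ 2 * Real.exp (-2 * m * t) := by ring
    _ ≤ _ := by
      linarith [mul_le_of_le_one_right h3 h2]

lemma exists_pos_mul_sq_le {κ₀ κ : ℝ} (h0 : 0 ≤ κ₀) (h : κ₀ < κ) :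
    ∃ τ > 0, κ₀ * (1 + τ) ^ 2 ≤ κ := by
  have hd : 0 < κ - κ₀ := by linarith
  refine ⟨min 1 ((κ - κ₀) / (3 * κ₀ + 1)), lt_min one_pos (by positivity), ?_⟩
  set τ := min 1 ((κ - κ₀) / (3 * κ₀ + 1))
  have hτ0 : 0 < τ := lt_min one_pos (by positivity)
  have hτ1 : τ ≤ 1 := min_le_left _ _
  have hτ2 : τ * (3 * κ₀ + 1) ≤ κ - κ₀ := by
    rw [← le_div_iff₀ (by positivity)]
    exact min_le_right _ _
  nlinarith [mul_nonneg h0 hτ0.le, mul_nonneg (mul_nonneg h0 hτ0.le) (sub_nonneg.2 hτ1)]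

/-- The three-circle inequality for a mode with a source term, with constants independent of the
mode. -/
lemma exists_mode_source_bound {m : ℕ} (hm : 1 ≤ m) {L κ₀ κ : ℝ} (hL : 0 < L) (h0 : 0 ≤ κ₀)
    (hκ : κ₀ < κ) (hmode : ∀ k, ModeBound m L κ₀ k) :
    ∃ C > 0, ∀ (k : ℕ) (c c₁ f : ℝ → ℝ), Continuous c → Continuous c₁ → Continuous f →
      (∀ t ∈ Ioo 0 (3 * L), HasDerivAt c (c₁ t) t) →
      (∀ t ∈ Ioo 0 (3 * L), HasDerivAt c₁ ((k : ℝ) ^ 2 * c t + f t) t) →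
      (k = m → c₁ (3 * L / 2) + m * c (3 * L / 2) = 0) →
      segEnergy m L (2 * L) c ≤ κ * (segEnergy m 0 L c + segEnergy m (2 * L) (3 * L) c) +
        C * ∫ t in (0 : ℝ)..(3 * L), (t * (3 * L - t)) ^ 2 * f t ^ 2 := by
  obtain ⟨C, hC, happ⟩ := exists_hom_approx hm hL
  obtain ⟨τ, hτ, hτκ⟩ := exists_pos_mul_sq_le h0 hκ
  refine ⟨((1 + 1 / τ) + (1 + τ) * κ₀ * (1 + 1 / τ) * 2) * C, by positivity,
    fun k c c₁ f hc hc₁ hf hd hd₁ hmid => ?_⟩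
  obtain ⟨a, b, hb, hab⟩ := happ k c c₁ f hc hc₁ hf hd hd₁ hmid
  have hh := continuous_hom_right k a b
  set D := ∫ t in (0 : ℝ)..(3 * L), (t * (3 * L - t)) ^ 2 * f t ^ 2 with hD
  have hpart : ∀ x y : ℝ, 0 ≤ x → x ≤ y → y ≤ 3 * L →
      (∫ t in x..y, (c t - hom k a b t) ^ 2) ≤ C * D := fun x y hx hxy hy =>
    (intervalIntegral.integral_mono_interval hx hxy hy
      (Filter.Eventually.of_forall fun t => by positivity)
      (Continuous.intervalIntegrable (by fun_prop) _ _)).trans hab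
  have hsym : ∀ x y : ℝ, (∫ t in x..y, (hom k a b t - c t) ^ 2)
      = ∫ t in x..y, (c t - hom k a b t) ^ 2 := fun x y => by
    congr 1
    ext t
    ring
  have h2 := segEnergy_le_add m hL.le (by linarith : L ≤ 2 * L) hτ hc hh
  have h1 := segEnergy_le_add m le_rfl hL.le hτ hh hc
  have h3 := segEnergy_le_add m (by linarith : 0 ≤ 2 * L) (by linarith : 2 * L ≤ 3 * L) hτ hh hc
  rw [hsym] at h1 h3
  have p1 := hpart 0 L le_rfl hL.le (by linarith)
  have p2 := hpart L (2 * L) hL.le (by linarith) (by linarith)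
  have p3 := hpart (2 * L) (3 * L) (by linarith) (by linarith) le_rfl
  have hM := hmode k a b hb
  have hσ : 0 < 1 + 1 / τ := by positivity
  set S1 := segEnergy m 0 L c
  set S3 := segEnergy m (2 * L) (3 * L) c
  set H1 := segEnergy m 0 L (hom k a b)
  set H3 := segEnergy m (2 * L) (3 * L) (hom k a b)
  have hS : 0 ≤ S1 + S3 :=
    add_nonneg (segEnergy_nonneg m hL.le _) (segEnergy_nonneg m (by linarith) _)
  have q1 : H1 + H3 ≤ (1 + τ) * (S1 + S3) + (1 + 1 / τ) * 2 * (C * D) := by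
    have := mul_le_mul_of_nonneg_left p1 hσ.le
    have := mul_le_mul_of_nonneg_left p3 hσ.le
    linarith
  calc segEnergy m L (2 * L) c
      ≤ (1 + τ) * segEnergy m L (2 * L) (hom k a b) + (1 + 1 / τ) * (C * D) := by
        refine h2.trans ?_
        gcongr
    _ ≤ (1 + τ) * (κ₀ * ((1 + τ) * (S1 + S3) + (1 + 1 / τ) * 2 * (C * D)))
        + (1 + 1 / τ) * (C * D) := by
        gcongr
        exact hM.trans (mul_le_mul_of_nonneg_left q1 h0)
    _ = κ₀ * (1 + τ) ^ 2 * (S1 + S3) + ((1 + 1 / τ) + (1 + τ) * κ₀ * (1 + 1 / τ) * 2) * C * D := by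
        ring
    _ ≤ _ := by gcongr

/-! ### Parseval's identity on the circles -/

/-- Parseval's identity for the cosine and sine coefficients. Each mode `k ≥ 1` is counted for the
two integers `±k`, which accounts for the factor of the mean value. -/
lemma hasSum_sq_coeff {u : ℝ → ℝ → ℝ} {t : ℝ} (hu : Continuous (u t)) :
    HasSum (fun n : ℤ => cosCoeff n.natAbs u t ^ 2 + sinCoeff n.natAbs u t ^ 2)
      (2 / Real.pi * ∫ θ in (0 : ℝ)..(2 * Real.pi), u t θ ^ 2) := by
  have hpi := Real.pi_pos
  have hab : (0 : ℝ) < 2 * Real.pi := by positivity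
  have hcont : Continuous fun θ : ℝ => (u t θ : ℂ) := Complex.continuous_ofReal.comp hu
  have hmem : MemLp (fun θ : ℝ => (u t θ : ℂ)) 2 (volume.restrict (Ioc 0 (2 * Real.pi))) := by
    obtain ⟨C, hC⟩ := (isCompact_Icc (a := (0 : ℝ)) (b := 2 * Real.pi)).exists_bound_of_continuousOn
      hcont.continuousOn
    refine MemLp.of_bound hcont.aestronglyMeasurable C ?_
    filter_upwards [ae_restrict_mem measurableSet_Ioc] with θ hθ
    exact hC θ ⟨hθ.1.le, hθ.2⟩
  have h := (hasSum_sq_fourierCoeffOn hab hmem).mul_left 4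
  have hval : 4 * ((2 * Real.pi - 0)⁻¹ • ∫ θ in (0 : ℝ)..(2 * Real.pi), ‖(u t θ : ℂ)‖ ^ 2)
      = 2 / Real.pi * ∫ θ in (0 : ℝ)..(2 * Real.pi), u t θ ^ 2 := by
    simp only [Complex.norm_real, Real.norm_eq_abs, sq_abs, smul_eq_mul, sub_zero]
    field_simp
    ring
  rw [hval] at h
  refine h.congr_fun fun n => ?_
  have hC : ∀ n : ℤ, cosCoeff n.natAbs u t
      = 1 / Real.pi * ∫ θ in (0 : ℝ)..(2 * Real.pi), Real.cos (n * θ) * u t θ := by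
    intro n
    unfold cosCoeff
    simp only [smul_eq_mul]
    congr 2
    ext θ
    rcases Int.natAbs_eq n with h | h
    · nth_rw 2 [h]
      simp
    · nth_rw 2 [h]
      simp [neg_mul, Real.cos_neg]
  have hS : ∀ n : ℤ, sinCoeff n.natAbs u t ^ 2
      = (1 / Real.pi * ∫ θ in (0 : ℝ)..(2 * Real.pi), Real.sin (n * θ) * u t θ) ^ 2 := by
    intro n
    unfold sinCoeff
    simp only [smul_eq_mul]
    rcases Int.natAbs_eq n with h | h
    · nth_rw 2 [h]
      simp
    · nth_rw 2 [h]
      simp [neg_mul, Real.sin_neg]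
  have hF : fourierCoeffOn hab (fun θ : ℝ => (u t θ : ℂ)) n = ((1 / (2 * Real.pi) : ℝ) : ℂ) *
      (((∫ θ in (0 : ℝ)..(2 * Real.pi), Real.cos (n * θ) * u t θ : ℝ) : ℂ)
        - ((∫ θ in (0 : ℝ)..(2 * Real.pi), Real.sin (n * θ) * u t θ : ℝ) : ℂ) * Complex.I) := by
    rw [fourierCoeffOn_eq_integral, ← intervalIntegral.integral_ofReal,
      ← intervalIntegral.integral_ofReal, ← intervalIntegral.integral_mul_const,
      ← intervalIntegral.integral_sub (Continuous.intervalIntegrable (by fun_prop) _ _)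
        (Continuous.intervalIntegrable (by fun_prop) _ _), sub_zero, Complex.real_smul]
    congr 1
    refine intervalIntegral.integral_congr fun θ _ => ?_
    simp only [fourier_coe_apply, smul_eq_mul]
    have e : 2 * (Real.pi : ℂ) * Complex.I * ((-n : ℤ) : ℂ) * θ / ((2 * Real.pi : ℝ) : ℂ)
        = ((-(n * θ) : ℝ) : ℂ) * Complex.I := by
      have : (Real.pi : ℂ) ≠ 0 := by exact_mod_cast hpi.ne'
      push_cast
      field_simp
    rw [e, Complex.exp_mul_I, ← Complex.ofReal_cos, ← Complex.ofReal_sin, Real.cos_neg,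
      Real.sin_neg]
    push_cast
    ring
  rw [hC, hS, hF]
  set A := ∫ θ in (0 : ℝ)..(2 * Real.pi), Real.cos (n * θ) * u t θ
  set B := ∫ θ in (0 : ℝ)..(2 * Real.pi), Real.sin (n * θ) * u t θ
  have hAB : ‖(A : ℂ) - (B : ℂ) * Complex.I‖ ^ 2 = A ^ 2 + B ^ 2 := by
    rw [Complex.sq_norm, Complex.normSq_apply]
    simp
    ring
  have hnorm : ‖((1 / (2 * Real.pi) : ℝ) : ℂ) * ((A : ℂ) - (B : ℂ) * Complex.I)‖ ^ 2
      = (1 / (2 * Real.pi)) ^ 2 * (A ^ 2 + B ^ 2) := by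
    rw [norm_mul, mul_pow, Complex.norm_real, Real.norm_eq_abs, sq_abs, hAB]
  rw [hnorm]
  field_simp
  ring

lemma continuous_of_uncurry {V : Type*} [TopologicalSpace V] {w : ℝ → ℝ → V}
    (hw : Continuous (Function.uncurry w)) (t : ℝ) : Continuous (w t) :=
  hw.comp (Continuous.prodMk continuous_const continuous_id)

section Coeff

variable {V : Type*} [NormedAddCommGroup V] [NormedSpace ℝ V]

lemma continuous_integral_circle {w : ℝ → ℝ → V} (hw : Continuous (Function.uncurry w)) :
    Continuous fun t => ∫ θ in (0 : ℝ)..(2 * Real.pi), w t θ :=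
  intervalIntegral.continuous_parametric_intervalIntegral_of_continuous' hw _ _

lemma continuous_cosCoeff {w : ℝ → ℝ → V} (hw : Continuous (Function.uncurry w)) (k : ℕ) :
    Continuous (cosCoeff k w) :=
  (continuous_integral_circle (w := fun t θ => Real.cos (k * θ) • w t θ) (by
    simp only [Function.uncurry_def] at hw ⊢
    fun_prop)).const_smul _

lemma continuous_sinCoeff {w : ℝ → ℝ → V} (hw : Continuous (Function.uncurry w)) (k : ℕ) :
    Continuous (sinCoeff k w) :=
  (continuous_integral_circle (w := fun t θ => Real.sin (k * θ) • w t θ) (by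
    simp only [Function.uncurry_def] at hw ⊢
    fun_prop)).const_smul _

end Coeff

/-- Parseval's identity integrated in `t` against a nonnegative weight. -/
lemma hasSum_integral_sq_coeff {u : ℝ → ℝ → ℝ} (hu : Continuous (Function.uncurry u)) {ρ : ℝ → ℝ}
    (hρ : Continuous ρ) {x y : ℝ} (hρ0 : ∀ t, 0 ≤ ρ t) :
    HasSum (fun n : ℤ => (∫ t in x..y, ρ t * cosCoeff n.natAbs u t ^ 2)
        + ∫ t in x..y, ρ t * sinCoeff n.natAbs u t ^ 2)
      (2 / Real.pi * ∫ t in x..y, ρ t * ∫ θ in (0 : ℝ)..(2 * Real.pi), u t θ ^ 2) := by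
  have hut : ∀ t, Continuous (u t) := continuous_of_uncurry hu
  have hu2 : Continuous fun t => ∫ θ in (0 : ℝ)..(2 * Real.pi), u t θ ^ 2 :=
    continuous_integral_circle (w := fun t θ => u t θ ^ 2) (by
      simp only [Function.uncurry_def] at hu ⊢
      fun_prop)
  have hs : ∀ t, HasSum
      (fun n : ℤ => ρ t * cosCoeff n.natAbs u t ^ 2 + ρ t * sinCoeff n.natAbs u t ^ 2)
      (2 / Real.pi * (ρ t * ∫ θ in (0 : ℝ)..(2 * Real.pi), u t θ ^ 2)) := fun t => by
    have := (hasSum_sq_coeff (hut t)).mul_left (ρ t)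
    simp only [mul_add] at this
    have e : ρ t * (2 / Real.pi * ∫ θ in (0 : ℝ)..(2 * Real.pi), u t θ ^ 2)
        = 2 / Real.pi * (ρ t * ∫ θ in (0 : ℝ)..(2 * Real.pi), u t θ ^ 2) := by ring
    rwa [e] at this
  rw [← intervalIntegral.integral_const_mul]
  have hc : ∀ k, Continuous (cosCoeff k u) := continuous_cosCoeff hu
  have hsn : ∀ k, Continuous (sinCoeff k u) := continuous_sinCoeff hu
  have key := intervalIntegral.hasSum_integral_of_dominated_convergence (μ := volume)
    (a := x) (b := y)
    (F := fun (n : ℤ) t => ρ t * cosCoeff n.natAbs u t ^ 2 + ρ t * sinCoeff n.natAbs u t ^ 2)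
    (f := fun t => 2 / Real.pi * (ρ t * ∫ θ in (0 : ℝ)..(2 * Real.pi), u t θ ^ 2))
    (fun (n : ℤ) t => ρ t * cosCoeff n.natAbs u t ^ 2 + ρ t * sinCoeff n.natAbs u t ^ 2)
    (fun n => ?_) (fun n => ?_) ?_ ?_ ?_
  · refine key.congr_fun fun n => ?_
    have h1 := hc n.natAbs
    have h2 := hsn n.natAbs
    rw [intervalIntegral.integral_add (Continuous.intervalIntegrable (by fun_prop) _ _)
      (Continuous.intervalIntegrable (by fun_prop) _ _)]
  · have h1 := hc n.natAbs
    have h2 := hsn n.natAbs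
    exact Continuous.aestronglyMeasurable (by fun_prop)
  · refine Filter.Eventually.of_forall fun t _ => ?_
    rw [Real.norm_of_nonneg (add_nonneg (mul_nonneg (hρ0 t) (sq_nonneg _))
      (mul_nonneg (hρ0 t) (sq_nonneg _)))]
  · exact Filter.Eventually.of_forall fun t _ => (hs t).summable
  · simp only [fun t => (hs t).tsum_eq]
    exact Continuous.intervalIntegrable (by fun_prop) _ _
  · exact Filter.Eventually.of_forall fun t _ => hs t

/-! ### Twice differentiable functions on the cylinder -/

lemma hasDerivAt_cos_mul (k : ℕ) (θ : ℝ) :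
    HasDerivAt (fun θ : ℝ => Real.cos (k * θ)) (-(k * Real.sin (k * θ))) θ :=
  (((hasDerivAt_id θ).const_mul (k : ℝ)).cos).congr_deriv (by simp only [id]; ring)

lemma hasDerivAt_sin_mul (k : ℕ) (θ : ℝ) :
    HasDerivAt (fun θ : ℝ => Real.sin (k * θ)) (k * Real.cos (k * θ)) θ :=
  (((hasDerivAt_id θ).const_mul (k : ℝ)).sin).congr_deriv (by simp only [id]; ring)

section Ext

variable {V : Type*} [NormedAddCommGroup V] [NormedSpace ℝ V]

/-- Globally continuous `u`, `u_t`, `u_θ`, `u_tt`, `u_θθ` that are, on the open cylinder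
`(0, T) × S¹`, the indicated derivatives of `u`. A function that is `C²` up to the boundary circles
gives rise to such data when its derivatives are extended by their boundary values. -/
structure C2Data (T : ℝ) (u ut uθ utt uθθ : ℝ → ℝ → V) : Prop where
  cont : Continuous (Function.uncurry u)
  cont_t : Continuous (Function.uncurry ut)
  cont_θ : Continuous (Function.uncurry uθ)
  cont_tt : Continuous (Function.uncurry utt)
  cont_θθ : Continuous (Function.uncurry uθθ)
  deriv_t : ∀ t ∈ Ioo 0 T, ∀ θ, HasDerivAt (fun s => u s θ) (ut t θ) t
  deriv_tt : ∀ t ∈ Ioo 0 T, ∀ θ, HasDerivAt (fun s => ut s θ) (utt t θ) t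
  deriv_θ : ∀ t ∈ Ioo 0 T, ∀ θ, HasDerivAt (u t) (uθ t θ) θ
  deriv_θθ : ∀ t ∈ Ioo 0 T, ∀ θ, HasDerivAt (uθ t) (uθθ t θ) θ
  periodic : ∀ t ∈ Ioo 0 T, u t (2 * Real.pi) = u t 0
  periodic_θ : ∀ t ∈ Ioo 0 T, uθ t (2 * Real.pi) = uθ t 0

/-- Differentiation under the integral over the circles. -/
lemma hasDerivAt_integral_circle {T : ℝ} {w w₁ : ℝ → ℝ → V} (hw : Continuous (Function.uncurry w))
    (hw₁ : Continuous (Function.uncurry w₁))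
    (hd : ∀ t ∈ Ioo 0 T, ∀ θ, HasDerivAt (fun s => w s θ) (w₁ t θ) t) {t : ℝ} (ht : t ∈ Ioo 0 T) :
    HasDerivAt (fun s => ∫ θ in (0 : ℝ)..(2 * Real.pi), w s θ)
      (∫ θ in (0 : ℝ)..(2 * Real.pi), w₁ t θ) t := by
  have hr : ∀ s, Continuous (w s) := continuous_of_uncurry hw
  have hr₁ : ∀ s, Continuous (w₁ s) := continuous_of_uncurry hw₁
  obtain ⟨C, hC⟩ := ((isCompact_Icc (a := (0 : ℝ)) (b := T)).prod
    (isCompact_Icc (a := (0 : ℝ)) (b := 2 * Real.pi))).exists_bound_of_continuousOn hw₁.continuousOn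
  refine (intervalIntegral.hasDerivAt_integral_of_dominated_loc_of_deriv_le
    (s := Ioo 0 T) (bound := fun _ => C) (Ioo_mem_nhds ht.1 ht.2)
    (Filter.Eventually.of_forall fun s => (hr s).aestronglyMeasurable)
    ((hr t).intervalIntegrable _ _) (hr₁ t).aestronglyMeasurable
    (Filter.Eventually.of_forall fun θ hθ s hs => ?_) intervalIntegrable_const
    (Filter.Eventually.of_forall fun θ _ s hs => hd s hs θ)).2
  have h2 : (0 : ℝ) ≤ 2 * Real.pi := by positivity
  rw [uIoc_of_le h2] at hθ
  exact hC (s, θ) ⟨⟨hs.1.le, hs.2.le⟩, ⟨hθ.1.le, hθ.2⟩⟩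

lemma hasDerivAt_cosCoeff {T : ℝ} {w w₁ : ℝ → ℝ → V} (hw : Continuous (Function.uncurry w))
    (hw₁ : Continuous (Function.uncurry w₁))
    (hd : ∀ t ∈ Ioo 0 T, ∀ θ, HasDerivAt (fun s => w s θ) (w₁ t θ) t) (k : ℕ) {t : ℝ}
    (ht : t ∈ Ioo 0 T) : HasDerivAt (cosCoeff k w) (cosCoeff k w₁ t) t := by
  refine (hasDerivAt_integral_circle (T := T) (w := fun t θ => Real.cos (k * θ) • w t θ)
    (w₁ := fun t θ => Real.cos (k * θ) • w₁ t θ) ?_ ?_ (fun t ht θ => (hd t ht θ).const_smul _)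
    ht).const_smul (1 / Real.pi)
  · simp only [Function.uncurry_def] at hw ⊢
    fun_prop
  · simp only [Function.uncurry_def] at hw₁ ⊢
    fun_prop

lemma hasDerivAt_sinCoeff {T : ℝ} {w w₁ : ℝ → ℝ → V} (hw : Continuous (Function.uncurry w))
    (hw₁ : Continuous (Function.uncurry w₁))
    (hd : ∀ t ∈ Ioo 0 T, ∀ θ, HasDerivAt (fun s => w s θ) (w₁ t θ) t) (k : ℕ) {t : ℝ}
    (ht : t ∈ Ioo 0 T) : HasDerivAt (sinCoeff k w) (sinCoeff k w₁ t) t := by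
  refine (hasDerivAt_integral_circle (T := T) (w := fun t θ => Real.sin (k * θ) • w t θ)
    (w₁ := fun t θ => Real.sin (k * θ) • w₁ t θ) ?_ ?_ (fun t ht θ => (hd t ht θ).const_smul _)
    ht).const_smul (1 / Real.pi)
  · simp only [Function.uncurry_def] at hw ⊢
    fun_prop
  · simp only [Function.uncurry_def] at hw₁ ⊢
    fun_prop

variable {T : ℝ} {u ut uθ utt uθθ : ℝ → ℝ → V}

lemma C2Data.cont_lap (h : C2Data T u ut uθ utt uθθ) :
    Continuous (Function.uncurry fun t θ => utt t θ + uθθ t θ) := h.cont_tt.add h.cont_θθ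

variable [CompleteSpace V]

/-- Integration by parts twice in `θ`: the coefficients of `u_tt` are `k²` times those of `u` plus
those of the Laplacian. -/
lemma C2Data.cosCoeff_tt (h : C2Data T u ut uθ utt uθθ) (k : ℕ) {t : ℝ} (ht : t ∈ Ioo 0 T) :
    cosCoeff k utt t
      = (k : ℝ) ^ 2 • cosCoeff k u t + cosCoeff k (fun t θ => utt t θ + uθθ t θ) t := by
  have c0 := continuous_of_uncurry h.cont t
  have c1 := continuous_of_uncurry h.cont_θ t
  have c2 := continuous_of_uncurry h.cont_θθ t
  have c3 := continuous_of_uncurry h.cont_tt t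
  have hI : ∫ θ in (0 : ℝ)..(2 * Real.pi),
      (Real.cos (k * θ) • uθθ t θ + (k : ℝ) ^ 2 • Real.cos (k * θ) • u t θ) = 0 := by
    rw [intervalIntegral.integral_eq_sub_of_hasDerivAt
      (f := fun θ => Real.cos (k * θ) • uθ t θ + (k * Real.sin (k * θ)) • u t θ)
      (fun θ _ => ?_) (Continuous.intervalIntegrable (by fun_prop) _ _)]
    · have e1 : Real.cos (k * (2 * Real.pi)) = 1 := Real.cos_nat_mul_two_pi k
      have e2 : Real.sin (k * (2 * Real.pi)) = 0 := by
        have := Real.sin_nat_mul_pi (2 * k)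
        rw [← this]
        congr 1
        push_cast
        ring
      simp [e1, e2, h.periodic_θ t ht]
    · refine (((hasDerivAt_cos_mul k θ).smul (h.deriv_θθ t ht θ)).add
        (((hasDerivAt_sin_mul k θ).const_mul (k : ℝ)).smul (h.deriv_θ t ht θ))).congr_deriv ?_
      module
  rw [intervalIntegral.integral_add (Continuous.intervalIntegrable (by fun_prop) _ _)
    (Continuous.intervalIntegrable (by fun_prop) _ _), intervalIntegral.integral_smul] at hI
  simp only [cosCoeff, smul_add]
  rw [intervalIntegral.integral_add (Continuous.intervalIntegrable (by fun_prop) _ _)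
    (Continuous.intervalIntegrable (by fun_prop) _ _), eq_neg_of_add_eq_zero_left hI]
  module

lemma C2Data.sinCoeff_tt (h : C2Data T u ut uθ utt uθθ) (k : ℕ) {t : ℝ} (ht : t ∈ Ioo 0 T) :
    sinCoeff k utt t
      = (k : ℝ) ^ 2 • sinCoeff k u t + sinCoeff k (fun t θ => utt t θ + uθθ t θ) t := by
  have c0 := continuous_of_uncurry h.cont t
  have c1 := continuous_of_uncurry h.cont_θ t
  have c2 := continuous_of_uncurry h.cont_θθ t
  have c3 := continuous_of_uncurry h.cont_tt t
  have hI : ∫ θ in (0 : ℝ)..(2 * Real.pi),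
      (Real.sin (k * θ) • uθθ t θ + (k : ℝ) ^ 2 • Real.sin (k * θ) • u t θ) = 0 := by
    rw [intervalIntegral.integral_eq_sub_of_hasDerivAt
      (f := fun θ => Real.sin (k * θ) • uθ t θ - (k * Real.cos (k * θ)) • u t θ)
      (fun θ _ => ?_) (Continuous.intervalIntegrable (by fun_prop) _ _)]
    · have e1 : Real.cos (k * (2 * Real.pi)) = 1 := Real.cos_nat_mul_two_pi k
      have e2 : Real.sin (k * (2 * Real.pi)) = 0 := by
        have := Real.sin_nat_mul_pi (2 * k)
        rw [← this]
        congr 1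
        push_cast
        ring
      simp [e1, e2, h.periodic t ht]
    · refine (((hasDerivAt_sin_mul k θ).smul (h.deriv_θθ t ht θ)).sub
        (((hasDerivAt_cos_mul k θ).const_mul (k : ℝ)).smul (h.deriv_θ t ht θ))).congr_deriv ?_
      module
  rw [intervalIntegral.integral_add (Continuous.intervalIntegrable (by fun_prop) _ _)
    (Continuous.intervalIntegrable (by fun_prop) _ _), intervalIntegral.integral_smul] at hI
  simp only [sinCoeff, smul_add]
  rw [intervalIntegral.integral_add (Continuous.intervalIntegrable (by fun_prop) _ _)
    (Continuous.intervalIntegrable (by fun_prop) _ _), eq_neg_of_add_eq_zero_left hI]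
  module

end Ext

/-- The weighted energy on `[x, y] × S¹`. -/
def cylEnergy {V : Type*} [NormedAddCommGroup V] (m : ℕ) (x y : ℝ) (u : ℝ → ℝ → V) : ℝ :=
  ∫ t in x..y, Real.exp (-2 * m * t) * ∫ θ in (0 : ℝ)..(2 * Real.pi), ‖u t θ‖ ^ 2

/-- The energy of a source term on `(0, T) × S¹`, with a weight that degenerates at both ends. -/
def sourceEnergy {V : Type*} [NormedAddCommGroup V] (T : ℝ) (f : ℝ → ℝ → V) : ℝ :=
  ∫ t in (0 : ℝ)..T, (t * (T - t)) ^ 2 * ∫ θ in (0 : ℝ)..(2 * Real.pi), ‖f t θ‖ ^ 2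

/-- Parseval's identity for the weighted energies. -/
lemma hasSum_segEnergy_coeff (m : ℕ) {u : ℝ → ℝ → ℝ} (hu : Continuous (Function.uncurry u))
    (x y : ℝ) :
    HasSum (fun n : ℤ => segEnergy m x y (cosCoeff n.natAbs u)
      + segEnergy m x y (sinCoeff n.natAbs u)) (2 / Real.pi * cylEnergy m x y u) := by
  have := hasSum_integral_sq_coeff hu (ρ := fun t => Real.exp (-2 * m * t)) (by fun_prop)
    (x := x) (y := y) (fun t => (Real.exp_pos _).le)
  simp only [segEnergy, cylEnergy, Real.norm_eq_abs, sq_abs]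
  simpa only [mul_comm] using this

/-- The three-circle inequality with a source term for real functions: sum the one for the modes. -/
lemma exists_real_source_bound {m : ℕ} (hm : 1 ≤ m) {L κ₀ κ : ℝ} (hL : 0 < L) (h0 : 0 ≤ κ₀)
    (hκ : κ₀ < κ) (hmode : ∀ k, ModeBound m L κ₀ k) :
    ∃ C > 0, ∀ (u ut uθ utt uθθ : ℝ → ℝ → ℝ), C2Data (3 * L) u ut uθ utt uθθ →
      cosCoeff m ut (3 * L / 2) + m * cosCoeff m u (3 * L / 2) = 0 →
      sinCoeff m ut (3 * L / 2) + m * sinCoeff m u (3 * L / 2) = 0 →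
      cylEnergy m L (2 * L) u ≤ κ * (cylEnergy m 0 L u + cylEnergy m (2 * L) (3 * L) u) +
        C * sourceEnergy (3 * L) (fun t θ => utt t θ + uθθ t θ) := by
  obtain ⟨C, hC, hbd⟩ := exists_mode_source_bound hm hL h0 hκ hmode
  refine ⟨C, hC, fun u ut uθ utt uθθ h hcos hsin => ?_⟩
  have hE := hasSum_segEnergy_coeff m h.cont
  have hS := hasSum_integral_sq_coeff h.cont_lap
    (ρ := fun t => (t * (3 * L - t)) ^ 2) (by fun_prop) (x := 0) (y := 3 * L)
    (fun t => sq_nonneg _)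
  have hS' : 2 / Real.pi * sourceEnergy (3 * L) (fun t θ => utt t θ + uθθ t θ) =
      2 / Real.pi * ∫ t in (0 : ℝ)..(3 * L), (t * (3 * L - t)) ^ 2 *
        ∫ θ in (0 : ℝ)..(2 * Real.pi), (utt t θ + uθθ t θ) ^ 2 := by
    simp only [sourceEnergy, Real.norm_eq_abs, sq_abs]
  have hle := hasSum_le (fun n : ℤ => ?_) (hE L (2 * L))
    ((((hE 0 L).add (hE (2 * L) (3 * L))).mul_left κ).add (hS.mul_left C))
  · rw [← hS'] at hle
    have hpi : 0 < 2 / Real.pi := by positivity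
    refine le_of_mul_le_mul_left ?_ hpi
    linarith
  · set k := n.natAbs
    have h1 := hbd k (cosCoeff k u) (cosCoeff k ut) (cosCoeff k fun t θ => utt t θ + uθθ t θ)
      (continuous_cosCoeff h.cont k) (continuous_cosCoeff h.cont_t k)
      (continuous_cosCoeff h.cont_lap k)
      (fun t ht => hasDerivAt_cosCoeff h.cont h.cont_t h.deriv_t k ht)
      (fun t ht => (hasDerivAt_cosCoeff h.cont_t h.cont_tt h.deriv_tt k ht).congr_deriv
        (h.cosCoeff_tt k ht)) (fun hk => by rw [hk]; exact hcos)
    have h2 := hbd k (sinCoeff k u) (sinCoeff k ut) (sinCoeff k fun t θ => utt t θ + uθθ t θ)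
      (continuous_sinCoeff h.cont k) (continuous_sinCoeff h.cont_t k)
      (continuous_sinCoeff h.cont_lap k)
      (fun t ht => hasDerivAt_sinCoeff h.cont h.cont_t h.deriv_t k ht)
      (fun t ht => (hasDerivAt_sinCoeff h.cont_t h.cont_tt h.deriv_tt k ht).congr_deriv
        (h.sinCoeff_tt k ht)) (fun hk => by rw [hk]; exact hsin)
    linarith

/-! ### Extension of the derivatives from the closed cylinder -/

section Extend

variable {V : Type*} [NormedAddCommGroup V] [NormedSpace ℝ V]

lemma hasDerivAt_fst_of_contDiffOn {T : ℝ} {W : ℝ × ℝ → V}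
    (hW : ContDiffOn ℝ 1 W (Icc 0 T ×ˢ univ)) {t : ℝ} (ht : t ∈ Ioo 0 T) (θ : ℝ) :
    HasDerivAt (fun s => W (s, θ)) (fderivWithin ℝ W (Icc 0 T ×ˢ univ) (t, θ) (1, 0)) t ∧
    HasDerivAt (fun s => W (t, s)) (fderivWithin ℝ W (Icc 0 T ×ˢ univ) (t, θ) (0, 1)) θ := by
  have hmem : (t, θ) ∈ Icc 0 T ×ˢ (univ : Set ℝ) := ⟨⟨ht.1.le, ht.2.le⟩, mem_univ _⟩
  have hnhds : Icc 0 T ×ˢ (univ : Set ℝ) ∈ nhds (t, θ) :=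
    prod_mem_nhds (Icc_mem_nhds ht.1 ht.2) Filter.univ_mem
  have hF : HasFDerivAt W (fderivWithin ℝ W (Icc 0 T ×ˢ univ) (t, θ)) (t, θ) :=
    ((hW.differentiableOn one_ne_zero _ hmem).hasFDerivWithinAt).hasFDerivAt hnhds
  exact ⟨hF.comp_hasDerivAt t ((hasDerivAt_id t).prodMk (hasDerivAt_const t θ)),
    hF.comp_hasDerivAt θ ((hasDerivAt_const θ t).prodMk (hasDerivAt_id θ))⟩

/-- A function that is `C²` on the closed cylinder coincides there with one that carries `C2Data`:
extend it and its derivatives by their values on the boundary circles. -/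
lemma exists_c2Data {L : ℝ} (hL : 0 < L) {u : ℝ → ℝ → V} (hu : IsC2 L u) :
    ∃ w wt wθ wtt wθθ : ℝ → ℝ → V, C2Data (3 * L) w wt wθ wtt wθθ ∧
      (∀ t ∈ Icc 0 (3 * L), ∀ θ, w t θ = u t θ) ∧
      ∀ t ∈ Ioo 0 (3 * L), ∀ θ, dt u t θ = wt t θ ∧ dθ u t θ = wθ t θ ∧
        lap u t θ = wtt t θ + wθθ t θ := by
  set T := 3 * L with hT
  have hT0 : 0 < T := by positivity
  obtain ⟨hsm, hper⟩ := hu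
  set S : Set (ℝ × ℝ) := Icc 0 T ×ˢ univ with hS
  have hUD : UniqueDiffOn ℝ S := (uniqueDiffOn_Icc hT0).prod uniqueDiffOn_univ
  have hder : ∀ {n m : WithTop ℕ∞} {W : ℝ × ℝ → V} (v : ℝ × ℝ), ContDiffOn ℝ n W S → m + 1 ≤ n →
      ContDiffOn ℝ m (fun x => fderivWithin ℝ W S x v) S := fun v hW h =>
    (hW.fderivWithin hUD h).clm_apply contDiffOn_const
  set U : ℝ × ℝ → V := Function.uncurry u
  set U1 : ℝ × ℝ → V := fun x => fderivWithin ℝ U S x (1, 0) with hU1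
  set U2 : ℝ × ℝ → V := fun x => fderivWithin ℝ U S x (0, 1) with hU2
  set U11 : ℝ × ℝ → V := fun x => fderivWithin ℝ U1 S x (1, 0) with hU11
  set U22 : ℝ × ℝ → V := fun x => fderivWithin ℝ U2 S x (0, 1) with hU22
  have s1 : ContDiffOn ℝ 1 U1 S := hder _ hsm (by norm_num)
  have s2 : ContDiffOn ℝ 1 U2 S := hder _ hsm (by norm_num)
  have s11 : ContDiffOn ℝ 0 U11 S := hder _ s1 (by norm_num)
  have s22 : ContDiffOn ℝ 0 U22 S := hder _ s2 (by norm_num)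
  have s0 : ContDiffOn ℝ 1 U S := hsm.of_le (by norm_num)
  -- Composing with the retraction `p` of `ℝ` onto `[0, T]` extends by the boundary values.
  set p : ℝ → ℝ := fun t => max 0 (min t T) with hp
  have hpc : Continuous p := by fun_prop
  have hpm : ∀ t, p t ∈ Icc 0 T := fun t => ⟨le_max_left _ _, max_le hT0.le (min_le_right _ _)⟩
  have hpe : ∀ t ∈ Icc 0 T, p t = t := fun t ht => by
    simp only [hp, min_eq_left ht.2, max_eq_right ht.1]
  have hpe' : ∀ t ∈ Ioo 0 T, p t = t := fun t ht => hpe t ⟨ht.1.le, ht.2.le⟩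
  have hext : ∀ {W : ℝ × ℝ → V}, ContinuousOn W S →
      Continuous (Function.uncurry fun t θ => W (p t, θ)) := fun hW =>
    hW.comp_continuous (f := fun x : ℝ × ℝ => (p x.1, x.2)) (by fun_prop)
      fun x => ⟨hpm x.1, mem_univ _⟩
  have hevent : ∀ (W : ℝ × ℝ → V), ∀ t ∈ Ioo 0 T, ∀ θ : ℝ,
      (fun s => W (p s, θ)) =ᶠ[nhds t] fun s => W (s, θ) := fun W t ht θ => by
    filter_upwards [Ioo_mem_nhds ht.1 ht.2] with s hs
    rw [hpe' s hs]
  have hdU : ∀ t ∈ Ioo 0 T, ∀ θ, dt u t θ = U1 (t, θ) := fun t ht θ =>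
    (hasDerivAt_fst_of_contDiffOn s0 ht θ).1.deriv
  have hdU' : ∀ t ∈ Ioo 0 T, ∀ θ, dθ u t θ = U2 (t, θ) := fun t ht θ =>
    (hasDerivAt_fst_of_contDiffOn s0 ht θ).2.deriv
  refine ⟨fun t θ => U (p t, θ), fun t θ => U1 (p t, θ), fun t θ => U2 (p t, θ),
    fun t θ => U11 (p t, θ), fun t θ => U22 (p t, θ), ?_, fun t ht θ => ?_, fun t ht θ => ?_⟩
  · refine ⟨hext s0.continuousOn, hext s1.continuousOn, hext s2.continuousOn,
      hext s11.continuousOn, hext s22.continuousOn, fun t ht θ => ?_, fun t ht θ => ?_,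
      fun t ht θ => ?_, fun t ht θ => ?_, fun t ht => ?_, fun t ht => ?_⟩
    · simp only [hpe' t ht]
      exact (hasDerivAt_fst_of_contDiffOn s0 ht θ).1.congr_of_eventuallyEq (hevent U t ht θ)
    · simp only [hpe' t ht]
      exact (hasDerivAt_fst_of_contDiffOn s1 ht θ).1.congr_of_eventuallyEq (hevent U1 t ht θ)
    · simp only [hpe' t ht]
      exact (hasDerivAt_fst_of_contDiffOn s0 ht θ).2
    · simp only [hpe' t ht]
      exact (hasDerivAt_fst_of_contDiffOn s2 ht θ).2
    · have := hper t ⟨ht.1.le, ht.2.le⟩ 0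
      simp only [hpe' t ht]
      simpa [U] using this
    · simp only [hpe' t ht]
      rw [← hdU' t ht, ← hdU' t ht]
      have hfun : u t = fun θ => u t (θ + 2 * Real.pi) :=
        funext fun θ => (hper t ⟨ht.1.le, ht.2.le⟩ θ).symm
      have : deriv (fun θ => u t (θ + 2 * Real.pi)) 0 = deriv (u t) (0 + 2 * Real.pi) :=
        deriv_comp_add_const _ _ _
      rw [← hfun, zero_add] at this
      exact this.symm
  · simp only [hpe t ht]
    rfl
  · simp only [hpe' t ht]
    refine ⟨hdU t ht θ, hdU' t ht θ, ?_⟩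
    unfold lap
    congr 1
    · have h1 : (fun s => dt u s θ) =ᶠ[nhds t] fun s => U1 (s, θ) := by
        filter_upwards [Ioo_mem_nhds ht.1 ht.2] with s hs
        exact hdU s hs θ
      exact h1.deriv_eq.trans (hasDerivAt_fst_of_contDiffOn s1 ht θ).1.deriv
    · have h1 : (fun s => dθ u t s) = fun s => U2 (t, s) := funext fun s => hdU' t ht s
      change deriv (fun s => dθ u t s) θ = _
      rw [h1]
      exact (hasDerivAt_fst_of_contDiffOn s2 ht θ).2.deriv

lemma C2Data.clm {W : Type*} [NormedAddCommGroup W] [NormedSpace ℝ W] (l : V →L[ℝ] W) {T : ℝ}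
    {u ut uθ utt uθθ : ℝ → ℝ → V} (h : C2Data T u ut uθ utt uθθ) :
    C2Data T (fun t θ => l (u t θ)) (fun t θ => l (ut t θ)) (fun t θ => l (uθ t θ))
      (fun t θ => l (utt t θ)) (fun t θ => l (uθθ t θ)) where
  cont := l.continuous.comp h.cont
  cont_t := l.continuous.comp h.cont_t
  cont_θ := l.continuous.comp h.cont_θ
  cont_tt := l.continuous.comp h.cont_tt
  cont_θθ := l.continuous.comp h.cont_θθ
  deriv_t t ht θ := l.hasFDerivAt.comp_hasDerivAt t (h.deriv_t t ht θ)
  deriv_tt t ht θ := l.hasFDerivAt.comp_hasDerivAt t (h.deriv_tt t ht θ)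
  deriv_θ t ht θ := l.hasFDerivAt.comp_hasDerivAt θ (h.deriv_θ t ht θ)
  deriv_θθ t ht θ := l.hasFDerivAt.comp_hasDerivAt θ (h.deriv_θθ t ht θ)
  periodic t ht := by rw [h.periodic t ht]
  periodic_θ t ht := by rw [h.periodic_θ t ht]

lemma cosCoeff_clm [CompleteSpace V] {W : Type*} [NormedAddCommGroup W] [NormedSpace ℝ W]
    [CompleteSpace W] (l : V →L[ℝ] W) {u : ℝ → ℝ → V} (hu : Continuous (Function.uncurry u))
    (k : ℕ) (t : ℝ) : cosCoeff k (fun t θ => l (u t θ)) t = l (cosCoeff k u t) := by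
  have := continuous_of_uncurry hu t
  simp only [cosCoeff, map_smul]
  rw [← ContinuousLinearMap.intervalIntegral_comp_comm l
    (Continuous.intervalIntegrable (by fun_prop) _ _)]
  simp only [map_smul]

lemma sinCoeff_clm [CompleteSpace V] {W : Type*} [NormedAddCommGroup W] [NormedSpace ℝ W]
    [CompleteSpace W] (l : V →L[ℝ] W) {u : ℝ → ℝ → V} (hu : Continuous (Function.uncurry u))
    (k : ℕ) (t : ℝ) : sinCoeff k (fun t θ => l (u t θ)) t = l (sinCoeff k u t) := by
  have := continuous_of_uncurry hu t
  simp only [sinCoeff, map_smul]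
  rw [← ContinuousLinearMap.intervalIntegral_comp_comm l
    (Continuous.intervalIntegrable (by fun_prop) _ _)]
  simp only [map_smul]

end Extend

/-! ### The three-circle inequality for vector-valued functions -/

lemma integral_weight_sum_sq {n : ℕ} {w : ℝ → ℝ → EuclideanSpace ℝ (Fin n)}
    (hw : Continuous (Function.uncurry w)) {ρ : ℝ → ℝ} (hρ : Continuous ρ) (x y : ℝ) :
    (∫ t in x..y, ρ t * ∫ θ in (0 : ℝ)..(2 * Real.pi), ‖w t θ‖ ^ 2)
      = ∑ j, ∫ t in x..y, ρ t * ∫ θ in (0 : ℝ)..(2 * Real.pi), ‖w t θ j‖ ^ 2 := by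
  have hj : ∀ j, Continuous fun z : ℝ × ℝ => w z.1 z.2 j := fun j =>
    (EuclideanSpace.proj (𝕜 := ℝ) j).continuous.comp hw
  have hj2 : ∀ j, Continuous fun t => ∫ θ in (0 : ℝ)..(2 * Real.pi), ‖w t θ j‖ ^ 2 := fun j =>
    continuous_integral_circle (w := fun t θ => ‖w t θ j‖ ^ 2) (by
      have := hj j
      simp only [Function.uncurry_def]
      fun_prop)
  rw [← intervalIntegral.integral_finsetSum fun j _ => by
    have := hj2 j
    exact Continuous.intervalIntegrable (by fun_prop) _ _]
  congr 1
  ext t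
  rw [← Finset.mul_sum, ← intervalIntegral.integral_finsetSum fun j _ => by
    have : Continuous fun θ => w t θ j :=
      (hj j).comp (Continuous.prodMk continuous_const continuous_id)
    exact Continuous.intervalIntegrable (by fun_prop) _ _]
  simp only [EuclideanSpace.norm_sq_eq]

lemma exists_source_bound {m : ℕ} (hm : 1 ≤ m) {L κ₀ κ : ℝ} (hL : 0 < L) (h0 : 0 ≤ κ₀)
    (hκ : κ₀ < κ) (hmode : ∀ k, ModeBound m L κ₀ k) :
    ∃ C > 0, ∀ (n : ℕ) (u ut uθ utt uθθ : ℝ → ℝ → EuclideanSpace ℝ (Fin n)),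
      C2Data (3 * L) u ut uθ utt uθθ →
      cosCoeff m ut (3 * L / 2) + (m : ℝ) • cosCoeff m u (3 * L / 2) = 0 →
      sinCoeff m ut (3 * L / 2) + (m : ℝ) • sinCoeff m u (3 * L / 2) = 0 →
      cylEnergy m L (2 * L) u ≤ κ * (cylEnergy m 0 L u + cylEnergy m (2 * L) (3 * L) u) +
        C * sourceEnergy (3 * L) (fun t θ => utt t θ + uθθ t θ) := by
  obtain ⟨C, hC, hbd⟩ := exists_real_source_bound hm hL h0 hκ hmode
  refine ⟨C, hC, fun n u ut uθ utt uθθ h hcos hsin => ?_⟩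
  have hE : ∀ x y, cylEnergy m x y u = ∑ j, cylEnergy m x y fun t θ => u t θ j := fun x y =>
    integral_weight_sum_sq h.cont (by fun_prop) x y
  have hS : sourceEnergy (3 * L) (fun t θ => utt t θ + uθθ t θ)
      = ∑ j, sourceEnergy (3 * L) fun t θ => utt t θ j + uθθ t θ j :=
    integral_weight_sum_sq h.cont_lap (by fun_prop) 0 (3 * L)
  rw [hE, hE, hE, hS, ← Finset.sum_add_distrib, Finset.mul_sum, Finset.mul_sum,
    ← Finset.sum_add_distrib]
  refine Finset.sum_le_sum fun j _ => ?_
  set l : EuclideanSpace ℝ (Fin n) →L[ℝ] ℝ := EuclideanSpace.proj j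
  refine hbd _ _ _ _ _ (h.clm l) ?_ ?_
  · change cosCoeff m (fun t θ => l (ut t θ)) _ + m * cosCoeff m (fun t θ => l (u t θ)) _ = 0
    rw [cosCoeff_clm l h.cont, cosCoeff_clm l h.cont_t]
    simpa using congrArg l hcos
  · change sinCoeff m (fun t θ => l (ut t θ)) _ + m * sinCoeff m (fun t θ => l (u t θ)) _ = 0
    rw [sinCoeff_clm l h.cont, sinCoeff_clm l h.cont_t]
    simpa using congrArg l hsin

/-! ### The interior gradient estimate -/

section Caccioppoli

variable {V : Type*} [NormedAddCommGroup V] [InnerProductSpace ℝ V]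
  {T : ℝ} {u ut uθ utt uθθ : ℝ → ℝ → V}

lemma C2Data.integral_inner_θθ (h : C2Data T u ut uθ utt uθθ) {t : ℝ} (ht : t ∈ Ioo 0 T) :
    ∫ θ in (0 : ℝ)..(2 * Real.pi), inner ℝ (u t θ) (uθθ t θ) =
      -∫ θ in (0 : ℝ)..(2 * Real.pi), ‖uθ t θ‖ ^ 2 := by
  have c0 := continuous_of_uncurry h.cont t
  have c1 := continuous_of_uncurry h.cont_θ t
  have c2 := continuous_of_uncurry h.cont_θθ t
  have hI : ∫ θ in (0 : ℝ)..(2 * Real.pi), (inner ℝ (u t θ) (uθθ t θ) + ‖uθ t θ‖ ^ 2) = 0 := by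
    rw [intervalIntegral.integral_eq_sub_of_hasDerivAt
      (f := fun θ => inner ℝ (u t θ) (uθ t θ)) (fun θ _ => ?_)
      (Continuous.intervalIntegrable (by fun_prop) _ _)]
    · simp [h.periodic t ht, h.periodic_θ t ht]
    · refine ((h.deriv_θ t ht θ).inner ℝ (h.deriv_θθ t ht θ)).congr_deriv ?_
      rw [real_inner_self_eq_norm_sq]
  rw [intervalIntegral.integral_add (Continuous.intervalIntegrable (by fun_prop) _ _)
    (Continuous.intervalIntegrable (by fun_prop) _ _)] at hI
  linarith

/-- The Caccioppoli inequality: if `|Δu| ≤ δ (|u| + |∇u|)` with `δ ≤ 1`, then the source `Δu` is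
small against `u` in `L²`, with a weight that vanishes on the boundary circles. It follows by
integrating `d² (∫ |u|² dθ)''` with `d = t (T - t)` by parts twice. -/
lemma C2Data.sourceEnergy_le (h : C2Data T u ut uθ utt uθθ) (hT : 0 < T) {δ : ℝ}
    (hδ1 : δ ≤ 1) (hbd : ∀ t ∈ Ioo 0 T, ∀ θ ∈ Icc 0 (2 * Real.pi),
      ‖utt t θ + uθθ t θ‖ ≤ δ * (‖u t θ‖ + √(‖ut t θ‖ ^ 2 + ‖uθ t θ‖ ^ 2))) :
    sourceEnergy T (fun t θ => utt t θ + uθθ t θ) ≤ 2 * (2 * T ^ 2 + 4 * T ^ 4) * δ ^ 2 *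
      ∫ t in (0 : ℝ)..T, ∫ θ in (0 : ℝ)..(2 * Real.pi), ‖u t θ‖ ^ 2 := by
  have h2pi : (0 : ℝ) ≤ 2 * Real.pi := by positivity
  have k0 := h.cont
  have k1 := h.cont_t
  have k2 := h.cont_θ
  have k3 := h.cont_tt
  have k4 := h.cont_θθ
  simp only [Function.uncurry_def] at k0 k1 k2 k3 k4
  set A : ℝ → ℝ := fun t => ∫ θ in (0 : ℝ)..(2 * Real.pi), ‖u t θ‖ ^ 2 with hA
  set A₁ : ℝ → ℝ := fun t => ∫ θ in (0 : ℝ)..(2 * Real.pi), 2 * inner ℝ (u t θ) (ut t θ) with hA₁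
  set G : ℝ → ℝ := fun t => ∫ θ in (0 : ℝ)..(2 * Real.pi), (‖ut t θ‖ ^ 2 + ‖uθ t θ‖ ^ 2) with hG
  set P : ℝ → ℝ := fun t => ∫ θ in (0 : ℝ)..(2 * Real.pi), inner ℝ (u t θ) (utt t θ + uθθ t θ)
    with hP
  set F : ℝ → ℝ := fun t => ∫ θ in (0 : ℝ)..(2 * Real.pi), ‖utt t θ + uθθ t θ‖ ^ 2 with hF
  have cA : Continuous A := continuous_integral_circle (w := fun t θ => ‖u t θ‖ ^ 2) (by
    simp only [Function.uncurry_def]; fun_prop)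
  have cA₁ : Continuous A₁ := continuous_integral_circle
    (w := fun t θ => 2 * inner ℝ (u t θ) (ut t θ)) (by simp only [Function.uncurry_def]; fun_prop)
  have cG : Continuous G := continuous_integral_circle
    (w := fun t θ => ‖ut t θ‖ ^ 2 + ‖uθ t θ‖ ^ 2) (by simp only [Function.uncurry_def]; fun_prop)
  have cP : Continuous P := continuous_integral_circle
    (w := fun t θ => inner ℝ (u t θ) (utt t θ + uθθ t θ)) (by
      simp only [Function.uncurry_def]; fun_prop)
  have cF : Continuous F := continuous_integral_circle
    (w := fun t θ => ‖utt t θ + uθθ t θ‖ ^ 2) (by simp only [Function.uncurry_def]; fun_prop)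
  have hAd : ∀ t ∈ Ioo 0 T, HasDerivAt A (A₁ t) t := fun t ht =>
    hasDerivAt_integral_circle (T := T) (w := fun t θ => ‖u t θ‖ ^ 2)
      (w₁ := fun t θ => 2 * inner ℝ (u t θ) (ut t θ))
      (by simp only [Function.uncurry_def]; fun_prop)
      (by simp only [Function.uncurry_def]; fun_prop)
      (fun t ht θ => (h.deriv_t t ht θ).norm_sq) ht
  have hA₁d : ∀ t ∈ Ioo 0 T, HasDerivAt A₁ (2 * G t + 2 * P t) t := fun t ht => by
    have h1 := hasDerivAt_integral_circle (T := T) (w := fun t θ => 2 * inner ℝ (u t θ) (ut t θ))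
      (w₁ := fun t θ => 2 * (inner ℝ (u t θ) (utt t θ) + inner ℝ (ut t θ) (ut t θ)))
      (by simp only [Function.uncurry_def]; fun_prop)
      (by simp only [Function.uncurry_def]; fun_prop)
      (fun t ht θ => ((h.deriv_t t ht θ).inner ℝ (h.deriv_tt t ht θ)).const_mul 2) ht
    refine h1.congr_deriv ?_
    have c0 := continuous_of_uncurry h.cont t
    have c1 := continuous_of_uncurry h.cont_θ t
    have c2 := continuous_of_uncurry h.cont_θθ t
    have c3 := continuous_of_uncurry h.cont_t t
    have c4 := continuous_of_uncurry h.cont_tt t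
    have hθ := h.integral_inner_θθ ht
    simp only [hG, hP, inner_add_right, real_inner_self_eq_norm_sq]
    rw [intervalIntegral.integral_const_mul,
      intervalIntegral.integral_add (Continuous.intervalIntegrable (by fun_prop) _ _)
        (Continuous.intervalIntegrable (by fun_prop) _ _),
      intervalIntegral.integral_add (Continuous.intervalIntegrable (by fun_prop) _ _)
        (Continuous.intervalIntegrable (by fun_prop) _ _),
      intervalIntegral.integral_add (Continuous.intervalIntegrable (by fun_prop) _ _)
        (Continuous.intervalIntegrable (by fun_prop) _ _), hθ]
    ring
  have hA0 : ∀ t, 0 ≤ A t := fun t => intervalIntegral.integral_nonneg h2pi fun _ _ => by positivity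
  have hG0 : ∀ t, 0 ≤ G t := fun t => intervalIntegral.integral_nonneg h2pi fun _ _ => by positivity
  have hPle : ∀ t ∈ Ioo 0 T, -P t ≤ 3 / 2 * A t + 1 / 2 * G t := fun t ht => by
    have c0 := continuous_of_uncurry h.cont t
    have c1 := continuous_of_uncurry h.cont_θ t
    have c2 := continuous_of_uncurry h.cont_θθ t
    have c3 := continuous_of_uncurry h.cont_t t
    have c4 := continuous_of_uncurry h.cont_tt t
    simp only [hP, hA, hG]
    rw [← intervalIntegral.integral_neg, ← intervalIntegral.integral_const_mul,
      ← intervalIntegral.integral_const_mul,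
      ← intervalIntegral.integral_add (Continuous.intervalIntegrable (by fun_prop) _ _)
        (Continuous.intervalIntegrable (by fun_prop) _ _)]
    refine intervalIntegral.integral_mono_on h2pi (Continuous.intervalIntegrable (by fun_prop) _ _)
      (Continuous.intervalIntegrable (by fun_prop) _ _) fun θ hθ => ?_
    have h1 := abs_real_inner_le_norm (u t θ) (utt t θ + uθθ t θ)
    have h2 := hbd t ht θ hθ
    have h3 := Real.sq_sqrt (by positivity : 0 ≤ ‖ut t θ‖ ^ 2 + ‖uθ t θ‖ ^ 2)
    have h4 := Real.sqrt_nonneg (‖ut t θ‖ ^ 2 + ‖uθ t θ‖ ^ 2)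
    set g := √(‖ut t θ‖ ^ 2 + ‖uθ t θ‖ ^ 2)
    have h5 : ‖utt t θ + uθθ t θ‖ ≤ ‖u t θ‖ + g :=
      h2.trans (mul_le_of_le_one_left (by positivity) hδ1)
    have h6 := mul_le_mul_of_nonneg_left h5 (norm_nonneg (u t θ))
    have h7 := neg_abs_le (inner ℝ (u t θ) (utt t θ + uθθ t θ))
    rw [← h3]
    nlinarith [sq_nonneg (‖u t θ‖ - g)]
  have hFle : ∀ t ∈ Ioo 0 T, F t ≤ 2 * δ ^ 2 * (A t + G t) := fun t ht => by
    have c0 := continuous_of_uncurry h.cont t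
    have c1 := continuous_of_uncurry h.cont_θ t
    have c2 := continuous_of_uncurry h.cont_θθ t
    have c3 := continuous_of_uncurry h.cont_t t
    have c4 := continuous_of_uncurry h.cont_tt t
    simp only [hF, hA, hG]
    rw [← intervalIntegral.integral_add (Continuous.intervalIntegrable (by fun_prop) _ _)
        (Continuous.intervalIntegrable (by fun_prop) _ _), ← intervalIntegral.integral_const_mul]
    refine intervalIntegral.integral_mono_on h2pi (Continuous.intervalIntegrable (by fun_prop) _ _)
      (Continuous.intervalIntegrable (by fun_prop) _ _) fun θ hθ => ?_
    have h2 := pow_le_pow_left₀ (norm_nonneg _) (hbd t ht θ hθ) 2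
    have h3 := Real.sq_sqrt (by positivity : 0 ≤ ‖ut t θ‖ ^ 2 + ‖uθ t θ‖ ^ 2)
    set g := √(‖ut t θ‖ ^ 2 + ‖uθ t θ‖ ^ 2)
    rw [← h3]
    refine h2.trans ?_
    rw [mul_pow]
    have h8 : (‖u t θ‖ + g) ^ 2 ≤ 2 * (‖u t θ‖ ^ 2 + g ^ 2) := by
      nlinarith [sq_nonneg (‖u t θ‖ - g)]
    nlinarith [mul_le_mul_of_nonneg_left h8 (sq_nonneg δ)]
  -- Both boundary terms vanish with the weight, so nothing is needed about `A₁` at the ends.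
  have hftc : ∫ t in (0 : ℝ)..T, ((t * (T - t)) ^ 2 * (2 * G t + 2 * P t)
      - (2 * (T - 2 * t) ^ 2 - 4 * (t * (T - t))) * A t) = 0 := by
    rw [intervalIntegral.integral_eq_sub_of_hasDerivAt_of_le hT.le
      (f := fun t => (t * (T - t)) ^ 2 * A₁ t - 2 * (t * (T - t)) * (T - 2 * t) * A t)
      (Continuous.continuousOn (by fun_prop)) (fun t ht => ?_)
      (Continuous.intervalIntegrable (by fun_prop) _ _)]
    · simp
    · have w : HasDerivAt (fun t : ℝ => t * (T - t)) (T - 2 * t) t := by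
        have := (hasDerivAt_id t).mul ((hasDerivAt_id t).const_sub T)
        refine this.congr_deriv ?_
        simp only [id]
        ring
      have w' : HasDerivAt (fun t : ℝ => T - 2 * t) (-2) t := by
        simpa using ((hasDerivAt_id t).const_mul 2).const_sub T
      refine (((w.pow 2).mul (hA₁d t ht)).sub
        (((w.const_mul 2).mul w').mul (hAd t ht))).congr_deriv ?_
      simp only [Pi.mul_apply, Pi.pow_apply]
      push_cast
      ring
  set IA := ∫ t in (0 : ℝ)..T, A t with hIA
  set IG := ∫ t in (0 : ℝ)..T, (t * (T - t)) ^ 2 * G t with hIG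
  -- At the ends the weight vanishes, so bounds on the open cylinder suffice.
  have hend : ∀ {X Y : ℝ → ℝ}, (∀ t ∈ Ioo 0 T, X t ≤ Y t) → ∀ t ∈ Icc 0 T,
      (t * (T - t)) ^ 2 * X t ≤ (t * (T - t)) ^ 2 * Y t := fun hXY t ht => by
    rcases eq_or_lt_of_le ht.1 with h0 | h0
    · simp [← h0]
    rcases eq_or_lt_of_le ht.2 with h1 | h1
    · simp [h1]
    exact mul_le_mul_of_nonneg_left (hXY t ⟨h0, h1⟩) (sq_nonneg _)
  have hd2 : ∀ t ∈ Icc 0 T, 0 ≤ t * (T - t) ∧ t * (T - t) ≤ T ^ 2 := fun t ht =>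
    ⟨mul_nonneg ht.1 (sub_nonneg.2 ht.2), by nlinarith [ht.1, ht.2]⟩
  have hd4 : ∀ t ∈ Icc 0 T, (t * (T - t)) ^ 2 ≤ T ^ 4 := fun t ht => by
    have := pow_le_pow_left₀ (hd2 t ht).1 (hd2 t ht).2 2
    rwa [← pow_mul] at this
  have hIGle : IG ≤ (2 * T ^ 2 + 3 * T ^ 4) * IA := by
    have e : IG - (2 * T ^ 2 + 3 * T ^ 4) * IA
        = ∫ t in (0 : ℝ)..T, ((t * (T - t)) ^ 2 * G t - (2 * T ^ 2 + 3 * T ^ 4) * A t) := by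
      rw [intervalIntegral.integral_sub (Continuous.intervalIntegrable (by fun_prop) _ _)
        (Continuous.intervalIntegrable (by fun_prop) _ _), intervalIntegral.integral_const_mul]
    have : IG - (2 * T ^ 2 + 3 * T ^ 4) * IA ≤ 0 := by
      rw [e]
      refine le_of_le_of_eq ?_ hftc
      refine intervalIntegral.integral_mono_on hT.le
        (Continuous.intervalIntegrable (by fun_prop) _ _)
        (Continuous.intervalIntegrable (by fun_prop) _ _) fun t ht => ?_
      have h1 := hend hPle t ht
      have h2 := mul_le_mul_of_nonneg_right (hd4 t ht) (hA0 t)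
      have h3 : (T - 2 * t) ^ 2 ≤ T ^ 2 := by nlinarith [ht.1, ht.2]
      have h4 := mul_le_mul_of_nonneg_right h3 (hA0 t)
      have h5 := mul_nonneg (hd2 t ht).1 (hA0 t)
      nlinarith
    linarith
  have hAle : (∫ t in (0 : ℝ)..T, (t * (T - t)) ^ 2 * A t) ≤ T ^ 4 * IA := by
    rw [hIA, ← intervalIntegral.integral_const_mul]
    refine intervalIntegral.integral_mono_on hT.le (Continuous.intervalIntegrable (by fun_prop) _ _)
      (Continuous.intervalIntegrable (by fun_prop) _ _) fun t ht => ?_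
    exact mul_le_mul_of_nonneg_right (hd4 t ht) (hA0 t)
  calc sourceEnergy T (fun t θ => utt t θ + uθθ t θ)
      = ∫ t in (0 : ℝ)..T, (t * (T - t)) ^ 2 * F t := rfl
    _ ≤ ∫ t in (0 : ℝ)..T, (t * (T - t)) ^ 2 * (2 * δ ^ 2 * (A t + G t)) :=
        intervalIntegral.integral_mono_on hT.le
          (Continuous.intervalIntegrable (u := fun t => (t * (T - t)) ^ 2 * F t) (by fun_prop) _ _)
          (Continuous.intervalIntegrable
            (u := fun t => (t * (T - t)) ^ 2 * (2 * δ ^ 2 * (A t + G t))) (by fun_prop) _ _)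
          (hend hFle)
    _ = 2 * δ ^ 2 * ((∫ t in (0 : ℝ)..T, (t * (T - t)) ^ 2 * A t) + IG) := by
        rw [hIG, ← intervalIntegral.integral_add (Continuous.intervalIntegrable (by fun_prop) _ _)
          (Continuous.intervalIntegrable (by fun_prop) _ _), ← intervalIntegral.integral_const_mul]
        congr 1
        ext t
        ring
    _ ≤ 2 * δ ^ 2 * (T ^ 4 * IA + (2 * T ^ 2 + 3 * T ^ 4) * IA) := by gcongr
    _ = _ := by ring

end Caccioppoli

/-! ### Coefficients of everywhere convergent trigonometric series -/

/-- The Denjoy–Luzin theorem for sine series: absolute convergence at every point implies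
absolute convergence of the coefficients. The sum is bounded by some `M` outside a set of small
measure, and there each `sin²` still has integral at least `2`. -/
lemma summable_of_forall_summable_mul_sin {β : ℕ → ℝ}
    (h : ∀ θ : ℝ, Summable fun k : ℕ => β k * Real.sin ((k + 1 : ℕ) * θ)) :
    Summable fun k => |β k| := by
  have hpi := Real.pi_gt_three
  set φ : ℝ → ℝ≥0∞ := fun θ => ∑' k : ℕ, ENNReal.ofReal |β k * Real.sin ((k + 1 : ℕ) * θ)| with hφ
  have hφm : Measurable φ := Measurable.tsum fun k => by fun_prop
  have hφtop : ∀ θ, φ θ ≠ ∞ := fun θ => by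
    have := (h θ).abs
    rw [hφ]
    exact this.tsum_ofReal_ne_top
  set I : Set ℝ := Ioc 0 (2 * Real.pi) with hI
  have hlim := tendsto_measure_iInter_atTop (μ := volume.restrict I)
    (s := fun M : ℕ => {θ | (M : ℝ≥0∞) < φ θ})
    (fun M => (measurableSet_lt measurable_const hφm).nullMeasurableSet)
    (fun M N hMN θ hθ => lt_of_le_of_lt (Nat.cast_le.2 hMN : (M : ℝ≥0∞) ≤ N) hθ)
    ⟨0, measure_ne_top _ _⟩
  have hempty : (⋂ M : ℕ, {θ | (M : ℝ≥0∞) < φ θ}) = ∅ := by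
    ext θ
    simp only [mem_iInter, mem_ofPred_eq, mem_empty_iff_false, iff_false, not_forall, not_lt]
    obtain ⟨n, hn⟩ := ENNReal.exists_nat_gt (hφtop θ)
    exact ⟨n, hn.le⟩
  rw [hempty, measure_empty] at hlim
  obtain ⟨M, hM⟩ := (hlim.eventually_lt_const zero_lt_one).exists
  set B : Set ℝ := {θ | (M : ℝ≥0∞) < φ θ} with hB
  have hBm : MeasurableSet B := measurableSet_lt measurable_const hφm
  have hintI : ∀ {g : ℝ → ℝ}, Continuous g → IntegrableOn g I := fun hg =>
    (hg.integrableOn_Icc).mono_set Ioc_subset_Icc_self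
  have hvol : (volume.restrict I).real B ≤ 1 := by
    rw [measureReal_def]
    exact ENNReal.toReal_le_of_le_ofReal zero_le_one (by simpa using hM.le)
  -- The integral over the whole period is `π`, and the exceptional set `B` contributes at most `1`.
  have hsin : ∀ k : ℕ, 2 ≤ ∫ θ in I ∩ Bᶜ, Real.sin ((k + 1 : ℕ) * θ) ^ 2 := by
    intro k
    have hc : Continuous fun θ : ℝ => Real.sin ((k + 1 : ℕ) * θ) ^ 2 := by fun_prop
    have htot : ∫ θ in I, Real.sin ((k + 1 : ℕ) * θ) ^ 2 = Real.pi := by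
      have hk : ((k + 1 : ℕ) : ℝ) ≠ 0 := by positivity
      rw [hI, ← intervalIntegral.integral_of_le (by positivity),
        intervalIntegral.integral_comp_mul_left (fun θ => Real.sin θ ^ 2) hk, integral_sin_sq]
      have e2 : Real.sin ((k + 1 : ℕ) * (2 * Real.pi)) = 0 := by
        have := Real.sin_nat_mul_pi (2 * (k + 1))
        rw [← this]
        congr 1
        push_cast
        ring
      rw [e2]
      simp
      field_simp
    have hsplit := setIntegral_union (μ := volume)
      (f := fun θ : ℝ => Real.sin ((k + 1 : ℕ) * θ) ^ 2)
      (s := I ∩ Bᶜ) (t := I ∩ B) (disjoint_compl_left.mono inter_subset_right inter_subset_right)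
      (measurableSet_Ioc.inter hBm) ((hintI hc).mono_set inter_subset_left)
      ((hintI hc).mono_set inter_subset_left)
    rw [← inter_union_distrib_left, compl_union_self, inter_univ, htot] at hsplit
    have hsmall : ∫ θ in I ∩ B, Real.sin ((k + 1 : ℕ) * θ) ^ 2 ≤ 1 := by
      have h1 : ∫ θ in I ∩ B, Real.sin ((k + 1 : ℕ) * θ) ^ 2 ≤ ∫ θ in I ∩ B, (1 : ℝ) :=
        setIntegral_mono ((hintI hc).mono_set inter_subset_left)
          ((hintI continuous_const).mono_set inter_subset_left)
          fun θ => Real.sin_sq_le_one _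
      refine h1.trans ?_
      rw [setIntegral_const, smul_eq_mul, mul_one]
      rwa [inter_comm, ← measureReal_restrict_apply hBm]
    linarith
  refine summable_of_sum_le (c := M * (2 * Real.pi) / 2) (fun k => abs_nonneg _) fun s => ?_
  rw [le_div_iff₀ two_pos, Finset.sum_mul]
  have hcs : Continuous fun θ : ℝ => ∑ k ∈ s, |β k| * Real.sin ((k + 1 : ℕ) * θ) ^ 2 := by fun_prop
  calc ∑ k ∈ s, |β k| * 2
      ≤ ∑ k ∈ s, |β k| * ∫ θ in I ∩ Bᶜ, Real.sin ((k + 1 : ℕ) * θ) ^ 2 :=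
        Finset.sum_le_sum fun k _ => mul_le_mul_of_nonneg_left (hsin k) (abs_nonneg _)
    _ = ∫ θ in I ∩ Bᶜ, ∑ k ∈ s, |β k| * Real.sin ((k + 1 : ℕ) * θ) ^ 2 := by
        rw [integral_finsetSum _ fun k _ =>
          (hintI (by fun_prop :
            Continuous fun θ : ℝ => |β k| * Real.sin ((k + 1 : ℕ) * θ) ^ 2)).mono_set
              inter_subset_left]
        simp only [integral_const_mul]
    _ ≤ ∫ θ in I ∩ Bᶜ, (M : ℝ) := by
        refine setIntegral_mono_on ((hintI hcs).mono_set inter_subset_left)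
          ((hintI continuous_const).mono_set inter_subset_left) (measurableSet_Ioc.inter hBm.compl)
          fun θ hθ => ?_
        have h1 : ∑ k ∈ s, |β k * Real.sin ((k + 1 : ℕ) * θ)| ≤ M := by
          have h2 : ∑ k ∈ s, ENNReal.ofReal |β k * Real.sin ((k + 1 : ℕ) * θ)| ≤ M :=
            (ENNReal.sum_le_tsum s).trans (not_lt.1 hθ.2)
          rw [← ENNReal.ofReal_sum_of_nonneg fun _ _ => abs_nonneg _] at h2
          have := ENNReal.toReal_mono (ENNReal.natCast_ne_top M) h2
          rwa [ENNReal.toReal_ofReal (Finset.sum_nonneg fun _ _ => abs_nonneg _),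
            ENNReal.toReal_natCast] at this
        refine le_trans (Finset.sum_le_sum fun k _ => ?_) h1
        rw [abs_mul]
        refine mul_le_mul_of_nonneg_left ?_ (abs_nonneg _)
        rw [← sq_abs, sq]
        exact mul_le_of_le_one_left (abs_nonneg _) (Real.abs_sin_le_one _)
    _ ≤ M * (2 * Real.pi) := by
        rw [setIntegral_const, smul_eq_mul, mul_comm]
        gcongr
        refine (measureReal_mono inter_subset_left measure_Ioc_lt_top.ne).trans ?_
        rw [Real.volume_real_Ioc_of_le (by positivity), sub_zero]

lemma integral_cos_int_mul (n : ℤ) :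
    ∫ θ in (0 : ℝ)..(2 * Real.pi), Real.cos (n * θ) = if n = 0 then 2 * Real.pi else 0 := by
  split_ifs with h
  · simp [h]
  · have hn : (n : ℝ) ≠ 0 := by exact_mod_cast h
    rw [intervalIntegral.integral_comp_mul_left (fun θ => Real.cos θ) hn, integral_cos]
    have : Real.sin (n * (2 * Real.pi)) = 0 := by
      have := Real.sin_int_mul_pi (n * 2)
      rw [← this]
      congr 1
      push_cast
      ring
    simp [this]

lemma integral_sin_int_mul (n : ℤ) :
    ∫ θ in (0 : ℝ)..(2 * Real.pi), Real.sin (n * θ) = 0 := by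
  by_cases h : n = 0
  · simp [h]
  · have hn : (n : ℝ) ≠ 0 := by exact_mod_cast h
    rw [intervalIntegral.integral_comp_mul_left (fun θ => Real.sin θ) hn, integral_sin]
    have : Real.cos (n * (2 * Real.pi)) = 1 := Real.cos_int_mul_two_pi n
    simp [this]

lemma integral_cos_mul_cos (j l : ℕ) :
    ∫ θ in (0 : ℝ)..(2 * Real.pi), Real.cos (j * θ) * Real.cos (l * θ)
      = if j = l then (if j = 0 then 2 * Real.pi else Real.pi) else 0 := by
  have e : ∀ θ : ℝ, Real.cos (j * θ) * Real.cos (l * θ)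
      = (Real.cos (((j - l : ℤ) : ℝ) * θ) + Real.cos (((j + l : ℤ) : ℝ) * θ)) / 2 := fun θ => by
    push_cast
    rw [sub_mul, add_mul, Real.cos_sub, Real.cos_add]
    ring
  simp only [e]
  rw [intervalIntegral.integral_div, intervalIntegral.integral_add
    (Continuous.intervalIntegrable (by fun_prop) _ _)
    (Continuous.intervalIntegrable (by fun_prop) _ _), integral_cos_int_mul, integral_cos_int_mul]
  split_ifs <;> first | omega | ring

lemma integral_sin_mul_sin (j l : ℕ) (hl : l ≠ 0) :
    ∫ θ in (0 : ℝ)..(2 * Real.pi), Real.sin (j * θ) * Real.sin (l * θ)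
      = if j = l then Real.pi else 0 := by
  have e : ∀ θ : ℝ, Real.sin (j * θ) * Real.sin (l * θ)
      = (Real.cos (((j - l : ℤ) : ℝ) * θ) - Real.cos (((j + l : ℤ) : ℝ) * θ)) / 2 := fun θ => by
    push_cast
    rw [sub_mul, add_mul, Real.cos_sub, Real.cos_add]
    ring
  simp only [e]
  rw [intervalIntegral.integral_div, intervalIntegral.integral_sub
    (Continuous.intervalIntegrable (by fun_prop) _ _)
    (Continuous.intervalIntegrable (by fun_prop) _ _), integral_cos_int_mul, integral_cos_int_mul]
  split_ifs <;> first | omega | ring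

lemma integral_sin_mul_cos (j l : ℕ) :
    ∫ θ in (0 : ℝ)..(2 * Real.pi), Real.sin (j * θ) * Real.cos (l * θ) = 0 := by
  have e : ∀ θ : ℝ, Real.sin (j * θ) * Real.cos (l * θ)
      = (Real.sin (((j - l : ℤ) : ℝ) * θ) + Real.sin (((j + l : ℤ) : ℝ) * θ)) / 2 := fun θ => by
    push_cast
    rw [sub_mul, add_mul, Real.sin_sub, Real.sin_add]
    ring
  simp only [e]
  rw [intervalIntegral.integral_div, intervalIntegral.integral_add
    (Continuous.intervalIntegrable (by fun_prop) _ _)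
    (Continuous.intervalIntegrable (by fun_prop) _ _), integral_sin_int_mul, integral_sin_int_mul]
  simp

/-- The coefficients of an everywhere convergent trigonometric series with continuous sum can be
read off by termwise integration. -/
lemma coeff_of_hasSum_trig {g : ℝ → ℝ} {c : ℝ} {α β : ℕ → ℝ} (hg : Continuous g)
    (h : ∀ θ : ℝ, HasSum (fun k : ℕ => α k * Real.cos ((k + 1 : ℕ) * θ)
      + β k * Real.sin ((k + 1 : ℕ) * θ)) (g θ - c)) :
    (∫ θ in (0 : ℝ)..(2 * Real.pi), Real.cos ((0 : ℕ) * θ) * g θ) = 2 * Real.pi * c ∧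
    (∀ j, ∫ θ in (0 : ℝ)..(2 * Real.pi), Real.cos ((j + 1 : ℕ) * θ) * g θ = Real.pi * α j) ∧
    (∀ j, ∫ θ in (0 : ℝ)..(2 * Real.pi), Real.sin ((j + 1 : ℕ) * θ) * g θ = Real.pi * β j) := by
  have hα : Summable fun k => |α k| := by
    have := (h 0).summable.abs
    simpa using this
  have hβ : Summable fun k => |β k| := by
    refine summable_of_forall_summable_mul_sin fun θ => ?_
    have h1 : Summable fun k : ℕ => α k * Real.cos ((k + 1 : ℕ) * θ) := by
      refine Summable.of_norm_bounded hα fun k => ?_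
      rw [norm_mul]
      exact mul_le_of_le_one_right (abs_nonneg _) (Real.abs_cos_le_one _)
    exact ((h θ).summable.sub h1).congr fun k => by ring
  have key : ∀ w : ℝ → ℝ, Continuous w → (∀ θ, |w θ| ≤ 1) →
      HasSum (fun k : ℕ => α k * (∫ θ in (0 : ℝ)..(2 * Real.pi), w θ * Real.cos ((k + 1 : ℕ) * θ))
        + β k * ∫ θ in (0 : ℝ)..(2 * Real.pi), w θ * Real.sin ((k + 1 : ℕ) * θ))
      ((∫ θ in (0 : ℝ)..(2 * Real.pi), w θ * g θ) - c * ∫ θ in (0 : ℝ)..(2 * Real.pi), w θ) := by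
    intro w hw hw1
    have hs := intervalIntegral.hasSum_integral_of_dominated_convergence (μ := volume)
      (a := 0) (b := 2 * Real.pi)
      (F := fun (k : ℕ) θ => w θ * (α k * Real.cos ((k + 1 : ℕ) * θ)
        + β k * Real.sin ((k + 1 : ℕ) * θ)))
      (f := fun θ => w θ * (g θ - c)) (fun k _ => |α k| + |β k|)
      (fun k => Continuous.aestronglyMeasurable (by fun_prop)) (fun k => ?_)
      (Filter.Eventually.of_forall fun _ _ => hα.add hβ)
      intervalIntegrable_const (Filter.Eventually.of_forall fun θ _ => (h θ).mul_left _)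
    · have e1 : ∫ θ in (0 : ℝ)..(2 * Real.pi), w θ * (g θ - c)
          = (∫ θ in (0 : ℝ)..(2 * Real.pi), w θ * g θ)
            - c * ∫ θ in (0 : ℝ)..(2 * Real.pi), w θ := by
        simp only [mul_sub]
        rw [intervalIntegral.integral_sub (Continuous.intervalIntegrable (by fun_prop) _ _)
          (Continuous.intervalIntegrable (by fun_prop) _ _), intervalIntegral.integral_mul_const,
          mul_comm c]
      rw [← e1]
      refine hs.congr_fun fun k => ?_
      rw [← intervalIntegral.integral_const_mul, ← intervalIntegral.integral_const_mul,
        ← intervalIntegral.integral_add (Continuous.intervalIntegrable (by fun_prop) _ _)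
          (Continuous.intervalIntegrable (by fun_prop) _ _)]
      congr 1
      ext θ
      ring
    · refine Filter.Eventually.of_forall fun θ _ => ?_
      rw [norm_mul]
      refine (mul_le_of_le_one_left (norm_nonneg _) (hw1 θ)).trans ((norm_add_le _ _).trans ?_)
      rw [norm_mul, norm_mul]
      exact add_le_add (mul_le_of_le_one_right (abs_nonneg _) (Real.abs_cos_le_one _))
        (mul_le_of_le_one_right (abs_nonneg _) (Real.abs_sin_le_one _))
  have hcos1 : ∀ j : ℕ, ∫ θ in (0 : ℝ)..(2 * Real.pi), Real.cos (j * θ)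
      = if j = 0 then 2 * Real.pi else 0 := fun j => by
    have := integral_cos_int_mul j
    simpa using this
  have hsin1 : ∀ j : ℕ, ∫ θ in (0 : ℝ)..(2 * Real.pi), Real.sin (j * θ) = 0 := fun j => by
    have := integral_sin_int_mul j
    simpa using this
  have hcs : ∀ j l : ℕ, ∫ θ in (0 : ℝ)..(2 * Real.pi), Real.cos (j * θ) * Real.sin (l * θ) = 0 :=
    fun j l => by
      simp only [mul_comm (Real.cos _)]
      exact integral_sin_mul_cos l j
  refine ⟨?_, fun j => ?_, fun j => ?_⟩
  · have h1 := key (fun θ => Real.cos ((0 : ℕ) * θ)) (by fun_prop) (fun θ => Real.abs_cos_le_one _)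
    simp only [integral_cos_mul_cos, hcs, hcos1] at h1
    have h2 := h1.unique (hasSum_single 0 fun k _ => by
      rw [if_neg (by omega)]
      simp)
    have h3 : ¬(0 = 0 + 1) := by omega
    simp only [if_true, if_neg h3] at h2
    linarith
  · have h1 := key (fun θ => Real.cos ((j + 1 : ℕ) * θ)) (by fun_prop)
      (fun θ => Real.abs_cos_le_one _)
    simp only [integral_cos_mul_cos, hcs, hcos1] at h1
    have h2 := h1.unique (hasSum_single j fun k hk => by
      rw [if_neg (by omega)]
      simp)
    rw [if_pos rfl, if_neg (by omega), if_neg (by omega)] at h2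
    linarith
  · have h1 := key (fun θ => Real.sin ((j + 1 : ℕ) * θ)) (by fun_prop)
      (fun θ => Real.abs_sin_le_one _)
    simp only [integral_sin_mul_cos, integral_sin_mul_sin _ _ (Nat.succ_ne_zero _), hsin1] at h1
    have h2 := h1.unique (hasSum_single j fun k hk => by
      rw [if_neg (by omega)]
      simp)
    rw [if_pos rfl] at h2
    linarith

/-! ### Harmonic functions and single modes -/

lemma energy_eq_cylEnergy {V : Type*} [NormedAddCommGroup V] (m : ℕ) (L : ℝ) (i : ℕ)
    (u : ℝ → ℝ → V) : energy m L i u = cylEnergy m (((i : ℝ) - 1) * L) (i * L) u := by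
  unfold energy cylEnergy
  congr 1
  ext t
  rw [intervalIntegral.integral_mul_const, mul_comm]

lemma cylEnergy_congr {V : Type*} [NormedAddCommGroup V] (m : ℕ) {x y : ℝ} {u w : ℝ → ℝ → V}
    (h : ∀ t ∈ uIcc x y, ∀ θ, u t θ = w t θ) : cylEnergy m x y u = cylEnergy m x y w := by
  unfold cylEnergy
  refine intervalIntegral.integral_congr fun t ht => ?_
  simp only [h t ht]

lemma energy_one_eq {V : Type*} [NormedAddCommGroup V] (m : ℕ) (L : ℝ) (u : ℝ → ℝ → V) :
    energy m L 1 u = cylEnergy m 0 L u := by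
  rw [energy_eq_cylEnergy]
  norm_num

lemma energy_two_eq {V : Type*} [NormedAddCommGroup V] (m : ℕ) (L : ℝ) (u : ℝ → ℝ → V) :
    energy m L 2 u = cylEnergy m L (2 * L) u := by
  rw [energy_eq_cylEnergy]
  norm_num

lemma energy_three_eq {V : Type*} [NormedAddCommGroup V] (m : ℕ) (L : ℝ) (u : ℝ → ℝ → V) :
    energy m L 3 u = cylEnergy m (2 * L) (3 * L) u := by
  rw [energy_eq_cylEnergy]
  norm_num

lemma isHarmonic_hom_mul_cos (L : ℝ) (k : ℕ) (a b : ℝ) :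
    IsHarmonic L fun t θ => hom k a b t * Real.cos (k * θ) := by
  refine ⟨⟨?_, fun t _ θ => ?_⟩, fun t _ θ => ?_⟩
  · refine ContDiff.contDiffOn ?_
    unfold hom
    simp only [Function.uncurry_def]
    split_ifs <;> fun_prop
  · have : Real.cos (k * (θ + 2 * Real.pi)) = Real.cos (k * θ) := by
      rw [mul_add]
      exact Real.cos_add_nat_mul_two_pi _ k
    simp only [this]
  · unfold lap
    have h1 : dt (fun t θ => hom k a b t * Real.cos (k * θ))
        = fun t θ => homDeriv k a b t * Real.cos (k * θ) := by
      ext t θ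
      exact ((hasDerivAt_hom k a b t).mul_const _).deriv
    have h2 : dθ (fun t θ => hom k a b t * Real.cos (k * θ))
        = fun t θ => hom k a b t * -(k * Real.sin (k * θ)) := by
      ext t θ
      exact ((hasDerivAt_cos_mul k θ).const_mul _).deriv
    have h3 : dt (fun t θ => homDeriv k a b t * Real.cos (k * θ)) t θ
        = (k : ℝ) ^ 2 * hom k a b t * Real.cos (k * θ) :=
      ((hasDerivAt_homDeriv k a b t).mul_const _).deriv
    have h4 : dθ (fun t θ => hom k a b t * -(k * Real.sin (k * θ))) t θ
        = hom k a b t * -(k * (k * Real.cos (k * θ))) :=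
      (((hasDerivAt_sin_mul k θ).const_mul (k : ℝ)).neg.const_mul _).deriv
    rw [h1, h2, h3, h4]
    ring

/-- The threshold condition, applied to `c(t) cos kθ`, is a strict inequality for every single
mode `k ≠ m`. -/
lemma IsHarmonicThreshold.mode {m : ℕ} {q L₀ L : ℝ} (h : IsHarmonicThreshold m q L₀) (hL : L₀ < L)
    {k : ℕ} (hk : k ≠ m) (a b : ℝ) :
    segEnergy m L (2 * L) (hom k a b) = 0 ∨ segEnergy m L (2 * L) (hom k a b) <
      Real.exp (-(q * L)) *
        (segEnergy m 0 L (hom k a b) + segEnergy m (2 * L) (3 * L) (hom k a b)) := by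
  have hpi := Real.pi_pos
  set ck := ∫ θ in (0 : ℝ)..(2 * Real.pi), Real.cos (k * θ) ^ 2 with hck
  have hck0 : 0 < ck := intervalIntegral.integral_pos (by positivity)
    (Continuous.continuousOn (by fun_prop)) (fun _ _ => by positivity)
    ⟨0, ⟨le_rfl, by positivity⟩, by simp⟩
  have hE : ∀ x y, cylEnergy m x y (fun t θ => hom k a b t * Real.cos (k * θ))
      = ck * segEnergy m x y (hom k a b) := fun x y => by
    unfold cylEnergy segEnergy
    rw [← intervalIntegral.integral_const_mul]
    congr 1
    ext t
    simp only [Real.norm_eq_abs, sq_abs, mul_pow]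
    rw [intervalIntegral.integral_const_mul]
    ring
  have hex : ∃ (a₀ b₀ : ℝ) (α β α' β' : ℕ → ℝ),
      HasExpansion L (fun t θ => hom k a b t * Real.cos (k * θ)) a₀ b₀ α β α' β' ∧
        β m = 0 ∧ β' m = 0 := by
    by_cases hk0 : k = 0
    · refine ⟨a, b, 0, 0, 0, 0, fun t _ θ => ?_, rfl, rfl⟩
      simp [hom, hk0, hasSum_zero]
    · refine ⟨0, 0, Pi.single k a, Pi.single k b, 0, 0, fun t _ θ => ?_, ?_, rfl⟩
      · obtain ⟨l, rfl⟩ := Nat.exists_eq_succ_of_ne_zero hk0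
        convert hasSum_single l fun j hj => ?_ using 1
        · simp [hom]
        · simp [hj]
      · rw [Pi.single_eq_of_ne (Ne.symm hk)]
  obtain ⟨a₀, b₀, α, β, α', β', hexp, hβ, hβ'⟩ := hex
  have := h.2 L hL _ a₀ b₀ α β α' β' (isHarmonic_hom_mul_cos L k a b) hexp hβ hβ'
  rw [energy_one_eq, energy_two_eq, energy_three_eq, hE, hE, hE] at this
  refine this.imp (fun h0 => (mul_eq_zero.1 h0).resolve_left hck0.ne') fun h0 => ?_
  refine lt_of_mul_lt_mul_left (a := ck) ?_ hck0.le
  linarith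

/-- For an admissible threshold and `L` large enough a single constant below `e^{-qL}` works for
all modes: infinitely many are covered by the estimate for `k ≥ m`, and each of the finitely many
others by the threshold condition and compactness. -/
lemma IsHarmonicThreshold.exists_forall_modeBound {m : ℕ} (hm : 1 ≤ m) {q L₀ L : ℝ} (hq : q < 2)
    (h : IsHarmonicThreshold m q L₀) (hL : L₀ < L) (hL' : 2 * Real.log 2 / (2 - q) < L) :
    ∃ κ, 0 ≤ κ ∧ κ < Real.exp (-(q * L)) ∧ ∀ k, ModeBound m L κ k := by
  have hL0 : 0 < L := h.1.trans hL
  -- Take the maximum of the constants of the modes below `m`.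
  have hlow : ∀ N ≤ m, ∃ κ, 0 ≤ κ ∧ κ < Real.exp (-(q * L)) ∧ ∀ k < N, ModeBound m L κ k := by
    intro N
    induction N with
    | zero => exact fun _ => ⟨0, le_rfl, Real.exp_pos _, fun k hk => absurd hk (Nat.not_lt_zero k)⟩
    | succ N ih =>
      intro hN
      obtain ⟨κ, hκ0, hκ, hκb⟩ := ih (by omega)
      obtain ⟨κ', hκ0', hκ', hκb'⟩ := exists_modeBound_of_strict hL0 (Real.exp_pos _)
        (h.mode hL (by omega : N ≠ m))
      refine ⟨max κ κ', le_max_of_le_left hκ0, max_lt hκ hκ', fun k hk => ?_⟩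
      rcases Nat.lt_succ_iff_lt_or_eq.1 hk with h1 | h1
      · exact (hκb k h1).mono hL0 (le_max_left _ _)
      · rw [h1]
        exact hκb'.mono hL0 (le_max_right _ _)
  obtain ⟨κ, hκ0, hκ, hκb⟩ := hlow m le_rfl
  have h2 : 2 * Real.exp (-(2 * L)) < Real.exp (-(q * L)) := by
    have h3 : Real.log 2 < (2 - q) * L := by
      rw [div_lt_iff₀ (by linarith)] at hL'
      have := Real.log_pos one_lt_two
      linarith
    have h4 : 2 < Real.exp ((2 - q) * L) := (Real.log_lt_iff_lt_exp two_pos).1 h3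
    calc 2 * Real.exp (-(2 * L)) < Real.exp ((2 - q) * L) * Real.exp (-(2 * L)) := by gcongr
      _ = Real.exp (-(q * L)) := by
        rw [← Real.exp_add]
        congr 1
        ring
  refine ⟨max κ (2 * Real.exp (-(2 * L))), le_max_of_le_left hκ0, max_lt hκ h2, fun k => ?_⟩
  rcases lt_trichotomy k m with h1 | h1 | h1
  · exact (hκb k h1).mono hL0 (le_max_left _ _)
  · rw [h1]
    exact (modeBound_self hm hL0).mono hL0 (le_max_right _ _)
  · exact (modeBound_of_gt h1 hL0).mono hL0 (le_max_right _ _)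

lemma exists_hom_coeff {L : ℝ} {h w : ℝ → ℝ → ℝ} {a₀ b₀ : ℝ} {a b a' b' : ℕ → ℝ}
    (hexp : HasExpansion L h a₀ b₀ a b a' b') (hw : Continuous (Function.uncurry w))
    (hwh : ∀ t ∈ Icc 0 (3 * L), ∀ θ, w t θ = h t θ) (k : ℕ) :
    (∃ α β : ℝ, (1 ≤ k → β = b k) ∧ ∀ t ∈ Icc 0 (3 * L), cosCoeff k w t = hom k α β t) ∧
    (∃ α β : ℝ, (1 ≤ k → β = b' k) ∧ ∀ t ∈ Icc 0 (3 * L), sinCoeff k w t = hom k α β t) := by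
  have hpi := Real.pi_pos
  have hco := fun t (ht : t ∈ Icc 0 (3 * L)) => coeff_of_hasSum_trig (continuous_of_uncurry hw t)
    (c := a₀ + b₀ * t) (fun θ => by
      rw [hwh t ht]
      exact hexp t ht θ)
  rcases Nat.eq_zero_or_pos k with hk | hk
  · subst hk
    refine ⟨⟨2 * a₀, 2 * b₀, by omega, fun t ht => ?_⟩, ⟨0, 0, by omega, fun t ht => ?_⟩⟩
    · have := (hco t ht).1
      simp only [cosCoeff, smul_eq_mul, hom, if_true]
      rw [this]
      field_simp
    · simp [sinCoeff, hom]
  · obtain ⟨l, rfl⟩ := Nat.exists_eq_succ_of_ne_zero hk.ne'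
    refine ⟨⟨a (l + 1), b (l + 1), fun _ => rfl, fun t ht => ?_⟩,
      ⟨a' (l + 1), b' (l + 1), fun _ => rfl, fun t ht => ?_⟩⟩
    · have := (hco t ht).2.1 l
      simp only [cosCoeff, smul_eq_mul, hom, Nat.succ_eq_add_one]
      rw [this, if_neg (by omega)]
      field_simp
    · have := (hco t ht).2.2 l
      simp only [sinCoeff, smul_eq_mul, hom, Nat.succ_eq_add_one]
      rw [this, if_neg (by omega)]
      field_simp

/-- Admissible thresholds exist: sum the inequalities for the modes by Parseval's identity. -/
lemma exists_isHarmonicThreshold {m : ℕ} (hm : 1 ≤ m) {q : ℝ} (hq : q < 2) :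
    ∃ L₀, IsHarmonicThreshold m q L₀ := by
  obtain ⟨L₀, hL₀, hmode⟩ := Cylinder.exists_forall_modeBound hm hq
  refine ⟨L₀, hL₀, fun L hL h a₀ b₀ a b a' b' hh hexp hb hb' => ?_⟩
  obtain ⟨κ, hκ0, hκ, hmb⟩ := hmode L hL
  have hL0 : 0 < L := hL₀.trans hL
  obtain ⟨w, wt, wθ, wtt, wθθ, hw, hwh, -⟩ := exists_c2Data hL0 hh.1
  have hsub : ∀ x y : ℝ, 0 ≤ x → x ≤ y → y ≤ 3 * L → uIcc x y ⊆ Icc 0 (3 * L) :=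
    fun x y hx hxy hy => by
      rw [uIcc_of_le hxy]
      exact Icc_subset_Icc hx hy
  have hE := hasSum_segEnergy_coeff m hw.cont
  have hbound : ∀ (c : ℝ → ℝ) (k : ℕ) (α β : ℝ), (k = m → β = 0) →
      (∀ t ∈ Icc 0 (3 * L), c t = hom k α β t) →
      segEnergy m L (2 * L) c ≤ κ * (segEnergy m 0 L c + segEnergy m (2 * L) (3 * L) c) := by
    intro c k α β hβ hc
    have hseg : ∀ x y : ℝ, 0 ≤ x → x ≤ y → y ≤ 3 * L →
        segEnergy m x y c = segEnergy m x y (hom k α β) := fun x y hx hxy hy =>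
      intervalIntegral.integral_congr fun t ht => by
        simp only [hc t (hsub x y hx hxy hy ht)]
    rw [hseg L (2 * L) hL0.le (by linarith) (by linarith), hseg 0 L le_rfl hL0.le (by linarith),
      hseg (2 * L) (3 * L) (by linarith) (by linarith) le_rfl]
    exact hmb k α β hβ
  have hle : cylEnergy m L (2 * L) w ≤
      κ * (cylEnergy m 0 L w + cylEnergy m (2 * L) (3 * L) w) := by
    have := hasSum_le (fun n : ℤ => ?_) (hE L (2 * L))
      (((hE 0 L).add (hE (2 * L) (3 * L))).mul_left κ)
    · have hpi : 0 < 2 / Real.pi := by positivity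
      refine le_of_mul_le_mul_left ?_ hpi
      linarith
    · obtain ⟨⟨α, β, hβ, hc⟩, ⟨α', β', hβ', hc'⟩⟩ := exists_hom_coeff hexp hw.cont hwh n.natAbs
      have h1 := hbound _ _ α β (fun hk => by rw [hβ (by omega), hk, hb]) hc
      have h2 := hbound _ _ α' β' (fun hk => by rw [hβ' (by omega), hk, hb']) hc'
      linarith
  have hcy : ∀ x y : ℝ, 0 ≤ x → x ≤ y → y ≤ 3 * L → cylEnergy m x y h = cylEnergy m x y w :=
    fun x y hx hxy hy => cylEnergy_congr m fun t ht θ => (hwh t (hsub x y hx hxy hy ht) θ).symm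
  rw [energy_one_eq, energy_two_eq, energy_three_eq,
    hcy L (2 * L) hL0.le (by linarith) (by linarith), hcy 0 L le_rfl hL0.le (by linarith),
    hcy (2 * L) (3 * L) (by linarith) (by linarith) le_rfl]
  have hnn : ∀ x y : ℝ, x ≤ y → 0 ≤ cylEnergy m x y w := fun x y hxy =>
    intervalIntegral.integral_nonneg hxy fun t _ => mul_nonneg (Real.exp_pos _).le
      (intervalIntegral.integral_nonneg (by positivity) fun _ _ => by positivity)
  have hX := add_nonneg (hnn 0 L hL0.le) (hnn (2 * L) (3 * L) (by linarith))
  rcases hX.eq_or_lt with h0 | h0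
  · left
    rw [← h0, mul_zero] at hle
    exact le_antisymm hle (hnn L (2 * L) (by linarith))
  · right
    exact hle.trans_lt (mul_lt_mul_of_pos_right hκ h0)

/-! ### The growing mode of degree `m` -/

section GrowMode

variable {V : Type*} [NormedAddCommGroup V] [InnerProductSpace ℝ V]

/-- The harmonic function `(2m)⁻¹ e^{mt} (A cos mθ + B sin mθ)`. Each `proj m L i u` is of this
form. -/
def growMode (m : ℕ) (A B : V) (t θ : ℝ) : V :=
  (Real.exp (m * t) / (2 * m)) • (Real.cos (m * θ) • A + Real.sin (m * θ) • B)

/-- The cosine component of `e^{-mt} g⁺(u)`, taken at the midpoint of the `i`-th interval. -/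
def growCos (m : ℕ) (L : ℝ) (i : ℕ) (u : ℝ → ℝ → V) : V :=
  Real.exp (-(m * mid L i)) • gPlusCos m u (mid L i)

/-- The sine component of `e^{-mt} g⁺(u)`, taken at the midpoint of the `i`-th interval. -/
def growSin (m : ℕ) (L : ℝ) (i : ℕ) (u : ℝ → ℝ → V) : V :=
  Real.exp (-(m * mid L i)) • gPlusSin m u (mid L i)

lemma proj_eq_growMode (m : ℕ) (L : ℝ) (i : ℕ) (u : ℝ → ℝ → V) :
    proj m L i u = growMode m (growCos m L i u) (growSin m L i u) := by
  ext t θ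
  have e : Real.exp (m * t - m * mid L i) = Real.exp (m * t) * Real.exp (-(m * mid L i)) := by
    rw [← Real.exp_add, sub_eq_add_neg]
  simp only [proj, growMode, growCos, growSin, e]
  module

lemma gamma_sq (m : ℕ) (L : ℝ) (i : ℕ) (u : ℝ → ℝ → V) :
    gamma m L i u ^ 2 = ‖growCos m L i u‖ ^ 2 + ‖growSin m L i u‖ ^ 2 := by
  unfold gamma growCos growSin
  rw [mul_pow, Real.sq_sqrt (by positivity), norm_smul, norm_smul, mul_pow, mul_pow,
    Real.norm_eq_abs, sq_abs]
  ring

lemma growMode_sub (m : ℕ) (A B A' B' : V) (t θ : ℝ) :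
    growMode m A B t θ - growMode m A' B' t θ = growMode m (A - A') (B - B') t θ := by
  simp only [growMode]
  module

lemma continuous_growMode (m : ℕ) (A B : V) :
    Continuous (Function.uncurry (growMode m A B)) := by
  simp only [Function.uncurry_def, growMode]
  fun_prop

lemma integral_cos_sq_mul {m : ℕ} (hm : 1 ≤ m) :
    ∫ θ in (0 : ℝ)..(2 * Real.pi), Real.cos (m * θ) ^ 2 = Real.pi := by
  have := integral_cos_mul_cos m m
  simp only [← sq] at this
  rw [this, if_pos trivial, if_neg (by omega)]

lemma integral_sin_sq_mul {m : ℕ} (hm : 1 ≤ m) :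
    ∫ θ in (0 : ℝ)..(2 * Real.pi), Real.sin (m * θ) ^ 2 = Real.pi := by
  have := integral_sin_mul_sin m m (by omega)
  simp only [← sq] at this
  rw [this, if_pos trivial]

lemma integral_norm_sq_cos_add_sin {m : ℕ} (hm : 1 ≤ m) (A B : V) :
    ∫ θ in (0 : ℝ)..(2 * Real.pi), ‖Real.cos (m * θ) • A + Real.sin (m * θ) • B‖ ^ 2
      = Real.pi * (‖A‖ ^ 2 + ‖B‖ ^ 2) := by
  have e : ∀ θ : ℝ, ‖Real.cos (m * θ) • A + Real.sin (m * θ) • B‖ ^ 2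
      = Real.cos (m * θ) ^ 2 * ‖A‖ ^ 2
        + Real.sin (m * θ) * Real.cos (m * θ) * (2 * inner ℝ A B)
        + Real.sin (m * θ) ^ 2 * ‖B‖ ^ 2 := fun θ => by
    rw [norm_add_sq_real, norm_smul, norm_smul, mul_pow, mul_pow, Real.norm_eq_abs,
      Real.norm_eq_abs, sq_abs, sq_abs, real_inner_smul_left, real_inner_smul_right]
    ring
  simp only [e]
  rw [intervalIntegral.integral_add (Continuous.intervalIntegrable (by fun_prop) _ _)
      (Continuous.intervalIntegrable (by fun_prop) _ _),
    intervalIntegral.integral_add (Continuous.intervalIntegrable (by fun_prop) _ _)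
      (Continuous.intervalIntegrable (by fun_prop) _ _), intervalIntegral.integral_mul_const,
    intervalIntegral.integral_mul_const, intervalIntegral.integral_mul_const,
    integral_cos_sq_mul hm, integral_sin_sq_mul hm, integral_sin_mul_cos]
  ring

lemma cylEnergy_growMode {m : ℕ} (hm : 1 ≤ m) (x y : ℝ) (A B : V) :
    cylEnergy m x y (growMode m A B)
      = (y - x) * Real.pi / (4 * m ^ 2) * (‖A‖ ^ 2 + ‖B‖ ^ 2) := by
  have hm0 : (m : ℝ) ≠ 0 := by positivity
  have e : ∀ t, Real.exp (-2 * m * t) * ∫ θ in (0 : ℝ)..(2 * Real.pi), ‖growMode m A B t θ‖ ^ 2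
      = Real.pi / (4 * m ^ 2) * (‖A‖ ^ 2 + ‖B‖ ^ 2) := fun t => by
    simp only [growMode, norm_smul, mul_pow]
    rw [intervalIntegral.integral_const_mul, integral_norm_sq_cos_add_sin hm, Real.norm_eq_abs,
      sq_abs, div_pow, ← Real.exp_nat_mul]
    have h1 : Real.exp (-2 * m * t) * Real.exp ((2 : ℕ) * (m * t)) = 1 := by
      rw [← Real.exp_add, Real.exp_eq_one_iff]
      push_cast
      ring
    calc Real.exp (-2 * m * t) * (Real.exp ((2 : ℕ) * (m * t)) / (2 * m) ^ 2 *
          (Real.pi * (‖A‖ ^ 2 + ‖B‖ ^ 2)))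
        = (Real.exp (-2 * m * t) * Real.exp ((2 : ℕ) * (m * t))) / (2 * m) ^ 2 *
          (Real.pi * (‖A‖ ^ 2 + ‖B‖ ^ 2)) := by ring
      _ = _ := by
        rw [h1]
        ring
  unfold cylEnergy
  simp only [e]
  rw [intervalIntegral.integral_const, smul_eq_mul]
  ring

lemma cosCoeff_growMode [CompleteSpace V] {m : ℕ} (hm : 1 ≤ m) (A B : V) (t : ℝ) :
    cosCoeff m (growMode m A B) t = (Real.exp (m * t) / (2 * m)) • A := by
  have e : ∀ θ : ℝ, Real.cos (m * θ) • growMode m A B t θ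
      = (Real.cos (m * θ) ^ 2) • (Real.exp (m * t) / (2 * m)) • A
        + (Real.sin (m * θ) * Real.cos (m * θ)) • (Real.exp (m * t) / (2 * m)) • B := fun θ => by
    simp only [growMode]
    module
  simp only [cosCoeff, e]
  rw [intervalIntegral.integral_add (Continuous.intervalIntegrable (by fun_prop) _ _)
      (Continuous.intervalIntegrable (by fun_prop) _ _), intervalIntegral.integral_smul_const,
    intervalIntegral.integral_smul_const, integral_cos_sq_mul hm, integral_sin_mul_cos, zero_smul,
    add_zero, smul_smul, one_div, inv_mul_cancel₀ Real.pi_ne_zero, one_smul]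

lemma sinCoeff_growMode [CompleteSpace V] {m : ℕ} (hm : 1 ≤ m) (A B : V) (t : ℝ) :
    sinCoeff m (growMode m A B) t = (Real.exp (m * t) / (2 * m)) • B := by
  have e : ∀ θ : ℝ, Real.sin (m * θ) • growMode m A B t θ
      = (Real.sin (m * θ) * Real.cos (m * θ)) • (Real.exp (m * t) / (2 * m)) • A
        + (Real.sin (m * θ) ^ 2) • (Real.exp (m * t) / (2 * m)) • B := fun θ => by
    simp only [growMode]
    module
  simp only [sinCoeff, e]
  rw [intervalIntegral.integral_add (Continuous.intervalIntegrable (by fun_prop) _ _)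
      (Continuous.intervalIntegrable (by fun_prop) _ _), intervalIntegral.integral_smul_const,
    intervalIntegral.integral_smul_const, integral_sin_sq_mul hm, integral_sin_mul_cos, zero_smul,
    zero_add, smul_smul, one_div, inv_mul_cancel₀ Real.pi_ne_zero, one_smul]

lemma cosCoeff_sub (k : ℕ) {u w : ℝ → ℝ → V} (hu : Continuous (Function.uncurry u))
    (hw : Continuous (Function.uncurry w)) (t : ℝ) :
    cosCoeff k (fun t θ => u t θ - w t θ) t = cosCoeff k u t - cosCoeff k w t := by
  have h1 := continuous_of_uncurry hu t
  have h2 := continuous_of_uncurry hw t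
  simp only [cosCoeff, smul_sub]
  rw [intervalIntegral.integral_sub (Continuous.intervalIntegrable (by fun_prop) _ _)
      (Continuous.intervalIntegrable (by fun_prop) _ _), smul_sub]

lemma sinCoeff_sub (k : ℕ) {u w : ℝ → ℝ → V} (hu : Continuous (Function.uncurry u))
    (hw : Continuous (Function.uncurry w)) (t : ℝ) :
    sinCoeff k (fun t θ => u t θ - w t θ) t = sinCoeff k u t - sinCoeff k w t := by
  have h1 := continuous_of_uncurry hu t
  have h2 := continuous_of_uncurry hw t
  simp only [sinCoeff, smul_sub]
  rw [intervalIntegral.integral_sub (Continuous.intervalIntegrable (by fun_prop) _ _)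
      (Continuous.intervalIntegrable (by fun_prop) _ _), smul_sub]

/-- Subtracting a growing mode changes neither the regularity nor the Laplacian. -/
lemma C2Data.sub_growMode {T : ℝ} {u ut uθ utt uθθ : ℝ → ℝ → V} (h : C2Data T u ut uθ utt uθθ)
    (m : ℕ) (A B : V) :
    C2Data T (fun t θ => u t θ - growMode m A B t θ)
      (fun t θ => ut t θ - growMode m ((m : ℝ) • A) ((m : ℝ) • B) t θ)
      (fun t θ => uθ t θ - growMode m ((m : ℝ) • B) (-((m : ℝ) • A)) t θ)
      (fun t θ => utt t θ - growMode m ((m : ℝ) • (m : ℝ) • A) ((m : ℝ) • (m : ℝ) • B) t θ)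
      (fun t θ => uθθ t θ
        - growMode m (-((m : ℝ) • (m : ℝ) • A)) (-((m : ℝ) • (m : ℝ) • B)) t θ) := by
  have hdt : ∀ (A B : V) (t θ : ℝ), HasDerivAt (fun s => growMode m A B s θ)
      (growMode m ((m : ℝ) • A) ((m : ℝ) • B) t θ) t := fun A B t θ => by
    have h1 : HasDerivAt (fun t : ℝ => (m : ℝ) * t) m t := by
      simpa using (hasDerivAt_id t).const_mul (m : ℝ)
    refine ((h1.exp.div_const (2 * (m : ℝ))).smul_const _).congr_deriv ?_
    simp only [growMode]
    module
  have hdθ : ∀ (A B : V) (t θ : ℝ), HasDerivAt (growMode m A B t)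
      (growMode m ((m : ℝ) • B) (-((m : ℝ) • A)) t θ) θ := fun A B t θ => by
    refine ((((hasDerivAt_cos_mul m θ).smul_const A).add
      ((hasDerivAt_sin_mul m θ).smul_const B)).const_smul _).congr_deriv ?_
    simp only [growMode]
    module
  have hper : ∀ (A B : V) (t : ℝ), growMode m A B t (2 * Real.pi) = growMode m A B t 0 :=
    fun A B t => by
      have e1 : Real.cos (m * (2 * Real.pi)) = 1 := Real.cos_nat_mul_two_pi m
      have e2 : Real.sin (m * (2 * Real.pi)) = 0 := by
        have := Real.sin_nat_mul_pi (2 * m)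
        rw [← this]
        congr 1
        push_cast
        ring
      simp [growMode, e1, e2]
  refine ⟨h.cont.sub (continuous_growMode m _ _), h.cont_t.sub (continuous_growMode m _ _),
    h.cont_θ.sub (continuous_growMode m _ _), h.cont_tt.sub (continuous_growMode m _ _),
    h.cont_θθ.sub (continuous_growMode m _ _), fun t ht θ => (h.deriv_t t ht θ).sub (hdt _ _ _ _),
    fun t ht θ => (h.deriv_tt t ht θ).sub (hdt _ _ _ _),
    fun t ht θ => (h.deriv_θ t ht θ).sub (hdθ _ _ _ _), fun t ht θ => ?_, fun t ht => ?_,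
    fun t ht => ?_⟩
  · refine ((h.deriv_θθ t ht θ).sub (hdθ _ _ _ _)).congr_deriv ?_
    simp only [smul_neg]
  · simp only [h.periodic t ht, hper]
  · simp only [h.periodic_θ t ht, hper]

lemma lap_sub_growMode (m : ℕ) (A B : V) (utt uθθ : ℝ → ℝ → V) (t θ : ℝ) :
    (utt t θ - growMode m ((m : ℝ) • (m : ℝ) • A) ((m : ℝ) • (m : ℝ) • B) t θ) + (uθθ t θ
        - growMode m (-((m : ℝ) • (m : ℝ) • A)) (-((m : ℝ) • (m : ℝ) • B)) t θ)
      = utt t θ + uθθ t θ := by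
  simp only [growMode]
  module

end GrowMode

/-! ### Variation of the growing coefficient -/

section Variation

variable {V : Type*} [NormedAddCommGroup V] [InnerProductSpace ℝ V]

lemma norm_integral_circle_sq_le {f : ℝ → V} (hf : Continuous f) {w : ℝ → ℝ} (hw : Continuous w)
    (hw1 : ∀ θ, |w θ| ≤ 1) :
    ‖(1 / Real.pi) • ∫ θ in (0 : ℝ)..(2 * Real.pi), w θ • f θ‖ ^ 2
      ≤ ∫ θ in (0 : ℝ)..(2 * Real.pi), ‖f θ‖ ^ 2 := by
  have hpi := Real.pi_gt_three
  have h2pi : (0 : ℝ) < 2 * Real.pi := by positivity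
  have h1 : ‖∫ θ in (0 : ℝ)..(2 * Real.pi), w θ • f θ‖ ≤ ∫ θ in (0 : ℝ)..(2 * Real.pi), ‖f θ‖ := by
    refine (intervalIntegral.norm_integral_le_integral_norm h2pi.le).trans ?_
    refine intervalIntegral.integral_mono_on h2pi.le
      (Continuous.intervalIntegrable (by fun_prop) _ _)
      (Continuous.intervalIntegrable (by fun_prop) _ _) fun θ _ => ?_
    rw [norm_smul]
    exact mul_le_of_le_one_left (norm_nonneg _) (hw1 θ)
  have h2 := sq_integral_le h2pi hf.norm
  have h3 : 0 ≤ ∫ θ in (0 : ℝ)..(2 * Real.pi), ‖f θ‖ ^ 2 :=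
    intervalIntegral.integral_nonneg h2pi.le fun _ _ => by positivity
  rw [norm_smul, mul_pow, Real.norm_eq_abs, sq_abs]
  have h4 := pow_le_pow_left₀ (norm_nonneg _) h1 2
  rw [sub_zero] at h2
  calc (1 / Real.pi) ^ 2 * ‖∫ θ in (0 : ℝ)..(2 * Real.pi), w θ • f θ‖ ^ 2
      ≤ (1 / Real.pi) ^ 2 * (2 * Real.pi * ∫ θ in (0 : ℝ)..(2 * Real.pi), ‖f θ‖ ^ 2) := by
        gcongr
        exact h4.trans h2
    _ = 2 / Real.pi * ∫ θ in (0 : ℝ)..(2 * Real.pi), ‖f θ‖ ^ 2 := by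
        field_simp
    _ ≤ 1 * ∫ θ in (0 : ℝ)..(2 * Real.pi), ‖f θ‖ ^ 2 := by
        gcongr
        rw [div_le_one (by positivity)]
        linarith
    _ = _ := one_mul _

variable [CompleteSpace V] in
/-- `e^{-mt} (c' + m c)` varies only by the source between two points away from the ends. -/
lemma norm_sub_sq_le_sourceEnergy {m : ℕ} {L : ℝ} (hL : 0 < L) {c c₁ c₂ : ℝ → V}
    {f : ℝ → ℝ → V} (hf : Continuous (Function.uncurry f)) (hc₂ : Continuous c₂)
    (hd : ∀ t ∈ Ioo 0 (3 * L), HasDerivAt c (c₁ t) t)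
    (hd₁ : ∀ t ∈ Ioo 0 (3 * L), HasDerivAt c₁ ((m : ℝ) ^ 2 • c t + c₂ t) t)
    (hle : ∀ t, ‖c₂ t‖ ^ 2 ≤ ∫ θ in (0 : ℝ)..(2 * Real.pi), ‖f t θ‖ ^ 2)
    {x y : ℝ} (hx : x ∈ Icc (L / 2) (5 * L / 2)) (hy : y ∈ Icc (L / 2) (5 * L / 2)) :
    ‖Real.exp (-(m * y)) • (c₁ y + (m : ℝ) • c y)
        - Real.exp (-(m * x)) • (c₁ x + (m : ℝ) • c x)‖ ^ 2
      ≤ 2 / L ^ 3 * sourceEnergy (3 * L) f := by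
  wlog hxy : x ≤ y generalizing x y
  · rw [norm_sub_rev]
    exact this hy hx (le_of_not_ge hxy)
  have hm0 : (0 : ℝ) ≤ m := by positivity
  rcases hxy.eq_or_lt with rfl | hlt
  · have : 0 ≤ sourceEnergy (3 * L) f := intervalIntegral.integral_nonneg (by linarith) fun t _ =>
      mul_nonneg (sq_nonneg _)
        (intervalIntegral.integral_nonneg (by positivity) fun _ _ => by positivity)
    rw [sub_self, norm_zero, zero_pow two_ne_zero]
    exact mul_nonneg (by positivity) this
  have hG : ∫ s in x..y, Real.exp (-(m * s)) • c₂ s = Real.exp (-(m * y)) • (c₁ y + (m : ℝ) • c y)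
      - Real.exp (-(m * x)) • (c₁ x + (m : ℝ) • c x) := by
    refine intervalIntegral.integral_eq_sub_of_hasDerivAt
      (f := fun s => Real.exp (-(m * s)) • (c₁ s + (m : ℝ) • c s)) (fun s hs => ?_)
      (Continuous.intervalIntegrable (by fun_prop) _ _)
    rw [uIcc_of_le hxy] at hs
    have hs' : s ∈ Ioo 0 (3 * L) := ⟨by linarith [hs.1, hx.1], by linarith [hs.2, hy.2]⟩
    have h1 : HasDerivAt (fun s : ℝ => -((m : ℝ) * s)) (-m) s :=
      (((hasDerivAt_id s).const_mul (m : ℝ)).neg).congr_deriv (by ring)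
    refine (h1.exp.smul ((hd₁ s hs').add ((hd s hs').const_smul (m : ℝ)))).congr_deriv ?_
    simp only [Pi.add_apply, Pi.smul_apply]
    module
  have hF : Continuous fun t => ∫ θ in (0 : ℝ)..(2 * Real.pi), ‖f t θ‖ ^ 2 :=
    continuous_integral_circle (w := fun t θ => ‖f t θ‖ ^ 2) (by
      simp only [Function.uncurry_def] at hf ⊢
      fun_prop)
  have hF0 : ∀ t, 0 ≤ ∫ θ in (0 : ℝ)..(2 * Real.pi), ‖f t θ‖ ^ 2 := fun t =>
    intervalIntegral.integral_nonneg (by positivity) fun _ _ => by positivity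
  set Φ : ℝ → ℝ := fun t => ∫ θ in (0 : ℝ)..(2 * Real.pi), ‖f t θ‖ ^ 2 with hΦ
  rw [← hG]
  have h1 : ‖∫ s in x..y, Real.exp (-(m * s)) • c₂ s‖ ≤ ∫ s in x..y, ‖c₂ s‖ := by
    refine (intervalIntegral.norm_integral_le_integral_norm hxy).trans ?_
    refine intervalIntegral.integral_mono_on hxy (Continuous.intervalIntegrable (by fun_prop) _ _)
      (Continuous.intervalIntegrable (by fun_prop) _ _) fun s hs => ?_
    rw [norm_smul, Real.norm_eq_abs, Real.abs_exp]
    refine mul_le_of_le_one_left (norm_nonneg _) (Real.exp_le_one_iff.2 ?_)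
    nlinarith [hs.1, hx.1]
  have h2 := (pow_le_pow_left₀ (norm_nonneg _) h1 2).trans (sq_integral_le hlt hc₂.norm)
  have h3 : L ^ 4 * (∫ s in x..y, ‖c₂ s‖ ^ 2) ≤ sourceEnergy (3 * L) f := by
    rw [← intervalIntegral.integral_const_mul]
    refine (intervalIntegral.integral_mono_on (g := fun t => (t * (3 * L - t)) ^ 2 * Φ t) hxy
      (Continuous.intervalIntegrable (by fun_prop) _ _)
      (Continuous.intervalIntegrable (by fun_prop) _ _) fun t ht => ?_).trans ?_
    · have hd : L ^ 2 ≤ t * (3 * L - t) := by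
        nlinarith [mul_nonneg (sub_nonneg.2 (hx.1.trans ht.1)) (sub_nonneg.2 (ht.2.trans hy.2))]
      have hd2 := pow_le_pow_left₀ (by positivity) hd 2
      rw [← pow_mul] at hd2
      exact mul_le_mul hd2 (hle t) (by positivity) (by positivity)
    · exact intervalIntegral.integral_mono_interval (by linarith [hx.1]) hxy (by linarith [hy.2])
        (Filter.Eventually.of_forall fun t => mul_nonneg (sq_nonneg _) (hF0 t))
        (Continuous.intervalIntegrable (by fun_prop) _ _)
  have h4 : 0 ≤ ∫ s in x..y, ‖c₂ s‖ ^ 2 :=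
    intervalIntegral.integral_nonneg hxy fun _ _ => by positivity
  calc _ ≤ (y - x) * ∫ s in x..y, ‖c₂ s‖ ^ 2 := h2
    _ ≤ (2 * L) * ∫ s in x..y, ‖c₂ s‖ ^ 2 := by
        gcongr
        linarith [hx.1, hy.2]
    _ = 2 / L ^ 3 * (L ^ 4 * ∫ s in x..y, ‖c₂ s‖ ^ 2) := by
        field_simp
    _ ≤ _ := by gcongr

end Variation

/-! ### Perturbation of the three-circle inequality -/

/-- The bookkeeping at the end of the argument. Here `E`, `g`, `D`, `V` stand for the energies of
`u`, the squares of the `γ_i`, the `E_i^†` and the energies of `u - ℱ_2(u)`, the number `s g i` is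
`E_i^*`, and `S` is the energy of the source. The slack between `κ` and `μ` and the lower bound for
one of the `ν_i` absorb the source. -/
lemma three_circle_of_perturbed {κ μ s ε₁ ε C₂ C₄ : ℝ} (hκ0 : 0 ≤ κ) (hκμ : κ < μ) (hμ1 : μ ≤ 1)
    (hs : 0 < s) (hε₁ : 0 < ε₁) (hε : 0 < ε) (hC₂ : 0 < C₂) (hC₄ : 0 < C₄) :
    ∃ η > 0, ∀ (E g D V : ℕ → ℝ) (S : ℝ), (∀ i ∈ Icc 1 3, 0 < E i) → (∀ i ∈ Icc 1 3, 0 ≤ D i) →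
      S ≤ η * (E 1 + E 2 + E 3) →
      (∀ i ∈ Icc 1 3, ε₁ ^ 2 * E i ≤ g i) →
      (∀ i ∈ Icc 1 3, ∀ j ∈ Icc 1 3, ∀ τ > 0, g i ≤ (1 + τ) * g j + (1 + 1 / τ) * (C₂ * S)) →
      (∀ i ∈ Icc 1 3, ∀ τ > 0, V i ≤ (1 + τ) * D i + (1 + 1 / τ) * (s * (C₂ * S))) →
      D 2 ≤ κ * (V 1 + V 3) + C₄ * S →
      (∃ i ∈ Icc 1 3, ε * (s * g i) < D i) →
      D 2 ≤ μ * (D 1 + D 3) ∧ D 2 / (s * g 2) ≤ μ * (D 1 / (s * g 1) + D 3 / (s * g 3)) := by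
  set d := μ - κ with hd
  have hd0 : 0 < d := by linarith
  obtain ⟨τ, hτ, hτκ⟩ := exists_pos_mul_sq_le (κ := κ + d / 4) hκ0 (by linarith)
  obtain ⟨σ, hσ, hσκ⟩ := exists_pos_mul_sq_le (κ₀ := κ + d / 2) (κ := μ) (by linarith) (by linarith)
  set C₅ := κ * (2 * ((1 + 1 / τ) * (s * C₂))) + C₄ with hC₅
  have hC₅0 : 0 < C₅ := by positivity
  set c := s * (ε₁ ^ 2 / 12) with hc
  have hc0 : 0 < c := by positivity
  have hη1 : 0 < ε₁ ^ 2 / (12 * C₂) := by positivity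
  have hη2 : 0 < d / 4 * (ε * c) / C₅ := by positivity
  have hη3 : 0 < (σ ^ 2 + σ) / ((1 + 1 / σ) * C₂ * (12 / ε₁ ^ 2)) := by positivity
  set η := min (ε₁ ^ 2 / (12 * C₂))
    (min (d / 4 * (ε * c) / C₅) ((σ ^ 2 + σ) / ((1 + 1 / σ) * C₂ * (12 / ε₁ ^ 2)))) with hη
  have hη0 : 0 < η := lt_min hη1 (lt_min hη2 hη3)
  have hηa : 6 * (C₂ * η) ≤ ε₁ ^ 2 / 2 := by
    have h1 : η ≤ ε₁ ^ 2 / (12 * C₂) := min_le_left _ _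
    rw [le_div_iff₀ (by positivity)] at h1
    linarith
  have hηb : C₅ * η ≤ d / 4 * (ε * c) := by
    have h1 : η ≤ d / 4 * (ε * c) / C₅ := (min_le_right _ _).trans (min_le_left _ _)
    rw [le_div_iff₀ (by positivity)] at h1
    linarith
  have hηc : (1 + 1 / σ) * C₂ * (12 / ε₁ ^ 2) * η ≤ σ ^ 2 + σ := by
    have h1 : η ≤ (σ ^ 2 + σ) / ((1 + 1 / σ) * C₂ * (12 / ε₁ ^ 2)) :=
      (min_le_right _ _).trans (min_le_right _ _)
    rw [le_div_iff₀ (by positivity)] at h1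
    linarith
  refine ⟨η, hη0, fun E g D V S hE hD hS hEg hgg hV hD2 hν => ?_⟩
  have m1 : (1 : ℕ) ∈ Icc 1 3 := by simp
  have m2 : (2 : ℕ) ∈ Icc 1 3 := by simp
  have m3 : (3 : ℕ) ∈ Icc 1 3 := by simp
  set N := E 1 + E 2 + E 3 with hN
  have hN0 : 0 < N := by linarith [hE 1 m1, hE 2 m2, hE 3 m3]
  have hC₂S : C₂ * S ≤ C₂ * η * N := by
    rw [mul_assoc]
    exact mul_le_mul_of_nonneg_left hS hC₂.le
  have hg : ∀ j ∈ Icc 1 3, ε₁ ^ 2 / 12 * N ≤ g j := by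
    intro j hj
    -- All `g i` are comparable to `g j` (with `τ = 1`), and together they bound `N`.
    have h1 : ∀ i ∈ Icc 1 3, g i ≤ 2 * g j + 2 * (C₂ * S) := fun i hi => by
      have := hgg i hi j hj 1 one_pos
      norm_num at this
      linarith
    have h2 := mul_le_mul_of_nonneg_right hηa hN0.le
    linarith [h1 1 m1, h1 2 m2, h1 3 m3, hEg 1 m1, hEg 2 m2, hEg 3 m3]
  have hgc : ∀ j ∈ Icc 1 3, c * N ≤ s * g j := fun j hj => by
    rw [hc, mul_assoc]
    exact mul_le_mul_of_nonneg_left (hg j hj) hs.le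
  have hg0 : ∀ j ∈ Icc 1 3, 0 < g j := fun j hj =>
    lt_of_lt_of_le (by positivity) (hg j hj)
  set X := D 1 + D 3 with hX
  have hX0 : 0 ≤ X := add_nonneg (hD 1 m1) (hD 3 m3)
  have hYX : D 2 ≤ (κ + d / 4) * X + d / 4 * (ε * c) * N := by
    have h1 : V 1 + V 3 ≤ (1 + τ) * X + 2 * ((1 + 1 / τ) * (s * C₂)) * S := by
      linarith [hV 1 m1 τ hτ, hV 3 m3 τ hτ]
    have h2 := mul_le_mul_of_nonneg_left h1 hκ0
    have h3 : κ * (1 + τ) ≤ κ + d / 4 := by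
      have : κ * (1 + τ) ≤ κ * (1 + τ) ^ 2 :=
        mul_le_mul_of_nonneg_left (by nlinarith) hκ0
      linarith
    have h4 := mul_le_mul_of_nonneg_right h3 hX0
    have h5 := mul_le_mul_of_nonneg_left hS hC₅0.le
    have h6 := mul_le_mul_of_nonneg_right hηb hN0.le
    have h7 : C₅ * S = κ * (2 * ((1 + 1 / τ) * (s * C₂)) * S) + C₄ * S := by
      rw [hC₅]
      ring
    linarith
  have hεc : 0 < ε * c * N := by positivity
  have hmain : D 2 ≤ (κ + d / 2) * X := by
    rcases le_or_gt (ε * c * N) X with h | h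
    · have := mul_le_mul_of_nonneg_left h (by linarith : 0 ≤ d / 4)
      linarith
    · -- If `E_1^†` and `E_3^†` are too small, then `E_2^†` is not, against the inequality above.
      exfalso
      obtain ⟨i, hi, hlt⟩ := hν
      have hDi : ε * c * N < D i := by
        refine lt_of_le_of_lt ?_ hlt
        rw [mul_assoc]
        exact mul_le_mul_of_nonneg_left (hgc i hi) hε.le
      have h2 : D 2 < ε * c * N := by
        have h3 : (κ + d / 4) * X ≤ (κ + d / 4) * (ε * c * N) := by gcongr
        have h4 : (κ + d / 2) * (ε * c * N) < 1 * (ε * c * N) :=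
          mul_lt_mul_of_pos_right (by linarith) hεc
        linarith
      have hi' : i = 1 ∨ i = 2 ∨ i = 3 := by
        simp only [mem_Icc] at hi
        omega
      rcases hi' with rfl | rfl | rfl
      · linarith [hD 3 m3]
      · linarith
      · linarith [hD 1 m1]
  have hκμ2 : κ + d / 2 ≤ μ := by linarith
  refine ⟨hmain.trans (mul_le_mul_of_nonneg_right hκμ2 hX0), ?_⟩
  have hgσ : ∀ i ∈ Icc 1 3, g i ≤ (1 + σ) ^ 2 * g 2 := by
    intro i hi
    have h1 := hgg i hi 2 m2 σ hσ
    have h2 : (1 + 1 / σ) * (C₂ * S) ≤ (σ ^ 2 + σ) * g 2 := by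
      have h3 : N ≤ 12 / ε₁ ^ 2 * g 2 := by
        have := hg 2 m2
        rw [div_mul_eq_mul_div, div_le_iff₀ (by positivity)] at this
        rw [div_mul_eq_mul_div, le_div_iff₀ (by positivity)]
        linarith
      calc (1 + 1 / σ) * (C₂ * S) ≤ (1 + 1 / σ) * (C₂ * η * N) := by gcongr
        _ ≤ (1 + 1 / σ) * (C₂ * η * (12 / ε₁ ^ 2 * g 2)) := by gcongr
        _ = (1 + 1 / σ) * C₂ * (12 / ε₁ ^ 2) * η * g 2 := by ring
        _ ≤ _ := mul_le_mul_of_nonneg_right hηc (hg0 2 m2).le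
    linarith
  have hg2 := hg0 2 m2
  have hfrac : ∀ i ∈ Icc 1 3, D i / ((1 + σ) ^ 2 * (s * g 2)) ≤ D i / (s * g i) := fun i hi => by
    refine div_le_div_of_nonneg_left (hD i hi) (mul_pos hs (hg0 i hi)) ?_
    have := mul_le_mul_of_nonneg_left (hgσ i hi) hs.le
    linarith
  have hμ0 : 0 ≤ μ := by linarith
  calc D 2 / (s * g 2) ≤ (κ + d / 2) * X / (s * g 2) := by gcongr
    _ = (κ + d / 2) * (1 + σ) ^ 2 * (X / ((1 + σ) ^ 2 * (s * g 2))) := by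
        field_simp
    _ ≤ μ * (X / ((1 + σ) ^ 2 * (s * g 2))) := by gcongr
    _ = μ * (D 1 / ((1 + σ) ^ 2 * (s * g 2)) + D 3 / ((1 + σ) ^ 2 * (s * g 2))) := by
        rw [hX, add_div]
    _ ≤ _ := mul_le_mul_of_nonneg_left (add_le_add (hfrac 1 m1) (hfrac 3 m3)) hμ0

/-! ### Solutions of the perturbed equation -/

lemma cylEnergy_nonneg {V : Type*} [NormedAddCommGroup V] (m : ℕ) {x y : ℝ} (hxy : x ≤ y)
    (w : ℝ → ℝ → V) : 0 ≤ cylEnergy m x y w :=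
  intervalIntegral.integral_nonneg hxy fun t _ => mul_nonneg (Real.exp_pos _).le
    (intervalIntegral.integral_nonneg (by positivity) fun _ _ => by positivity)

lemma continuous_integral_norm_sq {V : Type*} [NormedAddCommGroup V] {w : ℝ → ℝ → V}
    (hw : Continuous (Function.uncurry w)) :
    Continuous fun t => ∫ θ in (0 : ℝ)..(2 * Real.pi), ‖w t θ‖ ^ 2 :=
  continuous_integral_circle (w := fun t θ => ‖w t θ‖ ^ 2) (by
    simp only [Function.uncurry_def] at hw ⊢
    fun_prop)

lemma cylEnergy_add_le {V : Type*} [NormedAddCommGroup V] (m : ℕ) {x y τ : ℝ} (hxy : x ≤ y)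
    (hτ : 0 < τ) {a b : ℝ → ℝ → V} (ha : Continuous (Function.uncurry a))
    (hb : Continuous (Function.uncurry b)) :
    cylEnergy m x y (fun t θ => a t θ + b t θ)
      ≤ (1 + τ) * cylEnergy m x y a + (1 + 1 / τ) * cylEnergy m x y b := by
  have ca := continuous_integral_norm_sq ha
  have cb := continuous_integral_norm_sq hb
  have cab := continuous_integral_norm_sq (w := fun t θ => a t θ + b t θ) (ha.add hb)
  unfold cylEnergy
  rw [← intervalIntegral.integral_const_mul, ← intervalIntegral.integral_const_mul,
    ← intervalIntegral.integral_add (Continuous.intervalIntegrable (by fun_prop) _ _)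
      (Continuous.intervalIntegrable (by fun_prop) _ _)]
  refine intervalIntegral.integral_mono_on hxy (Continuous.intervalIntegrable (by fun_prop) _ _)
    (Continuous.intervalIntegrable (by fun_prop) _ _) fun t _ => ?_
  have c1 := continuous_of_uncurry ha t
  have c2 := continuous_of_uncurry hb t
  have h1 : (∫ θ in (0 : ℝ)..(2 * Real.pi), ‖a t θ + b t θ‖ ^ 2) ≤
      (1 + τ) * (∫ θ in (0 : ℝ)..(2 * Real.pi), ‖a t θ‖ ^ 2)
        + (1 + 1 / τ) * ∫ θ in (0 : ℝ)..(2 * Real.pi), ‖b t θ‖ ^ 2 := by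
    rw [← intervalIntegral.integral_const_mul, ← intervalIntegral.integral_const_mul,
      ← intervalIntegral.integral_add (Continuous.intervalIntegrable (by fun_prop) _ _)
        (Continuous.intervalIntegrable (by fun_prop) _ _)]
    refine intervalIntegral.integral_mono_on (by positivity)
      (Continuous.intervalIntegrable (by fun_prop) _ _)
      (Continuous.intervalIntegrable (by fun_prop) _ _) fun θ _ => ?_
    exact (pow_le_pow_left₀ (norm_nonneg _) (norm_add_le _ _) 2).trans (add_sq_le_weighted hτ _ _)
  have h2 := mul_le_mul_of_nonneg_left h1 (Real.exp_pos (-2 * m * t)).le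
  linarith

lemma integral_norm_sq_le_cylEnergy {V : Type*} [NormedAddCommGroup V] (m : ℕ) {L : ℝ}
    (hL : 0 < L) {w : ℝ → ℝ → V} (hw : Continuous (Function.uncurry w)) :
    (∫ t in (0 : ℝ)..(3 * L), ∫ θ in (0 : ℝ)..(2 * Real.pi), ‖w t θ‖ ^ 2) ≤
      Real.exp (2 * m * (3 * L)) *
        (cylEnergy m 0 L w + cylEnergy m L (2 * L) w + cylEnergy m (2 * L) (3 * L) w) := by
  have cw := continuous_integral_norm_sq hw
  have hint : ∀ x y : ℝ, IntervalIntegrable (fun t => Real.exp (-2 * m * t) *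
      ∫ θ in (0 : ℝ)..(2 * Real.pi), ‖w t θ‖ ^ 2) volume x y := fun x y =>
    Continuous.intervalIntegrable (by fun_prop) _ _
  unfold cylEnergy
  rw [intervalIntegral.integral_add_adjacent_intervals (hint _ _) (hint _ _),
    intervalIntegral.integral_add_adjacent_intervals (hint _ _) (hint _ _),
    ← intervalIntegral.integral_const_mul]
  refine intervalIntegral.integral_mono_on (by linarith)
    (Continuous.intervalIntegrable (by fun_prop) _ _)
    (Continuous.intervalIntegrable (by fun_prop) _ _) fun t ht => ?_
  have h0 : 0 ≤ ∫ θ in (0 : ℝ)..(2 * Real.pi), ‖w t θ‖ ^ 2 :=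
    intervalIntegral.integral_nonneg (by positivity) fun _ _ => by positivity
  rw [← mul_assoc, ← Real.exp_add]
  refine le_mul_of_one_le_left h0 (Real.one_le_exp ?_)
  have hm0 : (0 : ℝ) ≤ m := by positivity
  nlinarith [mul_nonneg hm0 (sub_nonneg.2 ht.2)]

section Solutions

variable {V : Type*} [NormedAddCommGroup V] [InnerProductSpace ℝ V]

/-- The pointwise bound for the Laplacian holds almost everywhere with `ω` replaced by its essential
supremum, hence everywhere by continuity. -/
lemma norm_lap_le_of_solves {L δ : ℝ} (hδ : 0 ≤ δ) {u : ℝ → ℝ → V}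
    {φ : ℝ × ℝ → V → V × V → V} {ω : ℝ × ℝ → ℝ} (hsol : SolvesWithBound L u φ ω)
    (hω : supNorm L ω < ENNReal.ofReal δ) {w wt wθ wtt wθθ : ℝ → ℝ → V}
    (hw : C2Data (3 * L) w wt wθ wtt wθθ)
    (hwu : ∀ t ∈ Icc 0 (3 * L), ∀ θ, w t θ = u t θ)
    (hder : ∀ t ∈ Ioo 0 (3 * L), ∀ θ, dt u t θ = wt t θ ∧ dθ u t θ = wθ t θ ∧
        lap u t θ = wtt t θ + wθθ t θ) :
    ∀ t ∈ Ioo 0 (3 * L), ∀ θ ∈ Icc 0 (2 * Real.pi),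
      ‖wtt t θ + wθθ t θ‖ ≤ δ * (‖w t θ‖ + √(‖wt t θ‖ ^ 2 + ‖wθ t θ‖ ^ 2)) := by
  have k0 := hw.cont
  have k1 := hw.cont_t
  have k2 := hw.cont_θ
  have k3 := hw.cont_tt
  have k4 := hw.cont_θθ
  simp only [Function.uncurry_def] at k0 k1 k2 k3 k4
  set G : ℝ × ℝ → ℝ := fun x => max (‖wtt x.1 x.2 + wθθ x.1 x.2‖
    - δ * (‖w x.1 x.2‖ + √(‖wt x.1 x.2‖ ^ 2 + ‖wθ x.1 x.2‖ ^ 2))) 0 with hG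
  have hGc : Continuous G := by fun_prop
  set U : Set (ℝ × ℝ) := Ioo 0 (3 * L) ×ˢ Ioo 0 (2 * Real.pi) with hU
  have hUo : IsOpen U := isOpen_Ioo.prod isOpen_Ioo
  have hae : ∀ᵐ x ∂volume.restrict (Icc 0 (3 * L) ×ˢ Ico 0 (2 * Real.pi)),
      ‖ω x‖ₑ < ENNReal.ofReal δ := by
    unfold supNorm at hω
    rw [eLpNorm_exponent_top] at hω
    exact ae_lt_of_essSup_lt hω
  have hsubset : U ⊆ Icc 0 (3 * L) ×ˢ Ico 0 (2 * Real.pi) :=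
    prod_mono Ioo_subset_Icc_self Ioo_subset_Ico_self
  have hae0 : G =ᵐ[volume.restrict U] fun _ => 0 := by
    filter_upwards [ae_restrict_of_ae_restrict_of_subset hsubset hae,
      ae_restrict_mem hUo.measurableSet] with x hx hxU
    obtain ⟨ht, hθ⟩ := hxU
    obtain ⟨h1, h2⟩ := hsol x.1 ht x.2 ⟨hθ.1.le, hθ.2⟩
    obtain ⟨d1, d2, d3⟩ := hder x.1 ht x.2
    rw [← h1, d3, gradNorm, d1, d2, ← hwu x.1 ⟨ht.1.le, ht.2.le⟩] at h2
    have h3 : ω x ≤ δ := by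
      refine (le_abs_self _).trans ?_
      have := hx.le
      rw [Real.enorm_eq_ofReal_abs] at this
      exact (ENNReal.ofReal_le_ofReal_iff hδ).1 this
    refine max_eq_right (sub_nonpos.2 (h2.trans ?_))
    exact mul_le_mul_of_nonneg_right h3 (by positivity)
  have hEq : EqOn G (fun _ => 0) (closure U) :=
    (Measure.eqOn_open_of_ae_eq hae0 hUo hGc.continuousOn continuousOn_const).closure hGc
      continuous_const
  intro t ht θ hθ
  have h3L : (0 : ℝ) ≠ 3 * L := (ht.1.trans ht.2).ne
  have hmem : (t, θ) ∈ closure U := by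
    rw [hU, closure_prod_eq, closure_Ioo h3L, closure_Ioo (by positivity)]
    exact ⟨⟨ht.1.le, ht.2.le⟩, hθ⟩
  have h0 : G (t, θ) = 0 := hEq hmem
  have := le_max_left (‖wtt t θ + wθθ t θ‖ - δ * (‖w t θ‖ + √(‖wt t θ‖ ^ 2 + ‖wθ t θ‖ ^ 2))) 0
  have h1 : ‖wtt t θ + wθθ t θ‖ - δ * (‖w t θ‖ + √(‖wt t θ‖ ^ 2 + ‖wθ t θ‖ ^ 2)) ≤ G (t, θ) := this
  rw [h0] at h1
  linarith

/-- At interior times `g⁺(u)` can be computed from the extended derivatives. -/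
lemma gPlus_eq {L : ℝ} {u : ℝ → ℝ → V} {w wt wθ wtt wθθ : ℝ → ℝ → V}
    (hw : C2Data (3 * L) w wt wθ wtt wθθ) (hwu : ∀ t ∈ Icc 0 (3 * L), ∀ θ, w t θ = u t θ)
    (m : ℕ) {t : ℝ} (ht : t ∈ Ioo 0 (3 * L)) :
    gPlusCos m u t = cosCoeff m wt t + (m : ℝ) • cosCoeff m w t ∧
    gPlusSin m u t = sinCoeff m wt t + (m : ℝ) • sinCoeff m w t := by
  have hc : ∀ s ∈ Ioo 0 (3 * L), cosCoeff m u s = cosCoeff m w s := fun s hs => by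
    simp only [cosCoeff, hwu s ⟨hs.1.le, hs.2.le⟩]
  have hs : ∀ s ∈ Ioo 0 (3 * L), sinCoeff m u s = sinCoeff m w s := fun s hs => by
    simp only [sinCoeff, hwu s ⟨hs.1.le, hs.2.le⟩]
  have ec : cosCoeff m u =ᶠ[nhds t] cosCoeff m w := by
    filter_upwards [Ioo_mem_nhds ht.1 ht.2] with s hs'
    exact hc s hs'
  have es : sinCoeff m u =ᶠ[nhds t] sinCoeff m w := by
    filter_upwards [Ioo_mem_nhds ht.1 ht.2] with s hs'
    exact hs s hs'
  refine ⟨?_, ?_⟩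
  · rw [gPlusCos, ec.deriv_eq, hc t ht,
      (hasDerivAt_cosCoeff hw.cont hw.cont_t hw.deriv_t m ht).deriv]
  · rw [gPlusSin, es.deriv_eq, hs t ht,
      (hasDerivAt_sinCoeff hw.cont hw.cont_t hw.deriv_t m ht).deriv]

lemma mid_mem {L : ℝ} (hL : 0 < L) {i : ℕ} (hi : i ∈ Icc 1 3) :
    mid L i ∈ Icc (L / 2) (5 * L / 2) := by
  have h1 : (1 : ℝ) ≤ i := by exact_mod_cast hi.1
  have h2 : (i : ℝ) ≤ 3 := by exact_mod_cast hi.2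
  unfold mid
  constructor <;> nlinarith

variable [CompleteSpace V] in
/-- The coefficients of the three projections differ only by the source. -/
lemma norm_grow_sub_sq_le {L : ℝ} (hL : 0 < L) {u : ℝ → ℝ → V} {w wt wθ wtt wθθ : ℝ → ℝ → V}
    (hw : C2Data (3 * L) w wt wθ wtt wθθ) (hwu : ∀ t ∈ Icc 0 (3 * L), ∀ θ, w t θ = u t θ)
    (m : ℕ) {i j : ℕ} (hi : i ∈ Icc 1 3) (hj : j ∈ Icc 1 3) :
    ‖growCos m L i u - growCos m L j u‖ ^ 2
      ≤ 2 / L ^ 3 * sourceEnergy (3 * L) (fun t θ => wtt t θ + wθθ t θ) ∧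
    ‖growSin m L i u - growSin m L j u‖ ^ 2
      ≤ 2 / L ^ 3 * sourceEnergy (3 * L) (fun t θ => wtt t θ + wθθ t θ) := by
  have hIoo : ∀ {i : ℕ}, i ∈ Icc 1 3 → mid L i ∈ Ioo 0 (3 * L) := fun hi => by
    have := mid_mem hL hi
    exact ⟨by linarith [this.1], by linarith [this.2]⟩
  have hlapc : ∀ t, Continuous fun θ => wtt t θ + wθθ t θ := continuous_of_uncurry hw.cont_lap
  constructor
  · rw [growCos, growCos, (gPlus_eq hw hwu m (hIoo hi)).1, (gPlus_eq hw hwu m (hIoo hj)).1]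
    exact norm_sub_sq_le_sourceEnergy hL hw.cont_lap (continuous_cosCoeff hw.cont_lap m)
      (fun t ht => hasDerivAt_cosCoeff hw.cont hw.cont_t hw.deriv_t m ht)
      (fun t ht => (hasDerivAt_cosCoeff hw.cont_t hw.cont_tt hw.deriv_tt m ht).congr_deriv
        (hw.cosCoeff_tt m ht))
      (fun t => norm_integral_circle_sq_le (hlapc t) (by fun_prop) fun θ => Real.abs_cos_le_one _)
      (mid_mem hL hj) (mid_mem hL hi)
  · rw [growSin, growSin, (gPlus_eq hw hwu m (hIoo hi)).2, (gPlus_eq hw hwu m (hIoo hj)).2]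
    exact norm_sub_sq_le_sourceEnergy hL hw.cont_lap (continuous_sinCoeff hw.cont_lap m)
      (fun t ht => hasDerivAt_sinCoeff hw.cont hw.cont_t hw.deriv_t m ht)
      (fun t ht => (hasDerivAt_sinCoeff hw.cont_t hw.cont_tt hw.deriv_tt m ht).congr_deriv
        (hw.sinCoeff_tt m ht))
      (fun t => norm_integral_circle_sq_le (hlapc t) (by fun_prop) fun θ => Real.abs_sin_le_one _)
      (mid_mem hL hj) (mid_mem hL hi)

end Solutions

lemma norm_sq_add_norm_sq_le {V : Type*} [NormedAddCommGroup V] {τ K : ℝ} (hτ : 0 < τ)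
    {a a' b b' : V} (ha : ‖a - a'‖ ^ 2 ≤ K) (hb : ‖b - b'‖ ^ 2 ≤ K) :
    ‖a‖ ^ 2 + ‖b‖ ^ 2 ≤ (1 + τ) * (‖a'‖ ^ 2 + ‖b'‖ ^ 2) + (1 + 1 / τ) * (2 * K) := by
  have h : ∀ {x x' : V}, ‖x - x'‖ ^ 2 ≤ K →
      ‖x‖ ^ 2 ≤ (1 + τ) * ‖x'‖ ^ 2 + (1 + 1 / τ) * K := fun {x x'} hx => by
    have h1 : ‖x‖ ≤ ‖x'‖ + ‖x - x'‖ := by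
      have := norm_add_le x' (x - x')
      rwa [add_sub_cancel] at this
    refine ((pow_le_pow_left₀ (norm_nonneg _) h1 2).trans (add_sq_le_weighted hτ _ _)).trans ?_
    gcongr
  linarith [h ha, h hb]

lemma sq_mul_energy_le_of_le_lam {V : Type*} [NormedAddCommGroup V] [NormedSpace ℝ V] {m : ℕ}
    {L ε₁ : ℝ} {i : ℕ} {u : ℝ → ℝ → V} (hε₁ : 0 < ε₁) (h : ε₁ ≤ lam m L i u) :
    0 < energy m L i u ∧ ε₁ ^ 2 * energy m L i u ≤ gamma m L i u ^ 2 := by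
  unfold lam at h
  have hE : 0 < energy m L i u := by
    by_contra hne
    rw [Real.sqrt_eq_zero_of_nonpos (not_lt.1 hne), div_zero] at h
    linarith
  have hs := Real.sqrt_pos.2 hE
  rw [le_div_iff₀ hs] at h
  have := pow_le_pow_left₀ (by positivity) h 2
  rw [mul_pow, Real.sq_sqrt hE.le] at this
  exact ⟨hE, this⟩

end Cylinder

end

open Cylinder in
theorem theorem2p10 (m : ℕ) (hm : 1 ≤ m) (q : ℝ) (hq : q ∈ Set.Ioo (0 : ℝ) 2) :
    (∃ L₀ : ℝ, Cylinder.IsHarmonicThreshold m q L₀) ∧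
    ∀ L₀ : ℝ, Cylinder.IsHarmonicThreshold m q L₀ →
    ∀ L : ℝ, max L₀ (2 * Real.log 2 / (2 - q)) < L →
    ∀ ε₁ : ℝ, 0 < ε₁ → ∀ ε : ℝ, 0 < ε →
    ∃ δ₁ : ℝ, 0 < δ₁ ∧
      ∀ (n : ℕ) (u : ℝ → ℝ → EuclideanSpace ℝ (Fin n))
        (φ : ℝ × ℝ → EuclideanSpace ℝ (Fin n) →
          EuclideanSpace ℝ (Fin n) × EuclideanSpace ℝ (Fin n) → EuclideanSpace ℝ (Fin n))
        (ω : ℝ × ℝ → ℝ),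
        Cylinder.IsC2 L u →
        (∀ t ∈ Set.Icc 0 (3 * L), ∀ θ ∈ Set.Ico 0 (2 * Real.pi), 0 ≤ ω (t, θ)) →
        Cylinder.SolvesWithBound L u φ ω →
        ε₁ ≤ min (Cylinder.lam m L 1 u) (min (Cylinder.lam m L 2 u) (Cylinder.lam m L 3 u)) →
        ENNReal.ofReal ε <
          max (Cylinder.nu m L 1 u) (max (Cylinder.nu m L 2 u) (Cylinder.nu m L 3 u)) →
        Cylinder.supNorm L ω < ENNReal.ofReal δ₁ →
        Cylinder.ThreeCircle q L (fun i => ENNReal.ofReal (Cylinder.energyDagger m L i u)) ∧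
        Cylinder.ThreeCircle q L (fun i => Cylinder.nu m L i u) := by
  refine ⟨exists_isHarmonicThreshold hm hq.2, fun L₀ hL₀ L hL ε₁ hε₁ ε hε => ?_⟩
  have hLL₀ : L₀ < L := (le_max_left _ _).trans_lt hL
  have hL0 : 0 < L := hL₀.1.trans hLL₀
  obtain ⟨κ₀, hκ₀, hκ₀μ, hmode⟩ := hL₀.exists_forall_modeBound hm hq.2 hLL₀
    ((le_max_right _ _).trans_lt hL)
  set μ := Real.exp (-(q * L)) with hμ
  have hμ1 : μ ≤ 1 := Real.exp_le_one_iff.2 (by nlinarith [hq.1])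
  obtain ⟨κ, hκ₀κ, hκμ⟩ := exists_between hκ₀μ
  obtain ⟨C₄, hC₄, hsource⟩ := exists_source_bound hm hL0 hκ₀ hκ₀κ hmode
  have hpi := Real.pi_pos
  set s := L * Real.pi / (4 * m ^ 2) with hs
  have hs0 : 0 < s := by positivity
  set C₂ := 2 * (2 / L ^ 3) with hC₂
  have hC₂0 : 0 < C₂ := by positivity
  obtain ⟨η, hη, halg⟩ := three_circle_of_perturbed (hκ₀.trans hκ₀κ.le) hκμ hμ1 hs0 hε₁ hε hC₂0 hC₄
  set C₁ := 2 * (2 * (3 * L) ^ 2 + 4 * (3 * L) ^ 4) * Real.exp (2 * m * (3 * L)) with hC₁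
  have hC₁0 : 0 < C₁ := by positivity
  -- With `C₁` from the Caccioppoli inequality, the source is at most `C₁ ‖ω‖² ∑ E_i`.
  refine ⟨min 1 (η / C₁), by positivity, fun n u φ ω hu _ hsol hlam hnu hω => ?_⟩
  set δ := min 1 (η / C₁) with hδ
  have hδ0 : 0 < δ := by positivity
  have hδ1 : δ ≤ 1 := min_le_left _ _
  have hδη : C₁ * δ ^ 2 ≤ η := by
    have h1 : δ * C₁ ≤ η := (le_div_iff₀ hC₁0).1 (min_le_right _ _)
    have h2 : δ ^ 2 ≤ δ := by nlinarith
    have h3 := mul_le_mul_of_nonneg_left h2 hC₁0.le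
    linarith
  obtain ⟨w, wt, wθ, wtt, wθθ, hw, hwu, hder⟩ := exists_c2Data hL0 hu
  have hlap := norm_lap_le_of_solves hδ0.le hsol hω hw hwu hder
  set S := sourceEnergy (3 * L) (fun t θ => wtt t θ + wθθ t θ) with hS
  have hrange : ∀ i ∈ Icc (1 : ℕ) 3, (0 : ℝ) ≤ ((i : ℝ) - 1) * L ∧ ((i : ℝ) - 1) * L ≤ i * L ∧
      (i : ℝ) * L ≤ 3 * L := fun i hi => by
    have h1 : (1 : ℝ) ≤ i := by exact_mod_cast hi.1
    have h2 : (i : ℝ) ≤ 3 := by exact_mod_cast hi.2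
    exact ⟨mul_nonneg (by linarith) hL0.le, by nlinarith, by nlinarith⟩
  have hcongr : ∀ i ∈ Icc 1 3, ∀ F : ℝ → ℝ → EuclideanSpace ℝ (Fin n),
      energy m L i (fun t θ => u t θ - F t θ)
        = cylEnergy m (((i : ℝ) - 1) * L) (i * L) fun t θ => w t θ - F t θ := fun i hi F => by
    obtain ⟨h1, h2, h3⟩ := hrange i hi
    rw [energy_eq_cylEnergy]
    refine cylEnergy_congr m fun t ht θ => ?_
    rw [uIcc_of_le h2] at ht
    rw [hwu t ⟨h1.trans ht.1, ht.2.trans h3⟩ θ]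
  set A := fun i => growCos m L i u with hA
  set B := fun i => growSin m L i u with hB
  set g : ℕ → ℝ := fun i => ‖A i‖ ^ 2 + ‖B i‖ ^ 2 with hg
  have hstar : ∀ i, energyStar m L i u = s * g i := fun i => by
    rw [energyStar, energy_eq_cylEnergy, proj_eq_growMode, cylEnergy_growMode hm, hs]
    congr 2
    ring
  set D : ℕ → ℝ := fun i => energyDagger m L i u with hD
  have hDeq : ∀ i ∈ Icc 1 3, D i = cylEnergy m (((i : ℝ) - 1) * L) (i * L)
      fun t θ => w t θ - growMode m (A i) (B i) t θ := fun i hi => by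
    rw [← hcongr i hi, hD]
    simp only [energyDagger, proj_eq_growMode, hA, hB]
  set E : ℕ → ℝ := fun i => energy m L i u with hE
  set V : ℕ → ℝ := fun i => cylEnergy m (((i : ℝ) - 1) * L) (i * L)
      fun t θ => w t θ - growMode m (A 2) (B 2) t θ with hV
  have m1 : (1 : ℕ) ∈ Icc 1 3 := by simp
  have m2 : (2 : ℕ) ∈ Icc 1 3 := by simp
  have m3 : (3 : ℕ) ∈ Icc 1 3 := by simp
  have hD0 : ∀ i ∈ Icc 1 3, 0 ≤ D i := fun i hi => by
    rw [hDeq i hi]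
    exact cylEnergy_nonneg m (hrange i hi).2.1 _
  have hvar := fun i hi j hj => norm_grow_sub_sq_le (i := i) (j := j) hL0 hw hwu m hi hj
  have hlami : ∀ i ∈ Icc 1 3, ε₁ ≤ lam m L i u := fun i hi => by
    have hi' : i = 1 ∨ i = 2 ∨ i = 3 := by
      simp only [mem_Icc] at hi
      omega
    rcases hi' with rfl | rfl | rfl
    · exact hlam.trans (min_le_left _ _)
    · exact hlam.trans ((min_le_right _ _).trans (min_le_left _ _))
    · exact hlam.trans ((min_le_right _ _).trans (min_le_right _ _))
  have hEpos : ∀ i ∈ Icc 1 3, 0 < E i := fun i hi =>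
    (sq_mul_energy_le_of_le_lam hε₁ (hlami i hi)).1
  have hEg : ∀ i ∈ Icc 1 3, ε₁ ^ 2 * E i ≤ g i := fun i hi => by
    have := (sq_mul_energy_le_of_le_lam hε₁ (hlami i hi)).2
    rwa [gamma_sq] at this
  have hgpos : ∀ i ∈ Icc 1 3, 0 < g i := fun i hi =>
    lt_of_lt_of_le (mul_pos (by positivity) (hEpos i hi)) (hEg i hi)
  have hSle : S ≤ η * (E 1 + E 2 + E 3) := by
    have hcw : ∀ i ∈ Icc 1 3, E i = cylEnergy m (((i : ℝ) - 1) * L) (i * L) w := fun i hi => by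
      have := hcongr i hi (fun _ _ => 0)
      simpa only [sub_zero] using this
    have h1 := hw.sourceEnergy_le (by linarith) hδ1 hlap
    have h2 := integral_norm_sq_le_cylEnergy m hL0 hw.cont
    have h3 : cylEnergy m 0 L w + cylEnergy m L (2 * L) w + cylEnergy m (2 * L) (3 * L) w
        = E 1 + E 2 + E 3 := by
      rw [hcw 1 m1, hcw 2 m2, hcw 3 m3]
      norm_num
    rw [h3] at h2
    have hE0 : 0 ≤ E 1 + E 2 + E 3 := by linarith [hEpos 1 m1, hEpos 2 m2, hEpos 3 m3]
    calc S ≤ 2 * (2 * (3 * L) ^ 2 + 4 * (3 * L) ^ 4) * δ ^ 2 *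
          (Real.exp (2 * m * (3 * L)) * (E 1 + E 2 + E 3)) := h1.trans (by gcongr)
      _ = C₁ * δ ^ 2 * (E 1 + E 2 + E 3) := by
        rw [hC₁]
        ring
      _ ≤ _ := by gcongr
  have hggs : ∀ i ∈ Icc 1 3, ∀ j ∈ Icc 1 3, ∀ τ > 0,
      g i ≤ (1 + τ) * g j + (1 + 1 / τ) * (C₂ * S) := fun i hi j hj τ hτ => by
    have := norm_sq_add_norm_sq_le hτ (hvar i hi j hj).1 (hvar i hi j hj).2
    rwa [← mul_assoc 2 (2 / L ^ 3)] at this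
  have hVD : ∀ i ∈ Icc 1 3, ∀ τ > 0, V i ≤ (1 + τ) * D i + (1 + 1 / τ) * (s * (C₂ * S)) :=
    fun i hi τ hτ => by
      have hadd := cylEnergy_add_le m (hrange i hi).2.1 hτ
        (a := fun t θ => w t θ - growMode m (A i) (B i) t θ)
        (b := growMode m (A i - A 2) (B i - B 2))
        (hw.sub_growMode m (A i) (B i)).cont (continuous_growMode m _ _)
      simp only [← growMode_sub, sub_add_sub_cancel] at hadd
      rw [← hDeq i hi] at hadd
      refine hadd.trans ?_
      have h1 : cylEnergy m (((i : ℝ) - 1) * L) (i * L) (growMode m (A i - A 2) (B i - B 2))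
          = s * (‖A i - A 2‖ ^ 2 + ‖B i - B 2‖ ^ 2) := by
        rw [cylEnergy_growMode hm, hs]
        congr 2
        ring
      have h2 : ‖A i - A 2‖ ^ 2 + ‖B i - B 2‖ ^ 2 ≤ C₂ * S := by
        rw [hC₂]
        linarith [(hvar i hi 2 m2).1, (hvar i hi 2 m2).2]
      have h3 : cylEnergy m (((i : ℝ) - 1) * L) (i * L)
          (fun t θ => growMode m (A i - A 2) (B i - B 2) t θ) ≤ s * (C₂ * S) := by
        rw [h1]
        gcongr
      gcongr
  have hD2 : D 2 ≤ κ * (V 1 + V 3) + C₄ * S := by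
    have hmid : mid L 2 = 3 * L / 2 := by
      unfold mid
      push_cast
      ring
    have hmidmem : mid L 2 ∈ Ioo 0 (3 * L) := by
      rw [hmid]
      constructor <;> linarith
    have hv := hw.sub_growMode m (A 2) (B 2)
    have hm0 : (m : ℝ) ≠ 0 := by positivity
    have hexp : Real.exp (m * mid L 2) * Real.exp (-(m * mid L 2)) = 1 := by
      rw [← Real.exp_add, add_neg_cancel, Real.exp_zero]
    -- The projection is chosen so that `g⁺(u - ℱ_2(u))` vanishes at the midpoint of `[L, 2L]`.
    have hkill : ∀ G : EuclideanSpace ℝ (Fin n),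
        (Real.exp (m * mid L 2) / (2 * m)) • (m : ℝ) • Real.exp (-(m * mid L 2)) • G
          + (m : ℝ) • (Real.exp (m * mid L 2) / (2 * m)) • Real.exp (-(m * mid L 2)) • G = G :=
      fun G => by
        simp only [smul_smul, ← add_smul]
        have : Real.exp (m * mid L 2) / (2 * m) * (m * Real.exp (-(m * mid L 2)))
            + m * (Real.exp (m * mid L 2) / (2 * m) * Real.exp (-(m * mid L 2)))
            = Real.exp (m * mid L 2) * Real.exp (-(m * mid L 2)) := by
          field_simp
          ring
        rw [this, hexp, one_smul]
    have hgp := gPlus_eq hw hwu m hmidmem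
    have hsrc := hsource n _ _ _ _ _ hv (by
      rw [← hmid, cosCoeff_sub m hw.cont_t (continuous_growMode m _ _),
        cosCoeff_sub m hw.cont (continuous_growMode m _ _), cosCoeff_growMode hm,
        cosCoeff_growMode hm, smul_sub, sub_add_sub_comm, ← hgp.1]
      simp only [hA, growCos, hkill, sub_self]) (by
      rw [← hmid, sinCoeff_sub m hw.cont_t (continuous_growMode m _ _),
        sinCoeff_sub m hw.cont (continuous_growMode m _ _), sinCoeff_growMode hm,
        sinCoeff_growMode hm, smul_sub, sub_add_sub_comm, ← hgp.2]
      simp only [hB, growSin, hkill, sub_self])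
    simp only [lap_sub_growMode] at hsrc
    have e1 : V 1 = cylEnergy m 0 L fun t θ => w t θ - growMode m (A 2) (B 2) t θ := by
      simp only [hV]
      norm_num
    have e3 : V 3 = cylEnergy m (2 * L) (3 * L)
        fun t θ => w t θ - growMode m (A 2) (B 2) t θ := by
      simp only [hV]
      norm_num
    have e2 : D 2 = cylEnergy m L (2 * L) fun t θ => w t θ - growMode m (A 2) (B 2) t θ := by
      rw [hDeq 2 m2]
      norm_num
    rw [e1, e2, e3]
    exact hsrc
  have hnu_eq : ∀ i ∈ Icc 1 3, nu m L i u = ENNReal.ofReal (D i / (s * g i)) := fun i hi => by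
    rw [nu, hstar, ENNReal.ofReal_div_of_pos (mul_pos hs0 (hgpos i hi))]
  have hbig : ∃ i ∈ Icc 1 3, ε * (s * g i) < D i := by
    have hone : ∀ i ∈ Icc 1 3, ENNReal.ofReal ε < nu m L i u → ε * (s * g i) < D i :=
      fun i hi h => by
        rw [hnu_eq i hi, ENNReal.ofReal_lt_ofReal_iff_of_nonneg hε.le,
          lt_div_iff₀ (mul_pos hs0 (hgpos i hi))] at h
        exact h
    rcases lt_max_iff.1 hnu with h | h
    · exact ⟨1, m1, hone 1 m1 h⟩
    · rcases lt_max_iff.1 h with h | h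
      · exact ⟨2, m2, hone 2 m2 h⟩
      · exact ⟨3, m3, hone 3 m3 h⟩
  obtain ⟨r1, r2⟩ := halg E g D V S hEpos hD0 hSle hEg hggs hVD hD2 hbig
  have hq0 : ∀ i ∈ Icc 1 3, 0 ≤ D i / (s * g i) := fun i hi =>
    div_nonneg (hD0 i hi) (mul_pos hs0 (hgpos i hi)).le
  constructor
  · change ENNReal.ofReal (D 2) ≤ ENNReal.ofReal μ * (ENNReal.ofReal (D 1) + ENNReal.ofReal (D 3))
    rw [← ENNReal.ofReal_add (hD0 1 m1) (hD0 3 m3), ← ENNReal.ofReal_mul (Real.exp_pos _).le]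
    exact ENNReal.ofReal_le_ofReal r1
  · change nu m L 2 u ≤ ENNReal.ofReal μ * (nu m L 1 u + nu m L 3 u)
    rw [hnu_eq 1 m1, hnu_eq 2 m2, hnu_eq 3 m3, ← ENNReal.ofReal_add (hq0 1 m1) (hq0 3 m3),
      ← ENNReal.ofReal_mul (Real.exp_pos _).le]
    exact ENNReal.ofReal_le_ofReal r2
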